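/- **Setting.** Let $\mu$ be a probability measure on $\mathbb R$ that is symmetric about $0$ and satisfies $\int |h|\,d\mu(h)<\infty$, and let $\theta>0$. For $S\subset[n]$ and $h\in\mathbb R^n$ let $$\mathbb P_S(\sigma\mid h)\ \propto\ \exp\Big(\frac{\theta}{2|S|}\Big(\sum_{i\in S}\sigma_i\Big)^2+\sum_{i=1}^n h_i\sigma_i\Big),\qquad \sigma\in\{-1,1\}^n,$$ and let $\mathbb P_S(\sigma)=\mathbb E_h[\mathbb P_S(\sigma\mid h)]$, where $h_1,\dots,h_n$ are i.i.d. with law $\mu$. Let $\mathbb P_0$ be the law obtained in the same way without the quadratic interaction term. One observes $m$ i.i.d. samples $\sigma^{(1)},\dots,\sigma^{(m)}$ (the fields are not observed), drawn from $\mathbb P_0$ under the null hypothesis, and from $\mathbb P_S$ for some unknown $S\subset[n]$ with $|S|=k$ under the alternative. For a (possibly randomized) test $\psi$ with values in $[0,1]$ put $$R(\psi)=\mathbb E_{\mathbb P_0^{\otimes m}}[\psi]+\sup_{|S|=k}\mathbb E_{\mathbb P_S^{\otimes m}}[1-\psi].$$ Detection is called *impossible* (all tests are asymptotically powerless) along a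 sequence $(k,m)=(k_n,m_n)$ if $\inf_\psi R(\psi)\to1$ as $n\to\infty$. **Assumptions.** The temperature is critical, $\theta=1/\mathbb E[\operatorname{sech}^2(h)]$, and $0$ is the unique global minimum, with flatness $\tau$, of $$G(x)=\frac{x^2}{2}-\mathbb E\big[\log\cosh(\sqrt{\theta}\,x+h)\big],$$ that is, $\tau\ge 1$ is an integer, $G(x)>G(0)$ for $x\ne0$, $G^{(j)}(0)=0$ for $1\le j<2\tau$, and $G^{(2\tau)}(0)>0$. **Theorem.** Write $$A=n^2k^{-\frac{2(4\tau-3)}{2\tau-1}},\qquad B=\Big(\frac{k}{\log k}\Big)^{\frac1{2\tau-1}}\log n .$$ 1. If $n^{\frac{4\tau-2}{8\tau-5}}\lesssim k\lesssim n^{\frac{2\tau-1}{4\tau-3}}$ and $m=o(A)$, then detection is impossible. 2. If $k\lesssim n^{\frac{4\tau-2}{8\tau-5}}/\log n$ and $m=o(B)$, then detection is impossible. 3. More generally, if $k=o\big(n^{\frac{4\tau-2}{8\tau-5}}\big)$ and $m=o(\min(A,B))$, then detection is impossible. -/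

import Mathlib

open MeasureTheory Filter Asymptotics Topology

noncomputable section

/-- The two values of a spin: `true` is `+1`, `false` is `-1`. -/
def spin (b : Bool) : ℝ := if b then 1 else -1

/-- Gibbs weight of the configuration `σ` of `n` spins: Curie-Weiss interaction of strength `θ` on
the clique `S`, external field `h` on all sites. -/
def gibbsWeight {n : ℕ} (θ : ℝ) (S : Finset (Fin n)) (h : Fin n → ℝ) (σ : Fin n → Bool) : ℝ :=
  Real.exp (θ / (2 * (S.card : ℝ)) * (∑ i ∈ S, spin (σ i)) ^ 2 + ∑ i, h i * spin (σ i))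

/-- Conditional law `ℙ_S(σ | h)` of the spins given the field. -/
def quenchedLaw {n : ℕ} (θ : ℝ) (S : Finset (Fin n)) (h : Fin n → ℝ) (σ : Fin n → Bool) : ℝ :=
  gibbsWeight θ S h σ / ∑ σ' : Fin n → Bool, gibbsWeight θ S h σ'

/-- Law `ℙ_S(σ)` of one observation: the field has i.i.d. coordinates of law `μ` and is not
observed. -/
def plantedLaw {n : ℕ} (μ : Measure ℝ) (θ : ℝ) (S : Finset (Fin n)) (σ : Fin n → Bool) : ℝ :=
  ∫ h, quenchedLaw θ S h σ ∂(Measure.pi fun _ : Fin n => μ)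

/-- Law `ℙ_0(σ)` of one observation under the null hypothesis: no clique, no interaction. -/
def nullLaw {n : ℕ} (μ : Measure ℝ) (σ : Fin n → Bool) : ℝ :=
  plantedLaw μ 0 (∅ : Finset (Fin n)) σ

/-- A (possibly randomized) test based on `m` observations: the probability of rejecting the null
hypothesis as a function of the data. Nonrandomized tests are those with values in `{0, 1}`. -/
def DetectionTest (n m : ℕ) : Type :=
  {ψ : (Fin m → Fin n → Bool) → ℝ // ∀ x, ψ x ∈ Set.Icc (0 : ℝ) 1}

/-- Type I error of a test, from `m` i.i.d. observations. -/
def typeIError {n m : ℕ} (μ : Measure ℝ) (ψ : DetectionTest n m) : ℝ :=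
  ∑ x : Fin m → Fin n → Bool, (∏ j, nullLaw μ (x j)) * ψ.1 x

/-- Type II error of a test when the clique is `S`, from `m` i.i.d. observations. -/
def typeIIError {n m : ℕ} (μ : Measure ℝ) (θ : ℝ) (S : Finset (Fin n))
    (ψ : DetectionTest n m) : ℝ :=
  ∑ x : Fin m → Fin n → Bool, (∏ j, plantedLaw μ θ S (x j)) * (1 - ψ.1 x)

/-- Type I error plus the worst type II error over all cliques of size `k`. -/
def testRisk {n m : ℕ} (μ : Measure ℝ) (θ : ℝ) (k : ℕ) (ψ : DetectionTest n m) : ℝ :=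
  typeIError μ ψ + ⨆ S : {S : Finset (Fin n) // S.card = k}, typeIIError μ θ S.1 ψ

/-- The smallest risk of a test for a hidden clique of size `k` among `n` spins from `m`
observations. -/
def minimaxRisk (μ : Measure ℝ) (θ : ℝ) (n k m : ℕ) : ℝ :=
  ⨅ ψ : DetectionTest n m, testRisk μ θ k ψ

/-- The mean-field functional `x ↦ x² / 2 - 𝔼[log cosh (√θ x + h)]`, `h ∼ μ`. -/
def meanFieldFunctional (μ : Measure ℝ) (θ : ℝ) (x : ℝ) : ℝ :=
  x ^ 2 / 2 - ∫ h, Real.log (Real.cosh (√θ * x + h)) ∂μ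

/-- `0` is the unique global minimum of `G`, with flatness `τ`: the expansion of `G` at `0` is
`G 0 + c x ^ (2 τ) + O(x ^ (2 τ + 1))` with `c > 0`. -/
structure IsGlobalMinWithFlatness (G : ℝ → ℝ) (τ : ℕ) : Prop where
  pos : 1 ≤ τ
  lt_of_ne : ∀ x, x ≠ 0 → G 0 < G x
  iteratedDeriv_eq_zero : ∀ j, 1 ≤ j → j < 2 * τ → iteratedDeriv j G 0 = 0
  iteratedDeriv_pos : 0 < iteratedDeriv (2 * τ) G 0

/-- The rate `n² k ^ (-2(4τ-3)/(2τ-1))`. -/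
def globalRate (τ n k : ℕ) : ℝ :=
  (n : ℝ) ^ 2 * (k : ℝ) ^ (-(2 * (4 * (τ : ℝ) - 3) / (2 * (τ : ℝ) - 1)))

/-- The rate `(k / log k) ^ (1/(2τ-1)) log n`. -/
def localRate (τ n k : ℕ) : ℝ :=
  ((k : ℝ) / Real.log (k : ℝ)) ^ (1 / (2 * (τ : ℝ) - 1)) * Real.log (n : ℝ)

end

/-!
Put `γ = 1 / (2τ - 1)`; criticality forces `τ ≥ 2`, hence `γ ≤ 1 / 3`.

By the Hubbard–Stratonovich transform, the average spin of the clique given the field is governed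
by a one-dimensional integral of `exp (-k G(x))`, up to field fluctuations of order `√k |x|` in the
exponent. Since `G` grows like `x ^ (2τ)`, the two terms balance at `x² = k ^ (-γ)`, and the squared
average spin has uniform exponential moments on this scale.

By symmetry of `μ` the law `P_0` is uniform, and the second moment of the likelihood ratio of the
mixture over cliques is an average of overlap products `∑ σ, P_S σ * P_S' σ / P_0 σ`. In the Walsh
basis, and by spin-flip symmetry, such a product exceeds `1` by at most a multiple of
`(|S ∩ S'| k ^ (-γ))²` when this is small. For larger overlaps one truncates to the event that the
squared average spins of the `m` samples sum to at most a multiple of `m k ^ (-γ)`; there the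
contribution is exponential in `m |S ∩ S'| k ^ (-γ)`. The overlap of two uniform cliques is
hypergeometric and has the tail of a Poisson variable of mean `k² / n`: typical overlaps are
harmless when `m = o(n² k ^ (2γ - 4))`, large ones when `m = o(k ^ γ log n)`.
-/

section LogCosh

/-- The free energy `log cosh` of a single spin, as a function of its field. -/
noncomputable def logCosh (x : ℝ) : ℝ := Real.log (Real.cosh x)

theorem contDiff_logCosh (r : WithTop ℕ∞) : ContDiff ℝ r logCosh :=
  Real.contDiff_cosh.log fun x => (Real.cosh_pos x).ne'

theorem deriv_logCosh : deriv logCosh = Real.tanh := by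
  ext x
  rw [Real.tanh_eq_sinh_div_cosh]
  exact ((Real.hasDerivAt_cosh x).log (Real.cosh_pos x).ne').deriv

theorem hasDerivAt_iteratedDeriv_logCosh (j : ℕ) (x : ℝ) :
    HasDerivAt (iteratedDeriv j logCosh) (iteratedDeriv (j + 1) logCosh x) x := by
  rw [iteratedDeriv_succ]
  exact ((contDiff_logCosh ⊤).differentiable_iteratedDeriv j
    (WithTop.coe_lt_top _) x).hasDerivAt

theorem continuous_iteratedDeriv_logCosh (j : ℕ) : Continuous (iteratedDeriv j logCosh) :=
  (contDiff_logCosh ⊤).continuous_iteratedDeriv j le_top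

theorem hasDerivAt_tanh (x : ℝ) : HasDerivAt Real.tanh (1 - Real.tanh x ^ 2) x := by
  have hc := (Real.cosh_pos x).ne'
  have htanh : Real.tanh = Real.sinh / Real.cosh := funext Real.tanh_eq_sinh_div_cosh
  rw [htanh]
  refine ((Real.hasDerivAt_sinh x).div (Real.hasDerivAt_cosh x) hc).congr_deriv ?_
  simp only [Pi.div_apply]
  field_simp

theorem one_sub_tanh_sq (x : ℝ) : 1 - Real.tanh x ^ 2 = 1 / Real.cosh x ^ 2 := by
  have hc := (Real.cosh_pos x).ne'
  rw [Real.tanh_eq_sinh_div_cosh]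
  field_simp
  linarith [Real.cosh_sq x]

theorem iteratedDeriv_two_logCosh : iteratedDeriv 2 logCosh = fun x => 1 / Real.cosh x ^ 2 := by
  ext x
  rw [iteratedDeriv_succ, iteratedDeriv_one, deriv_logCosh, (hasDerivAt_tanh x).deriv,
    one_sub_tanh_sq]

theorem exists_iteratedDeriv_logCosh_eq_eval_tanh (j : ℕ) :
    ∃ p : Polynomial ℝ, iteratedDeriv (j + 1) logCosh = fun x => p.eval (Real.tanh x) := by
  induction j with
  | zero => exact ⟨Polynomial.X, by simp [iteratedDeriv_one, deriv_logCosh]⟩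
  | succ j ih =>
    obtain ⟨p, hp⟩ := ih
    refine ⟨p.derivative * (1 - Polynomial.X ^ 2), ?_⟩
    ext x
    rw [iteratedDeriv_succ, hp]
    exact ((p.hasDerivAt (Real.tanh x)).comp x (hasDerivAt_tanh x)).deriv.trans (by simp)

theorem exists_abs_iteratedDeriv_logCosh_le (j : ℕ) :
    ∃ C, ∀ x, |iteratedDeriv (j + 1) logCosh x| ≤ C := by
  obtain ⟨p, hp⟩ := exists_iteratedDeriv_logCosh_eq_eval_tanh j
  obtain ⟨C, hC⟩ := (isCompact_Icc (a := (-1 : ℝ)) (b := 1)).exists_bound_of_continuousOn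
    p.continuous.continuousOn
  exact ⟨C, fun x => hp ▸ hC _ (abs_le.1 (Real.abs_tanh_lt_one x).le)⟩

theorem abs_logCosh_sub_le (x y : ℝ) : |logCosh x - logCosh y| ≤ |x - y| := by
  simpa using Convex.norm_image_sub_le_of_norm_deriv_le (f := logCosh) (C := 1)
    (fun x _ => (contDiff_logCosh 1).differentiable one_ne_zero x)
    (fun x _ => by simpa [deriv_logCosh] using (Real.abs_tanh_lt_one x).le)
    convex_univ (Set.mem_univ y) (Set.mem_univ x)

end LogCosh

section MeanField

variable {μ : Measure ℝ} [IsFiniteMeasure μ]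

theorem integrable_iteratedDeriv_logCosh_add (hint : Integrable (fun h : ℝ => h) μ) (j : ℕ)
    (c : ℝ) : Integrable (fun h => iteratedDeriv j logCosh (c + h)) μ := by
  have hmeas : AEStronglyMeasurable (fun h => iteratedDeriv j logCosh (c + h)) μ :=
    ((continuous_iteratedDeriv_logCosh j).comp (by fun_prop)).aestronglyMeasurable
  cases j with
  | zero =>
    refine ((integrable_const c).add hint).norm.mono' hmeas (Eventually.of_forall fun h => ?_)
    simpa [logCosh] using abs_logCosh_sub_le (c + h) 0
  | succ j =>
    obtain ⟨C, hC⟩ := exists_abs_iteratedDeriv_logCosh_le j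
    exact (integrable_const C).mono' hmeas (Eventually.of_forall fun h => hC _)

theorem hasDerivAt_integral_comp_mul_add {f f' : ℝ → ℝ} (hf : ∀ x, HasDerivAt f (f' x) x) {C : ℝ}
    (hC : ∀ x, |f' x| ≤ C) (a : ℝ) {x : ℝ} (hint : Integrable (fun h => f (a * x + h)) μ) :
    HasDerivAt (fun x => ∫ h, f (a * x + h) ∂μ) (a * ∫ h, f' (a * x + h) ∂μ) x := by
  have hcont : Continuous f := continuous_iff_continuousAt.2 fun x => (hf x).continuousAt
  have hmeas : Measurable f' := (funext fun x => (hf x).deriv : deriv f = f') ▸ measurable_deriv f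
  have hderiv (h y : ℝ) : HasDerivAt (fun y => f (a * y + h)) (a * f' (a * y + h)) y := by
    have hlin : HasDerivAt (fun y => a * y + h) a y := by
      simpa using ((hasDerivAt_id y).const_mul a).add_const h
    exact ((hf (a * y + h)).comp y hlin).congr_deriv (mul_comm _ _)
  rw [← integral_const_mul]
  refine (hasDerivAt_integral_of_dominated_loc_of_deriv_le (bound := fun _ => |a| * C)
    Filter.univ_mem (Eventually.of_forall fun y => ?_) hint ?_
    (Eventually.of_forall fun h y _ => ?_) (integrable_const _)
    (Eventually.of_forall fun h y _ => hderiv h y)).2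
  · exact (hcont.comp (by fun_prop)).aestronglyMeasurable
  · exact ((hmeas.comp (measurable_const.add measurable_id)).const_mul a).aestronglyMeasurable
  · rw [norm_mul]
    exact mul_le_mul_of_nonneg_left (hC _) (abs_nonneg a)

/-- The derivative of order `j` of the annealed free energy `x ↦ 𝔼[log cosh (a x + h)]`, `h ∼ μ`,
written as an expectation. -/
noncomputable def logCoshMean (μ : Measure ℝ) (a : ℝ) (j : ℕ) (x : ℝ) : ℝ :=
  a ^ j * ∫ h, iteratedDeriv j logCosh (a * x + h) ∂μ

theorem hasDerivAt_logCoshMean (hint : Integrable (fun h : ℝ => h) μ) (a : ℝ) (j : ℕ) (x : ℝ) :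
    HasDerivAt (logCoshMean μ a j) (logCoshMean μ a (j + 1) x) x := by
  obtain ⟨C, hC⟩ := exists_abs_iteratedDeriv_logCosh_le j
  refine ((hasDerivAt_integral_comp_mul_add (hasDerivAt_iteratedDeriv_logCosh j) hC a
    (integrable_iteratedDeriv_logCosh_add hint j (a * x))).const_mul (a ^ j)).congr_deriv ?_
  rw [logCoshMean]
  ring

theorem continuous_logCoshMean (hint : Integrable (fun h : ℝ => h) μ) (a : ℝ) (j : ℕ) :
    Continuous (logCoshMean μ a j) :=
  continuous_iff_continuousAt.2 fun x => (hasDerivAt_logCoshMean hint a j x).continuousAt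

theorem iteratedDeriv_logCoshMean (hint : Integrable (fun h : ℝ => h) μ) (a : ℝ) (j : ℕ) :
    iteratedDeriv j (logCoshMean μ a 0) = logCoshMean μ a j := by
  induction j with
  | zero => exact iteratedDeriv_zero
  | succ j ih =>
    rw [iteratedDeriv_succ, ih]
    exact funext fun x => (hasDerivAt_logCoshMean hint a j x).deriv

theorem contDiff_logCoshMean (hint : Integrable (fun h : ℝ => h) μ) (a : ℝ) (r : ℕ) :
    ContDiff ℝ r (logCoshMean μ a 0) := by
  refine contDiff_of_differentiable_iteratedDeriv fun j _ => ?_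
  rw [iteratedDeriv_logCoshMean hint]
  exact fun x => (hasDerivAt_logCoshMean hint a j x).differentiableAt

theorem meanFieldFunctional_eq (μ : Measure ℝ) (θ : ℝ) :
    meanFieldFunctional μ θ = fun x => x ^ 2 / 2 - logCoshMean μ √θ 0 x := by
  simp [funext_iff, meanFieldFunctional, logCoshMean, logCosh]

theorem contDiff_meanFieldFunctional (hint : Integrable (fun h : ℝ => h) μ) (θ : ℝ) (r : ℕ) :
    ContDiff ℝ r (meanFieldFunctional μ θ) := by
  rw [meanFieldFunctional_eq]
  exact ContDiff.sub (by fun_prop) (contDiff_logCoshMean hint _ r)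

theorem iteratedDeriv_two_meanFieldFunctional (hint : Integrable (fun h : ℝ => h) μ) {θ : ℝ}
    (hθ : 0 ≤ θ) :
    iteratedDeriv 2 (meanFieldFunctional μ θ) 0 = 1 - θ * ∫ h, 1 / Real.cosh h ^ 2 ∂μ := by
  have hderiv : deriv (meanFieldFunctional μ θ) = fun x => x - logCoshMean μ √θ 1 x := by
    rw [meanFieldFunctional_eq]
    ext x
    refine (((hasDerivAt_pow 2 x).div_const 2).sub
      (hasDerivAt_logCoshMean hint √θ 0 x)).deriv.trans ?_
    simp
  rw [iteratedDeriv_succ, iteratedDeriv_one, hderiv]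
  refine ((hasDerivAt_id (0 : ℝ)).sub (hasDerivAt_logCoshMean hint √θ 1 0)).deriv.trans ?_
  simp [logCoshMean, iteratedDeriv_two_logCosh, Real.sq_sqrt hθ]

theorem integral_sech_sq_pos [NeZero μ] : 0 < ∫ h, 1 / Real.cosh h ^ 2 ∂μ := by
  have hint : Integrable (fun h : ℝ => 1 / Real.cosh h ^ 2) μ := by
    have hcont : Continuous fun h : ℝ => 1 / Real.cosh h ^ 2 :=
      continuous_const.div (Real.continuous_cosh.pow 2) fun h => (pow_pos (Real.cosh_pos h) 2).ne'
    refine (integrable_const 1).mono' hcont.aestronglyMeasurable (Eventually.of_forall fun h => ?_)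
    rw [Real.norm_of_nonneg (by positivity)]
    exact div_le_one_of_le₀ (one_le_pow₀ (Real.one_le_cosh h)) (by positivity)
  rw [integral_pos_iff_support_of_nonneg (fun h => by positivity) hint]
  have hsupp : Function.support (fun h : ℝ => 1 / Real.cosh h ^ 2) = Set.univ := by
    ext h
    simp [(Real.cosh_pos h).ne']
  rw [hsupp]
  exact NeZero.pos _

theorem critical_temperature_pos [NeZero μ] {θ : ℝ}
    (hcrit : θ = 1 / ∫ h, 1 / Real.cosh h ^ 2 ∂μ) : 0 < θ :=
  hcrit ▸ one_div_pos.2 integral_sech_sq_pos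

theorem two_le_flatness [NeZero μ] (hint : Integrable (fun h : ℝ => h) μ) {θ : ℝ}
    (hcrit : θ = 1 / ∫ h, 1 / Real.cosh h ^ 2 ∂μ) {τ : ℕ}
    (hflat : IsGlobalMinWithFlatness (meanFieldFunctional μ θ) τ) : 2 ≤ τ := by
  by_contra! hτ
  obtain rfl : τ = 1 := le_antisymm (Nat.lt_succ_iff.1 hτ) hflat.pos
  refine hflat.iteratedDeriv_pos.ne' ?_
  rw [iteratedDeriv_two_meanFieldFunctional hint (critical_temperature_pos hcrit).le, hcrit,
    one_div_mul_cancel integral_sech_sq_pos.ne', sub_self]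

end MeanField

section Flatness

variable {G : ℝ → ℝ} {τ : ℕ}

theorem IsGlobalMinWithFlatness.taylorWithinEval_eq (h : IsGlobalMinWithFlatness G τ) (x : ℝ) :
    taylorWithinEval G (2 * τ) Set.univ 0 x =
      G 0 + iteratedDeriv (2 * τ) G 0 / (2 * τ).factorial * x ^ (2 * τ) := by
  rw [taylor_within_apply, Finset.sum_range_succ, Finset.sum_eq_single_of_mem 0]
  · simp [iteratedDerivWithin_univ]
    ring
  · exact Finset.mem_range.2 (by have := h.pos; lia)
  · intro j hj hj0
    rw [iteratedDerivWithin_univ,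
      h.iteratedDeriv_eq_zero j (Nat.one_le_iff_ne_zero.2 hj0) (Finset.mem_range.1 hj), smul_zero]

theorem IsGlobalMinWithFlatness.exists_eventually_le_sub (h : IsGlobalMinWithFlatness G τ)
    (hG : ContDiff ℝ (2 * τ : ℕ) G) :
    ∃ c > 0, ∀ᶠ x in 𝓝 (0 : ℝ), c * x ^ (2 * τ) ≤ G x - G 0 := by
  set c := iteratedDeriv (2 * τ) G 0 / (2 * τ).factorial with hc
  have hcpos : 0 < c := div_pos h.iteratedDeriv_pos (by positivity)
  refine ⟨c / 2, half_pos hcpos, ?_⟩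
  filter_upwards [(taylor_isLittleO_univ (x₀ := 0) hG).def (half_pos hcpos)] with x hx
  rw [h.taylorWithinEval_eq, ← hc, sub_zero,
    Real.norm_of_nonneg ((even_two_mul τ).pow_nonneg x)] at hx
  linarith [(abs_le.1 hx).1]

theorem IsGlobalMinWithFlatness.exists_le_sub (h : IsGlobalMinWithFlatness G τ)
    (hG : ContDiff ℝ (2 * τ : ℕ) G) (X : ℝ) :
    ∃ c > 0, ∀ x, |x| ≤ X → c * x ^ (2 * τ) ≤ G x - G 0 := by
  obtain ⟨c, hc, hnear⟩ := h.exists_eventually_le_sub hG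
  obtain ⟨ε, hε, hball⟩ := Metric.eventually_nhds_iff_ball.1 hnear
  have hne {x : ℝ} (hx : x ∈ Metric.closedBall 0 X \ Metric.ball 0 ε) : x ≠ 0 := by
    rintro rfl
    exact hx.2 (Metric.mem_ball_self hε)
  obtain ⟨c', hc', hfar⟩ : ∃ c' > 0, ∀ x ∈ Metric.closedBall 0 X \ Metric.ball 0 ε,
      c' ≤ (G x - G 0) / x ^ (2 * τ) :=
    ((isCompact_closedBall 0 X).diff Metric.isOpen_ball).exists_forall_le'
      (((hG.continuous.sub continuous_const).continuousOn).div (by fun_prop)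
        fun x hx => pow_ne_zero _ (hne hx))
      fun x hx => div_pos (sub_pos.2 (h.lt_of_ne x (hne hx))) ((even_two_mul τ).pow_pos (hne hx))
  refine ⟨min c c', lt_min hc hc', fun x hx => ?_⟩
  have hpow : 0 ≤ x ^ (2 * τ) := (even_two_mul τ).pow_nonneg x
  by_cases hxε : x ∈ Metric.ball 0 ε
  · exact (mul_le_mul_of_nonneg_right (min_le_left _ _) hpow).trans (hball x hxε)
  · have hxmem : x ∈ Metric.closedBall 0 X \ Metric.ball 0 ε := ⟨by simpa using hx, hxε⟩
    exact (mul_le_mul_of_nonneg_right (min_le_right _ _) hpow).trans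
      ((le_div_iff₀ ((even_two_mul τ).pow_pos (hne hxmem))).1 (hfar x hxmem))

end Flatness

section BlockSum

theorem spin_not (b : Bool) : spin (!b) = -spin b := by cases b <;> simp [spin]

theorem spin_mul_self (b : Bool) : spin b * spin b = 1 := by cases b <;> simp [spin]

variable {ι : Type*}

/-- The total spin of the sites of `S`. -/
noncomputable def blockSum (S : Finset ι) (σ : ι → Bool) : ℝ :=
  ∑ i ∈ S, spin (σ i)

/-- The square of the average spin on `S`. -/
noncomputable def sqMagnetization (S : Finset ι) (σ : ι → Bool) : ℝ :=
  (blockSum S σ / S.card) ^ 2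

theorem sqMagnetization_nonneg (S : Finset ι) (σ : ι → Bool) : 0 ≤ sqMagnetization S σ :=
  sq_nonneg _

theorem blockSum_comp (S : Finset ι) (π : Equiv.Perm ι) (hπ : ∀ i, π i ∈ S ↔ i ∈ S)
    (σ : ι → Bool) : blockSum S (σ ∘ π) = blockSum S σ :=
  Finset.sum_equiv π (fun i => (hπ i).symm) fun _ _ => rfl

variable [DecidableEq ι]

/-- The configuration obtained by flipping the spins of `D`. -/
def flipSpins (D : Finset ι) (σ : ι → Bool) : ι → Bool :=
  fun i => if i ∈ D then !σ i else σ i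

theorem flipSpins_involutive (D : Finset ι) : Function.Involutive (flipSpins D) := fun σ => by
  ext i
  by_cases h : i ∈ D <;> simp [flipSpins, h]

theorem blockSum_flipSpins_of_disjoint {S D : Finset ι} (hSD : Disjoint S D) (σ : ι → Bool) :
    blockSum S (flipSpins D σ) = blockSum S σ :=
  Finset.sum_congr rfl fun i hi => by simp [flipSpins, Finset.disjoint_left.1 hSD hi]

theorem blockSum_flipSpins_univ [Fintype ι] (S : Finset ι) (σ : ι → Bool) :
    blockSum S (flipSpins Finset.univ σ) = -blockSum S σ := by
  simp [blockSum, flipSpins, spin_not]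

theorem sum_prod_exp_spin [Fintype ι] (h : ι → ℝ) :
    ∑ σ : ι → Bool, ∏ i, Real.exp (h i * spin (σ i)) = ∏ i, (2 * Real.cosh (h i)) := by
  rw [← Fintype.prod_sum fun i b => Real.exp (h i * spin b)]
  refine Finset.prod_congr rfl fun i _ => ?_
  rw [Fintype.sum_bool, Real.cosh_eq]
  simp only [spin, if_true, Bool.false_eq_true, if_false, mul_one, mul_neg]
  ring

end BlockSum

section GibbsMeasure

variable {n : ℕ} (θ : ℝ) (S : Finset (Fin n)) (h : Fin n → ℝ)

theorem gibbsWeight_eq (σ : Fin n → Bool) :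
    gibbsWeight θ S h σ = Real.exp (θ / (2 * (S.card : ℝ)) * blockSum S σ ^ 2) *
      ∏ i, Real.exp (h i * spin (σ i)) := by
  rw [gibbsWeight, Real.exp_add, Real.exp_sum, blockSum]

theorem gibbsWeight_pos (σ : Fin n → Bool) : 0 < gibbsWeight θ S h σ := Real.exp_pos _

theorem partition_pos : 0 < ∑ σ : Fin n → Bool, gibbsWeight θ S h σ :=
  Finset.sum_pos (fun σ _ => gibbsWeight_pos θ S h σ) Finset.univ_nonempty

theorem prod_cosh_le_partition {θ : ℝ} (hθ : 0 ≤ θ) :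
    ∏ i, (2 * Real.cosh (h i)) ≤ ∑ σ : Fin n → Bool, gibbsWeight θ S h σ := by
  rw [← sum_prod_exp_spin]
  refine Finset.sum_le_sum fun σ _ => ?_
  rw [gibbsWeight_eq]
  exact le_mul_of_one_le_left (by positivity) (Real.one_le_exp (by positivity))

theorem quenchedLaw_nonneg (σ : Fin n → Bool) : 0 ≤ quenchedLaw θ S h σ :=
  div_nonneg (gibbsWeight_pos θ S h σ).le (partition_pos θ S h).le

theorem sum_quenchedLaw : ∑ σ : Fin n → Bool, quenchedLaw θ S h σ = 1 := by
  simp only [quenchedLaw]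
  rw [← Finset.sum_div, div_self (partition_pos θ S h).ne']

theorem quenchedLaw_le_one (σ : Fin n → Bool) : quenchedLaw θ S h σ ≤ 1 :=
  (Finset.single_le_sum (fun σ _ => quenchedLaw_nonneg θ S h σ) (Finset.mem_univ σ)).trans_eq
    (sum_quenchedLaw θ S h)

theorem continuous_quenchedLaw (σ : Fin n → Bool) : Continuous fun h => quenchedLaw θ S h σ := by
  unfold quenchedLaw
  refine Continuous.div ?_ ?_ fun h => (partition_pos θ S h).ne' <;>
  · unfold gibbsWeight
    fun_prop

theorem quenchedLaw_equiv {θ : ℝ} {S : Finset (Fin n)} {h h' : Fin n → ℝ}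
    (e : (Fin n → Bool) ≃ (Fin n → Bool))
    (he : ∀ σ, gibbsWeight θ S h' (e σ) = gibbsWeight θ S h σ) (σ : Fin n → Bool) :
    quenchedLaw θ S h' (e σ) = quenchedLaw θ S h σ := by
  unfold quenchedLaw
  rw [he, ← Equiv.sum_comp e]
  simp only [he]

end GibbsMeasure

section PlantedLaw

variable {n : ℕ} {μ : Measure ℝ}

theorem plantedLaw_nonneg (μ : Measure ℝ) (θ : ℝ) (S : Finset (Fin n)) (σ : Fin n → Bool) :
    0 ≤ plantedLaw μ θ S σ :=
  integral_nonneg fun h => quenchedLaw_nonneg θ S h σ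

theorem integrable_quenchedLaw (μ : Measure ℝ) [IsFiniteMeasure μ] (θ : ℝ) (S : Finset (Fin n))
    (σ : Fin n → Bool) :
    Integrable (fun h => quenchedLaw θ S h σ) (Measure.pi fun _ : Fin n => μ) := by
  refine (integrable_const 1).mono' (continuous_quenchedLaw θ S σ).aestronglyMeasurable
    (Eventually.of_forall fun h => ?_)
  rw [Real.norm_of_nonneg (quenchedLaw_nonneg θ S h σ)]
  exact quenchedLaw_le_one θ S h σ

theorem sum_plantedLaw (μ : Measure ℝ) [IsProbabilityMeasure μ] (θ : ℝ) (S : Finset (Fin n)) :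
    ∑ σ : Fin n → Bool, plantedLaw μ θ S σ = 1 := by
  unfold plantedLaw
  rw [← integral_finsetSum _ fun σ _ => integrable_quenchedLaw μ θ S σ]
  simp [sum_quenchedLaw]

theorem plantedLaw_equiv {θ : ℝ} {S : Finset (Fin n)} {T : (Fin n → ℝ) → Fin n → ℝ}
    (hT : MeasurePreserving T (Measure.pi fun _ => μ) (Measure.pi fun _ => μ))
    (e : (Fin n → Bool) ≃ (Fin n → Bool))
    (he : ∀ h σ, gibbsWeight θ S (T h) (e σ) = gibbsWeight θ S h σ) (σ : Fin n → Bool) :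
    plantedLaw μ θ S (e σ) = plantedLaw μ θ S σ := by
  unfold plantedLaw
  conv_lhs => rw [← hT.map_eq]
  rw [integral_map hT.aemeasurable (continuous_quenchedLaw θ S _).aestronglyMeasurable]
  exact integral_congr_ae (Eventually.of_forall fun h => quenchedLaw_equiv e (he h) σ)

theorem measurePreserving_comp_perm [SigmaFinite μ] {ι : Type*} [Fintype ι] (π : Equiv.Perm ι) :
    MeasurePreserving (fun h : ι → ℝ => h ∘ π) (Measure.pi fun _ => μ) (Measure.pi fun _ => μ) := by
  convert measurePreserving_piCongrLeft (fun _ : ι => μ) π.symm using 1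
  ext h i
  simpa using (MeasurableEquiv.piCongrLeft_apply_apply π.symm (β := fun _ => ℝ) h (π i)).symm

theorem plantedLaw_comp (μ : Measure ℝ) [SigmaFinite μ] (θ : ℝ) (S : Finset (Fin n))
    (π : Equiv.Perm (Fin n)) (hπ : ∀ i, π i ∈ S ↔ i ∈ S) (σ : Fin n → Bool) :
    plantedLaw μ θ S (σ ∘ π) = plantedLaw μ θ S σ := by
  refine plantedLaw_equiv (measurePreserving_comp_perm π)
    (π.symm.arrowCongr (Equiv.refl Bool)) (fun h σ => ?_) σ
  have hcomp : π.symm.arrowCongr (Equiv.refl Bool) σ = σ ∘ π := rfl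
  rw [hcomp, gibbsWeight_eq, gibbsWeight_eq, blockSum_comp S π hπ]
  congr 1
  exact Equiv.prod_comp π fun i => Real.exp (h i * spin (σ i))

theorem measurePreserving_neg_on [SigmaFinite μ] (hsymm : μ.map (fun h : ℝ => -h) = μ)
    {ι : Type*} [Fintype ι] [DecidableEq ι] (D : Finset ι) :
    MeasurePreserving (fun (h : ι → ℝ) i => if i ∈ D then -h i else h i)
      (Measure.pi fun _ => μ) (Measure.pi fun _ => μ) := by
  refine measurePreserving_pi (fun _ => μ) (fun _ => μ)
    (f := fun i (x : ℝ) => if i ∈ D then -x else x) fun i => ?_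
  by_cases hi : i ∈ D
  · simpa only [hi, if_true] using ⟨measurable_neg, hsymm⟩
  · simp only [hi, if_false]
    exact MeasurePreserving.id μ

theorem plantedLaw_flipSpins [SigmaFinite μ] (hsymm : μ.map (fun h : ℝ => -h) = μ) (θ : ℝ)
    {S D : Finset (Fin n)} (hD : ∀ σ, blockSum S (flipSpins D σ) ^ 2 = blockSum S σ ^ 2)
    (σ : Fin n → Bool) : plantedLaw μ θ S (flipSpins D σ) = plantedLaw μ θ S σ := by
  refine plantedLaw_equiv (measurePreserving_neg_on hsymm D)
    (flipSpins_involutive D).toPerm (fun h σ => ?_) σ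
  rw [Function.Involutive.coe_toPerm, gibbsWeight_eq, gibbsWeight_eq, hD]
  congr 1
  refine Finset.prod_congr rfl fun i _ => ?_
  by_cases hi : i ∈ D <;> simp [flipSpins, hi, spin_not]

theorem plantedLaw_flipSpins_of_disjoint [SigmaFinite μ] (hsymm : μ.map (fun h : ℝ => -h) = μ)
    (θ : ℝ) {S D : Finset (Fin n)} (hSD : Disjoint S D) (σ : Fin n → Bool) :
    plantedLaw μ θ S (flipSpins D σ) = plantedLaw μ θ S σ :=
  plantedLaw_flipSpins hsymm θ (fun σ => by rw [blockSum_flipSpins_of_disjoint hSD]) σ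

theorem plantedLaw_flipSpins_univ [SigmaFinite μ] (hsymm : μ.map (fun h : ℝ => -h) = μ) (θ : ℝ)
    (S : Finset (Fin n)) (σ : Fin n → Bool) :
    plantedLaw μ θ S (flipSpins Finset.univ σ) = plantedLaw μ θ S σ :=
  plantedLaw_flipSpins hsymm θ (fun σ => by rw [blockSum_flipSpins_univ, neg_sq]) σ

end PlantedLaw

section NullLaw

variable {n : ℕ} {μ : Measure ℝ}

theorem exp_mul_spin_add_exp_mul_spin_not (b : Bool) (h : ℝ) :
    Real.exp (h * spin b) + Real.exp (h * spin !b) = 2 * Real.cosh h := by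
  cases b <;> simp [spin, Real.cosh_eq] <;> ring

theorem integrable_exp_mul_spin_div_cosh (μ : Measure ℝ) [IsFiniteMeasure μ] (b : Bool) :
    Integrable (fun h => Real.exp (h * spin b) / (2 * Real.cosh h)) μ := by
  have hcont : Continuous fun h => Real.exp (h * spin b) / (2 * Real.cosh h) :=
    Continuous.div (by fun_prop) (by fun_prop) fun h =>
      (mul_pos two_pos (Real.cosh_pos h)).ne'
  refine (integrable_const 1).mono' hcont.aestronglyMeasurable (Eventually.of_forall fun h => ?_)
  have hpos := mul_pos two_pos (Real.cosh_pos h)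
  rw [Real.norm_of_nonneg (by positivity), div_le_one hpos, ← exp_mul_spin_add_exp_mul_spin_not b]
  exact le_add_of_nonneg_right (Real.exp_pos _).le

theorem integral_exp_mul_spin_div_cosh [IsProbabilityMeasure μ]
    (hsymm : μ.map (fun h : ℝ => -h) = μ) (b : Bool) :
    ∫ h, Real.exp (h * spin b) / (2 * Real.cosh h) ∂μ = 1 / 2 := by
  have heq : ∫ h, Real.exp (h * spin b) / (2 * Real.cosh h) ∂μ =
      ∫ h, Real.exp (h * spin !b) / (2 * Real.cosh h) ∂μ := by
    have hneg : MeasurePreserving (fun h : ℝ => -h) μ μ := ⟨measurable_neg, hsymm⟩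
    rw [← hneg.integral_comp (MeasurableEquiv.neg ℝ).measurableEmbedding]
    simp [spin_not]
  have hadd : ∫ h, Real.exp (h * spin b) / (2 * Real.cosh h) ∂μ +
      ∫ h, Real.exp (h * spin !b) / (2 * Real.cosh h) ∂μ = 1 := by
    rw [← integral_add (integrable_exp_mul_spin_div_cosh μ b)
      (integrable_exp_mul_spin_div_cosh μ !b)]
    have hone (h : ℝ) : Real.exp (h * spin b) / (2 * Real.cosh h) +
        Real.exp (h * spin !b) / (2 * Real.cosh h) = 1 := by
      rw [← add_div, exp_mul_spin_add_exp_mul_spin_not,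
        div_self (mul_pos two_pos (Real.cosh_pos h)).ne']
    simp [hone]
  linarith

theorem integral_prod_exp_mul_spin_div_cosh [IsProbabilityMeasure μ]
    (hsymm : μ.map (fun h : ℝ => -h) = μ) (σ : Fin n → Bool) :
    ∫ h, ∏ i, (Real.exp (h i * spin (σ i)) / (2 * Real.cosh (h i)))
      ∂(Measure.pi fun _ : Fin n => μ) = (1 / 2) ^ n := by
  rw [integral_fintype_prod_eq_prod (𝕜 := ℝ)
    (fun i (x : ℝ) => Real.exp (x * spin (σ i)) / (2 * Real.cosh x))]
  simp [integral_exp_mul_spin_div_cosh hsymm]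

theorem nullLaw_eq [IsProbabilityMeasure μ] (hsymm : μ.map (fun h : ℝ => -h) = μ)
    (σ : Fin n → Bool) : nullLaw μ σ = (1 / 2) ^ n := by
  have hweight (h : Fin n → ℝ) (σ : Fin n → Bool) :
      gibbsWeight 0 ∅ h σ = ∏ i, Real.exp (h i * spin (σ i)) := by simp [gibbsWeight_eq]
  rw [← integral_prod_exp_mul_spin_div_cosh hsymm σ]
  simp only [nullLaw, plantedLaw, quenchedLaw, hweight, sum_prod_exp_spin, Finset.prod_div_distrib]

theorem plantedLaw_le [IsProbabilityMeasure μ] (hsymm : μ.map (fun h : ℝ => -h) = μ) {θ : ℝ}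
    (hθ : 0 ≤ θ) (S : Finset (Fin n)) (σ : Fin n → Bool) :
    plantedLaw μ θ S σ ≤
      (1 / 2) ^ n * Real.exp (θ / (2 * (S.card : ℝ)) * blockSum S σ ^ 2) := by
  rw [← integral_prod_exp_mul_spin_div_cosh hsymm σ, ← integral_mul_const]
  refine integral_mono (integrable_quenchedLaw μ θ S σ) (Integrable.mul_const ?_ _) fun h => ?_
  · exact Integrable.fintype_prod (f := fun i (x : ℝ) =>
      Real.exp (x * spin (σ i)) / (2 * Real.cosh x)) fun i =>
        integrable_exp_mul_spin_div_cosh μ (σ i)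
  · have hpos : 0 < ∏ i, (2 * Real.cosh (h i)) :=
      Finset.prod_pos fun i _ => mul_pos two_pos (Real.cosh_pos _)
    refine (div_le_div_of_nonneg_left (gibbsWeight_pos θ S h σ).le hpos
      (prod_cosh_le_partition S h hθ)).trans_eq ?_
    rw [gibbsWeight_eq, Finset.prod_div_distrib]
    ring

end NullLaw

section Walsh

variable {ι : Type*}

/-- The Walsh character `σ ↦ ∏ i ∈ J, σ i` on configurations of spins. -/
noncomputable def walsh (J : Finset ι) (σ : ι → Bool) : ℝ :=
  ∏ i ∈ J, spin (σ i)

theorem sum_walsh_mul_walsh [Fintype ι] (σ σ' : ι → Bool) :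
    ∑ J : Finset ι, walsh J σ * walsh J σ' = if σ = σ' then 2 ^ Fintype.card ι else 0 := by
  simp only [walsh, ← Finset.prod_mul_distrib]
  rw [← Finset.powerset_univ, ← Finset.prod_one_add]
  split_ifs with h
  · subst h
    simp [spin_mul_self, one_add_one_eq_two]
  · obtain ⟨i, hi⟩ := Function.ne_iff.1 h
    refine Finset.prod_eq_zero (Finset.mem_univ i) ?_
    rw [Bool.eq_not.2 hi, spin_not, neg_mul, spin_mul_self, add_neg_cancel]

variable [DecidableEq ι]

theorem walsh_insert {i : ι} {J : Finset ι} (hi : i ∉ J) (σ : ι → Bool) :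
    walsh (insert i J) σ = spin (σ i) * walsh J σ :=
  Finset.prod_insert hi

theorem spin_mul_walsh_of_mem {i : ι} {J : Finset ι} (hi : i ∈ J) (σ : ι → Bool) :
    spin (σ i) * walsh J σ = walsh (J.erase i) σ := by
  rw [walsh, ← Finset.mul_prod_erase J _ hi, ← mul_assoc, spin_mul_self, one_mul, walsh]

theorem walsh_flipSpins (J D : Finset ι) (σ : ι → Bool) :
    walsh J (flipSpins D σ) = (-1) ^ (J ∩ D).card * walsh J σ := by
  have hspin (i : ι) : spin (flipSpins D σ i) = (if i ∈ D then -1 else 1) * spin (σ i) := by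
    by_cases hi : i ∈ D <;> simp [flipSpins, hi, spin_not]
  simp only [walsh, hspin, Finset.prod_mul_distrib, Finset.prod_ite, Finset.filter_mem_eq_inter,
    Finset.prod_const, one_pow, mul_one]

theorem blockSum_mul_walsh {S J : Finset ι} (hJ : J ⊆ S) (σ : ι → Bool) :
    blockSum S σ * walsh J σ =
      ∑ i ∈ S \ J, walsh (insert i J) σ + ∑ i ∈ J, walsh (J.erase i) σ := by
  rw [blockSum, ← Finset.sum_sdiff hJ, add_mul, Finset.sum_mul, Finset.sum_mul]
  congr 1
  · exact Finset.sum_congr rfl fun i hi => (walsh_insert (Finset.mem_sdiff.1 hi).2 σ).symm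
  · exact Finset.sum_congr rfl fun i hi => spin_mul_walsh_of_mem hi σ

variable [Fintype ι]

/-- The Walsh coefficient of a weight on configurations. -/
noncomputable def walshCoeff (w : (ι → Bool) → ℝ) (J : Finset ι) : ℝ :=
  ∑ σ, w σ * walsh J σ

theorem walshCoeff_empty (w : (ι → Bool) → ℝ) : walshCoeff w ∅ = ∑ σ, w σ := by
  simp [walshCoeff, walsh]

theorem two_pow_mul_sum_mul_eq_sum_walshCoeff (F H : (ι → Bool) → ℝ) :
    2 ^ Fintype.card ι * ∑ σ, F σ * H σ = ∑ J : Finset ι, walshCoeff F J * walshCoeff H J := by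
  have hinner (σ σ' : ι → Bool) : ∑ J : Finset ι, F σ * walsh J σ * (H σ' * walsh J σ') =
      if σ = σ' then 2 ^ Fintype.card ι * (F σ * H σ') else 0 := by
    simp only [mul_mul_mul_comm (F σ), ← Finset.mul_sum, sum_walsh_mul_walsh, mul_ite, mul_zero,
      mul_comm]
  simp only [walshCoeff, Finset.sum_mul_sum]
  rw [Finset.sum_comm, Finset.mul_sum]
  refine Finset.sum_congr rfl fun σ _ => ?_
  rw [Finset.sum_comm]
  simp only [hinner, Finset.sum_ite_eq, Finset.mem_univ, if_true]

theorem walshCoeff_eq_zero_of_flipSpins {w : (ι → Bool) → ℝ} {D J : Finset ι}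
    (hw : ∀ σ, w (flipSpins D σ) = w σ) (hJ : Odd (J ∩ D).card) : walshCoeff w J = 0 := by
  have hsum := Equiv.sum_comp (flipSpins_involutive D).toPerm fun σ => w σ * walsh J σ
  simp only [Function.Involutive.coe_toPerm, hw, walsh_flipSpins, hJ.neg_one_pow, neg_mul, one_mul,
    mul_neg, Finset.sum_neg_distrib] at hsum
  exact self_eq_neg.1 hsum.symm

end Walsh

section SwapInvariant

variable {ι : Type*} [DecidableEq ι] {S J : Finset ι} {w : (ι → Bool) → ℝ}

/-- Invariance of a weight on configurations under exchange of two sites of `S`; such weights only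
see how many sites of `S` a Walsh character charges. -/
def SwapInvariant (S : Finset ι) (w : (ι → Bool) → ℝ) : Prop :=
  ∀ i ∈ S, ∀ j ∈ S, ∀ σ, w (σ ∘ Equiv.swap i j) = w σ

theorem swap_mem_iff {i j : ι} (hi : i ∈ S) (hj : j ∈ S) (l : ι) :
    Equiv.swap i j l ∈ S ↔ l ∈ S := by
  rcases eq_or_ne l i with rfl | hli
  · simp [hi, hj]
  rcases eq_or_ne l j with rfl | hlj
  · simp [hi, hj]
  · rw [Equiv.swap_apply_of_ne_of_ne hli hlj]

theorem SwapInvariant.mul_blockSum (hw : SwapInvariant S w) (f : ℝ → ℝ) :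
    SwapInvariant S fun σ => w σ * f (blockSum S σ) := by
  intro i hi j hj σ
  simp only [hw i hi j hj, blockSum_comp S (Equiv.swap i j) (swap_mem_iff hi hj)]

theorem walsh_insert_comp_swap {i j : ι} (hi : i ∉ J) (hj : j ∉ J) (σ : ι → Bool) :
    walsh (insert i J) (σ ∘ Equiv.swap i j) = walsh (insert j J) σ := by
  rw [walsh_insert hi, walsh_insert hj, Function.comp_apply, Equiv.swap_apply_left]
  congr 1
  refine Finset.prod_congr rfl fun l hl => ?_
  rw [Function.comp_apply, Equiv.swap_apply_of_ne_of_ne (ne_of_mem_of_not_mem hl hi)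
    (ne_of_mem_of_not_mem hl hj)]

variable [Fintype ι]

theorem SwapInvariant.walshCoeff_insert (hw : SwapInvariant S w) {i j : ι} (hi : i ∈ S \ J)
    (hj : j ∈ S \ J) : walshCoeff w (insert i J) = walshCoeff w (insert j J) := by
  rw [Finset.mem_sdiff] at hi hj
  rw [walshCoeff, ← Equiv.sum_comp ((Equiv.swap i j).arrowCongr (Equiv.refl Bool))]
  refine Finset.sum_congr rfl fun σ _ => ?_
  have hcomp : (Equiv.swap i j).arrowCongr (Equiv.refl Bool) σ = σ ∘ Equiv.swap i j := rfl
  rw [hcomp, hw i hi.1 j hj.1, walsh_insert_comp_swap hi.2 hj.2]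

theorem SwapInvariant.card_sub_mul_walshCoeff_insert (hw : SwapInvariant S w) (hJ : J ⊆ S)
    {i : ι} (hi : i ∈ S \ J) :
    ((S.card : ℝ) - J.card) * walshCoeff w (insert i J) =
      walshCoeff (fun σ => w σ * blockSum S σ) J - ∑ j ∈ J, walshCoeff w (J.erase j) := by
  have hconst : ∑ l ∈ S \ J, walshCoeff w (insert l J) =
      ((S.card : ℝ) - J.card) * walshCoeff w (insert i J) := by
    rw [Finset.sum_congr rfl fun l hl => hw.walshCoeff_insert hl hi, Finset.sum_const,
      nsmul_eq_mul, Finset.card_sdiff_of_subset hJ, Nat.cast_sub (Finset.card_le_card hJ)]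
  rw [← hconst]
  simp only [walshCoeff]
  rw [Finset.sum_comm, Finset.sum_comm (s := J), ← Finset.sum_sub_distrib]
  refine Finset.sum_congr rfl fun σ _ => ?_
  rw [mul_assoc, blockSum_mul_walsh hJ, mul_add, Finset.mul_sum, Finset.mul_sum,
    add_sub_cancel_right]

end SwapInvariant

section WalshScale

variable {ι : Type*}

/-- The size of a Walsh character of degree at most `R`, averaged over the configurations with the
magnetization of `σ` on `S`. -/
noncomputable def walshScale (S : Finset ι) (R : ℝ) (σ : ι → Bool) : ℝ :=
  4 * √(sqMagnetization S σ + R / S.card)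

theorem walshScale_nonneg (S : Finset ι) (R : ℝ) (σ : ι → Bool) : 0 ≤ walshScale S R σ := by
  unfold walshScale
  positivity

theorem walshScale_sq (S : Finset ι) {R : ℝ} (hR : 0 ≤ R) (σ : ι → Bool) :
    walshScale S R σ ^ 2 = 16 * (sqMagnetization S σ + R / S.card) := by
  have hM := sqMagnetization_nonneg S σ
  rw [walshScale, mul_pow, Real.sq_sqrt (by positivity)]
  norm_num

variable {S : Finset ι} {R : ℝ}

theorem abs_blockSum_le_walshScale (hS : S.Nonempty) (hR : 0 ≤ R) (σ : ι → Bool) :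
    |blockSum S σ| ≤ S.card * walshScale S R σ / 4 := by
  have hk : (0 : ℝ) < S.card := by exact_mod_cast hS.card_pos
  have habs : |blockSum S σ / S.card| ≤ walshScale S R σ / 4 := by
    refine abs_le_of_sq_le_sq ?_ (div_nonneg (walshScale_nonneg S R σ) (by norm_num))
    rw [div_pow (walshScale S R σ), walshScale_sq S hR, ← sqMagnetization]
    linarith [div_nonneg hR hk.le]
  rw [abs_div, Nat.abs_cast, div_le_iff₀ hk] at habs
  linarith

theorem le_card_mul_walshScale_sq (hS : S.Nonempty) (hR : 0 ≤ R) (σ : ι → Bool) :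
    R ≤ S.card * walshScale S R σ ^ 2 / 16 := by
  have hk : (S.card : ℝ) ≠ 0 := by exact_mod_cast hS.card_pos.ne'
  have heq : S.card * walshScale S R σ ^ 2 / 16 = S.card * sqMagnetization S σ + R := by
    rw [walshScale_sq S hR]
    field_simp
  rw [heq]
  exact le_add_of_nonneg_left (mul_nonneg (Nat.cast_nonneg _) (sqMagnetization_nonneg S σ))

theorem abs_blockSum_mul_walshScale_pow_add_le (hS : S.Nonempty) (hR : 2 * R ≤ S.card) {q : ℕ}
    (hq : (q : ℝ) ≤ R) (σ : ι → Bool) :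
    |blockSum S σ| * walshScale S R σ ^ q + q * walshScale S R σ ^ (q - 1) ≤
      (S.card - q) * walshScale S R σ ^ (q + 1) := by
  have hR0 : 0 ≤ R := (Nat.cast_nonneg q).trans hq
  have hsum := abs_blockSum_le_walshScale hS hR0 σ
  have hdeg := hq.trans (le_card_mul_walshScale_sq hS hR0 σ)
  have hB0 := walshScale_nonneg S R σ
  set B := walshScale S R σ
  set k : ℝ := (S.card : ℝ)
  have hk : 0 ≤ k := Nat.cast_nonneg _
  have hfst : |blockSum S σ| * B ^ q ≤ k * B ^ (q + 1) / 4 :=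
    (mul_le_mul_of_nonneg_right hsum (pow_nonneg hB0 q)).trans_eq (by ring)
  have hsnd : (q : ℝ) * B ^ (q - 1) ≤ k * B ^ (q + 1) / 16 := by
    rcases q.eq_zero_or_pos with rfl | hqpos
    · rw [Nat.cast_zero, zero_mul]
      positivity
    · obtain ⟨q, rfl⟩ := Nat.exists_eq_add_of_lt hqpos
      rw [zero_add, Nat.add_sub_cancel]
      refine (mul_le_mul_of_nonneg_right (by simpa using hdeg) (pow_nonneg hB0 q)).trans_eq ?_
      ring
  have hhalf : k / 2 * B ^ (q + 1) ≤ (k - q) * B ^ (q + 1) :=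
    mul_le_mul_of_nonneg_right (by linarith) (pow_nonneg hB0 _)
  linarith [mul_nonneg hk (pow_nonneg hB0 (q + 1))]

theorem walshScale_mul_walshScale_le {S S' : Finset ι} (hR : 0 ≤ R) (hS : S.card = S'.card)
    (σ σ' : ι → Bool) :
    walshScale S R σ * walshScale S' R σ' ≤
      8 * (sqMagnetization S σ + sqMagnetization S' σ') + 16 * (R / S.card) := by
  have hsq := walshScale_sq S hR σ
  have hsq' := walshScale_sq S' hR σ'
  rw [← hS] at hsq'
  linarith [two_mul_le_add_sq (walshScale S R σ) (walshScale S' R σ')]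

/-- Induction on the degree: for `i ∈ S \ J` the coefficient at `insert i J` does not depend on
`i`, hence it is determined by the coefficients of lower degree through `blockSum_mul_walsh`. -/
theorem SwapInvariant.abs_walshCoeff_le [Fintype ι] [DecidableEq ι] (hR : 2 * R ≤ S.card)
    (p : ℕ) : ∀ J ⊆ S, J.card = p → (p : ℝ) ≤ R → ∀ w : (ι → Bool) → ℝ, SwapInvariant S w →
      |walshCoeff w J| ≤ ∑ σ, |w σ| * walshScale S R σ ^ p := by
  induction p using Nat.strong_induction_on with
  | _ p ih =>
  intro J hJ hp hpR w hw
  rcases p with _ | q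
  · rw [Finset.card_eq_zero.1 hp, walshCoeff_empty]
    simpa using Finset.abs_sum_le_sum_abs w Finset.univ
  obtain ⟨i, J, hi, rfl, hq⟩ := Finset.card_eq_succ.1 hp
  have hiS : i ∈ S \ J := Finset.mem_sdiff.2 ⟨hJ (Finset.mem_insert_self i J), hi⟩
  have hJS : J ⊆ S := (Finset.subset_insert i J).trans hJ
  push_cast at hpR
  have hqR : (q : ℝ) ≤ R := by linarith
  have hkq : (0 : ℝ) < S.card - q := by linarith
  have hmagn := ih q q.lt_succ_self J hJS hq hqR _ (hw.mul_blockSum id)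
  have herase : |∑ j ∈ J, walshCoeff w (J.erase j)| ≤
      ∑ σ, |w σ| * (q * walshScale S R σ ^ (q - 1)) := by
    have hone (j : ι) (hj : j ∈ J) :
        |walshCoeff w (J.erase j)| ≤ ∑ σ, |w σ| * walshScale S R σ ^ (q - 1) :=
      ih (q - 1) (by lia) _ ((Finset.erase_subset j J).trans hJS)
        (by rw [Finset.card_erase_of_mem hj, hq]) (le_trans (by exact_mod_cast q.sub_le 1) hqR) w hw
    refine (Finset.abs_sum_le_sum_abs _ _).trans ((Finset.sum_le_sum hone).trans_eq ?_)
    rw [Finset.sum_const, hq, nsmul_eq_mul, Finset.mul_sum]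
    exact Finset.sum_congr rfl fun σ _ => mul_left_comm _ _ _
  refine le_of_mul_le_mul_left ?_ hkq
  calc (S.card - q : ℝ) * |walshCoeff w (insert i J)|
      = |walshCoeff (fun σ => w σ * blockSum S σ) J - ∑ j ∈ J, walshCoeff w (J.erase j)| := by
        rw [← hw.card_sub_mul_walshCoeff_insert hJS hiS, hq, abs_mul, abs_of_pos hkq]
    _ ≤ ∑ σ, |w σ * blockSum S σ| * walshScale S R σ ^ q +
          ∑ σ, |w σ| * (q * walshScale S R σ ^ (q - 1)) :=
        (abs_sub _ _).trans (add_le_add hmagn herase)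
    _ ≤ (S.card - q : ℝ) * ∑ σ, |w σ| * walshScale S R σ ^ (q + 1) := by
        rw [← Finset.sum_add_distrib, Finset.mul_sum]
        refine Finset.sum_le_sum fun σ _ => ?_
        rw [abs_mul, mul_assoc, ← mul_add, mul_left_comm]
        exact mul_le_mul_of_nonneg_left (abs_blockSum_mul_walshScale_pow_add_le
          ⟨i, (Finset.mem_sdiff.1 hiS).1⟩ hR hqR σ) (abs_nonneg _)

end WalshScale

section TiltedLaw

variable {n : ℕ}

/-- The planted law damped by `exp (-lam * M²)`, where `M` is the magnetization of the clique. -/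
noncomputable def tiltedLaw (μ : Measure ℝ) (θ lam : ℝ) (S : Finset (Fin n)) (σ : Fin n → Bool) :
    ℝ :=
  plantedLaw μ θ S σ * Real.exp (-(lam * sqMagnetization S σ))

/-- The inner product, under the uniform law, of the likelihood ratios of two tilted laws. -/
noncomputable def overlapProduct (μ : Measure ℝ) (θ lam : ℝ) (S S' : Finset (Fin n)) : ℝ :=
  2 ^ n * ∑ σ, tiltedLaw μ θ lam S σ * tiltedLaw μ θ lam S' σ

theorem tiltedLaw_zero (μ : Measure ℝ) (θ : ℝ) (S : Finset (Fin n)) :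
    tiltedLaw μ θ 0 S = plantedLaw μ θ S := by
  funext σ
  simp [tiltedLaw]

theorem tiltedLaw_nonneg (μ : Measure ℝ) (θ lam : ℝ) (S : Finset (Fin n)) (σ : Fin n → Bool) :
    0 ≤ tiltedLaw μ θ lam S σ :=
  mul_nonneg (plantedLaw_nonneg μ θ S σ) (Real.exp_pos _).le

theorem tiltedLaw_le_plantedLaw (μ : Measure ℝ) (θ : ℝ) {lam : ℝ} (hlam : 0 ≤ lam)
    (S : Finset (Fin n)) (σ : Fin n → Bool) : tiltedLaw μ θ lam S σ ≤ plantedLaw μ θ S σ :=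
  mul_le_of_le_one_right (plantedLaw_nonneg μ θ S σ) (Real.exp_le_one_iff.2
    (neg_nonpos.2 (mul_nonneg hlam (sqMagnetization_nonneg S σ))))

theorem tiltedLaw_mul_tiltedLaw (μ : Measure ℝ) (θ lam : ℝ) (S S' : Finset (Fin n))
    (σ σ' : Fin n → Bool) :
    tiltedLaw μ θ lam S σ * tiltedLaw μ θ lam S' σ' =
      plantedLaw μ θ S σ * plantedLaw μ θ S' σ' *
        Real.exp (-(lam * (sqMagnetization S σ + sqMagnetization S' σ'))) := by
  rw [tiltedLaw, tiltedLaw, mul_mul_mul_comm, ← Real.exp_add, mul_add, neg_add]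

theorem overlapProduct_nonneg (μ : Measure ℝ) (θ lam : ℝ) (S S' : Finset (Fin n)) :
    0 ≤ overlapProduct μ θ lam S S' :=
  mul_nonneg (by positivity) (Finset.sum_nonneg fun σ _ =>
    mul_nonneg (tiltedLaw_nonneg μ θ lam S σ) (tiltedLaw_nonneg μ θ lam S' σ))

theorem swapInvariant_tiltedLaw (μ : Measure ℝ) [SigmaFinite μ] (θ lam : ℝ)
    (S : Finset (Fin n)) : SwapInvariant S (tiltedLaw μ θ lam S) := by
  have hplanted : SwapInvariant S (plantedLaw μ θ S) := fun i hi j hj σ =>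
    plantedLaw_comp μ θ S (Equiv.swap i j) (swap_mem_iff hi hj) σ
  exact hplanted.mul_blockSum fun s => Real.exp (-(lam * (s / S.card) ^ 2))

theorem walshCoeff_tiltedLaw_of_not_subset {μ : Measure ℝ} [SigmaFinite μ]
    (hsymm : μ.map (fun h : ℝ => -h) = μ) (θ lam : ℝ) {S J : Finset (Fin n)} (hJ : ¬J ⊆ S) :
    walshCoeff (tiltedLaw μ θ lam S) J = 0 := by
  obtain ⟨i, hiJ, hiS⟩ := Finset.not_subset.1 hJ
  have hdisj : Disjoint S {i} := Finset.disjoint_singleton_right.2 hiS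
  refine walshCoeff_eq_zero_of_flipSpins (D := {i}) (fun σ => ?_) ?_
  · rw [tiltedLaw, tiltedLaw, plantedLaw_flipSpins_of_disjoint hsymm θ hdisj, sqMagnetization,
      blockSum_flipSpins_of_disjoint hdisj, sqMagnetization]
  · simp [Finset.inter_singleton_of_mem hiJ]

theorem walshCoeff_tiltedLaw_of_odd_card {μ : Measure ℝ} [SigmaFinite μ]
    (hsymm : μ.map (fun h : ℝ => -h) = μ) (θ lam : ℝ) (S : Finset (Fin n)) {J : Finset (Fin n)}
    (hJ : Odd J.card) : walshCoeff (tiltedLaw μ θ lam S) J = 0 := by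
  refine walshCoeff_eq_zero_of_flipSpins (D := Finset.univ) (fun σ => ?_) (by simpa using hJ)
  rw [tiltedLaw, tiltedLaw, plantedLaw_flipSpins_univ hsymm θ S, sqMagnetization,
    blockSum_flipSpins_univ, neg_div, neg_sq, sqMagnetization]

theorem overlapProduct_eq_sum_walshCoeff {μ : Measure ℝ} [SigmaFinite μ]
    (hsymm : μ.map (fun h : ℝ => -h) = μ) (θ lam : ℝ) (S S' : Finset (Fin n)) :
    overlapProduct μ θ lam S S' = ∑ J ∈ (S ∩ S').powerset,
      walshCoeff (tiltedLaw μ θ lam S) J * walshCoeff (tiltedLaw μ θ lam S') J := by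
  have hparseval :=
    two_pow_mul_sum_mul_eq_sum_walshCoeff (tiltedLaw μ θ lam S) (tiltedLaw μ θ lam S')
  rw [Fintype.card_fin] at hparseval
  rw [overlapProduct, hparseval]
  symm
  refine Finset.sum_subset (Finset.subset_univ _) fun J _ hJ => ?_
  rw [Finset.mem_powerset, Finset.subset_inter_iff, not_and_or] at hJ
  rcases hJ with hJ | hJ
  · rw [walshCoeff_tiltedLaw_of_not_subset hsymm θ lam hJ, zero_mul]
  · rw [walshCoeff_tiltedLaw_of_not_subset hsymm θ lam hJ, mul_zero]

theorem walshCoeff_mul_walshCoeff_le (μ : Measure ℝ) [SigmaFinite μ] (θ lam : ℝ)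
    {S S' J : Finset (Fin n)} (hS : S.card = S'.card) (hJ : J ⊆ S ∩ S') {R : ℝ}
    (hJR : (J.card : ℝ) ≤ R) (hR : 2 * R ≤ S.card) :
    walshCoeff (tiltedLaw μ θ lam S) J * walshCoeff (tiltedLaw μ θ lam S') J ≤
      ∑ σ, ∑ σ', tiltedLaw μ θ lam S σ * tiltedLaw μ θ lam S' σ' *
        (8 * (sqMagnetization S σ + sqMagnetization S' σ') + 16 * (R / S.card)) ^ J.card := by
  have hR0 : 0 ≤ R := (Nat.cast_nonneg _).trans hJR
  rw [Finset.subset_inter_iff] at hJ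
  have hcoeff := SwapInvariant.abs_walshCoeff_le hR _ J hJ.1 rfl hJR _
    (swapInvariant_tiltedLaw μ θ lam S)
  have hcoeff' := SwapInvariant.abs_walshCoeff_le (by rwa [← hS]) _ J hJ.2 rfl hJR _
    (swapInvariant_tiltedLaw μ θ lam S')
  simp only [abs_of_nonneg (tiltedLaw_nonneg μ θ lam _ _)] at hcoeff hcoeff'
  refine (le_abs_self _).trans ?_
  rw [abs_mul]
  refine (mul_le_mul hcoeff hcoeff' (abs_nonneg _) ((abs_nonneg _).trans hcoeff)).trans ?_
  rw [Finset.sum_mul_sum]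
  refine Finset.sum_le_sum fun σ _ => Finset.sum_le_sum fun σ' _ => ?_
  rw [mul_mul_mul_comm, ← mul_pow]
  refine mul_le_mul_of_nonneg_left ?_
    (mul_nonneg (tiltedLaw_nonneg μ θ lam S σ) (tiltedLaw_nonneg μ θ lam S' σ'))
  exact pow_le_pow_left₀ (mul_nonneg (walshScale_nonneg S R σ) (walshScale_nonneg S' R σ'))
    (walshScale_mul_walshScale_le hR0 hS σ σ') _

theorem overlapProduct_le_of_walshCoeff_le {μ : Measure ℝ} [SigmaFinite μ]
    (hsymm : μ.map (fun h : ℝ => -h) = μ) (θ lam : ℝ) {S S' : Finset (Fin n)}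
    {f : Finset (Fin n) → (Fin n → Bool) → (Fin n → Bool) → ℝ}
    (hf : ∀ J ⊆ S ∩ S',
      walshCoeff (tiltedLaw μ θ lam S) J * walshCoeff (tiltedLaw μ θ lam S') J ≤
        ∑ σ, ∑ σ', tiltedLaw μ θ lam S σ * tiltedLaw μ θ lam S' σ' * f J σ σ') :
    overlapProduct μ θ lam S S' ≤ ∑ σ, ∑ σ', tiltedLaw μ θ lam S σ * tiltedLaw μ θ lam S' σ' *
      ∑ J ∈ (S ∩ S').powerset, f J σ σ' := by
  rw [overlapProduct_eq_sum_walshCoeff hsymm]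
  refine (Finset.sum_le_sum fun J hJ => hf J (Finset.mem_powerset.1 hJ)).trans_eq ?_
  rw [Finset.sum_comm]
  refine Finset.sum_congr rfl fun σ _ => ?_
  rw [Finset.sum_comm]
  exact Finset.sum_congr rfl fun σ' _ => (Finset.mul_sum _ _ _).symm

theorem sum_sum_plantedLaw_mul_const (μ : Measure ℝ) [IsProbabilityMeasure μ] (θ : ℝ)
    (S S' : Finset (Fin n)) (c : ℝ) :
    ∑ σ, ∑ σ', plantedLaw μ θ S σ * plantedLaw μ θ S' σ' * c = c := by
  simp only [← Finset.sum_mul]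
  rw [← Finset.sum_mul_sum, sum_plantedLaw, sum_plantedLaw, one_mul, one_mul]

end TiltedLaw

section PowersetSums

theorem choose_mul_pow_le {r j k : ℕ} (hr : 192 * r ≤ k) :
    (r.choose j : ℝ) * (32 * (j / k : ℝ)) ^ j ≤ (1 / 2) ^ j := by
  have hr' : 192 * (r : ℝ) ≤ k := by exact_mod_cast hr
  have hchoose : (r.choose j : ℝ) ≤ r ^ j / j.factorial := Nat.choose_le_pow_div j r
  have hstirling : (j : ℝ) ^ j / j.factorial ≤ 3 ^ j := by
    refine (Real.pow_div_factorial_le_exp (j : ℝ) (Nat.cast_nonneg j) j).trans ?_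
    rw [← Real.exp_one_pow]
    exact pow_le_pow_left₀ (Real.exp_pos 1).le (by linarith [Real.exp_one_lt_d9]) j
  calc (r.choose j : ℝ) * (32 * (j / k : ℝ)) ^ j
      ≤ r ^ j / j.factorial * (32 * (j / k : ℝ)) ^ j :=
        mul_le_mul_of_nonneg_right hchoose (by positivity)
    _ = (32 * r / k) ^ j * (j ^ j / j.factorial) := by
        rw [mul_pow, div_pow, div_pow, mul_pow]
        ring
    _ ≤ (32 * r / k) ^ j * 3 ^ j := mul_le_mul_of_nonneg_left hstirling (by positivity)
    _ = (96 * r / k) ^ j := by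
        rw [← mul_pow]
        ring
    _ ≤ (1 / 2) ^ j :=
        pow_le_pow_left₀ (by positivity) (div_le_of_le_mul₀ (by positivity) (by norm_num)
          (by linarith)) j

theorem add_pow_le_two_mul_pow_add {a b : ℝ} (ha : 0 ≤ a) (hb : 0 ≤ b) (j : ℕ) :
    (a + b) ^ j ≤ (2 * a) ^ j + (2 * b) ^ j := by
  rcases le_total a b with h | h
  · exact (pow_le_pow_left₀ (by positivity) (by linarith) j).trans
      (le_add_of_nonneg_left (by positivity))
  · exact (pow_le_pow_left₀ (by positivity) (by linarith) j).trans
      (le_add_of_nonneg_right (by positivity))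

variable {α : Type*} (T : Finset α)

theorem sum_powerset_pow_card (b : ℝ) : ∑ J ∈ T.powerset, b ^ J.card = (b + 1) ^ T.card := by
  simpa using Finset.sum_pow_mul_eq_add_pow b 1 T

theorem add_one_pow_le_exp_mul {b : ℝ} (hb : 0 ≤ b) (r : ℕ) : (b + 1) ^ r ≤ Real.exp (r * b) := by
  rw [Real.exp_nat_mul]
  exact pow_le_pow_left₀ (by positivity) (Real.add_one_le_exp b) r

theorem sum_powerset_pow_le {k : ℕ} (hT : 192 * T.card ≤ k) {Y : ℝ} (hY : 0 ≤ Y) :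
    ∑ J ∈ T.powerset, (8 * Y + 16 * ((J.card : ℝ) / k)) ^ J.card ≤
      Real.exp (16 * T.card * Y) + 2 := by
  have hsplit (J : Finset α) : (8 * Y + 16 * ((J.card : ℝ) / k)) ^ J.card ≤
      (16 * Y) ^ J.card + (32 * ((J.card : ℝ) / k)) ^ J.card := by
    refine (add_pow_le_two_mul_pow_add (by positivity) (by positivity) _).trans_eq ?_
    ring_nf
  refine (Finset.sum_le_sum fun J _ => hsplit J).trans ?_
  rw [Finset.sum_add_distrib]
  refine add_le_add ?_ ?_
  · rw [sum_powerset_pow_card]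
    refine (add_one_pow_le_exp_mul (by positivity) _).trans_eq ?_
    ring_nf
  · rw [Finset.sum_powerset_apply_card fun j : ℕ => (32 * ((j : ℝ) / k)) ^ j]
    simp only [nsmul_eq_mul]
    refine (Finset.sum_le_sum fun j _ => choose_mul_pow_le hT).trans ?_
    exact (summable_geometric_two.sum_le_tsum _ fun j _ => by positivity).trans_eq
      tsum_geometric_two

theorem exp_sub_le_one_add_sq_mul_exp {z : ℝ} (hz : 0 ≤ z) :
    Real.exp z - z ≤ 1 + z ^ 2 * Real.exp z := by
  have hexp : Real.exp z * (1 - z) ≤ 1 := by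
    have hneg := mul_le_mul_of_nonneg_left (Real.one_sub_le_exp_neg z) (Real.exp_pos z).le
    rwa [← Real.exp_add, add_neg_cancel, Real.exp_zero] at hneg
  linarith [mul_le_mul_of_nonneg_right hexp (by linarith : 0 ≤ 1 + z)]

theorem sum_powerset_card_ne_one_le {b : ℝ} (hb : 0 ≤ b) :
    ∑ J ∈ T.powerset, (if J.card = 1 then 0 else b ^ J.card) ≤
      1 + (T.card * b) ^ 2 * Real.exp (T.card * b) := by
  have hsplit (J : Finset α) : (if J.card = 1 then 0 else b ^ J.card) =
      b ^ J.card - if J.card = 1 then b else 0 := by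
    split_ifs with h <;> simp [h]
  have hlinear : ∑ J ∈ T.powerset, (if J.card = 1 then b else 0) = T.card * b := by
    rw [Finset.sum_powerset_apply_card fun j : ℕ => if j = 1 then b else 0]
    rcases T.card.eq_zero_or_pos with h | h <;> simp [h]
  rw [Finset.sum_congr rfl fun J _ => hsplit J, Finset.sum_sub_distrib, sum_powerset_pow_card,
    hlinear]
  exact (sub_le_sub_right (add_one_pow_le_exp_mul hb _) _).trans
    (exp_sub_le_one_add_sq_mul_exp (by positivity))

end PowersetSums

section OverlapProductBounds

variable {n : ℕ} {μ : Measure ℝ} [IsProbabilityMeasure μ] {S S' : Finset (Fin n)}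

theorem overlapProduct_le_three (hsymm : μ.map (fun h : ℝ => -h) = μ) (θ : ℝ)
    (hS : S.card = S'.card) (hr : 192 * (S ∩ S').card ≤ S.card) :
    overlapProduct μ θ (16 * (S ∩ S').card) S S' ≤ 3 := by
  set r := (S ∩ S').card
  have hhalf (J : Finset (Fin n)) (hJ : J ⊆ S ∩ S') : 2 * (J.card : ℝ) ≤ S.card := by
    have := Finset.card_le_card hJ
    exact_mod_cast (by lia : 2 * J.card ≤ S.card)
  refine (overlapProduct_le_of_walshCoeff_le hsymm θ _ fun J hJ =>
    walshCoeff_mul_walshCoeff_le μ θ (16 * r) hS hJ le_rfl (hhalf J hJ)).trans ?_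
  rw [← sum_sum_plantedLaw_mul_const μ θ S S' 3]
  refine Finset.sum_le_sum fun σ _ => Finset.sum_le_sum fun σ' _ => ?_
  rw [tiltedLaw_mul_tiltedLaw, mul_assoc]
  refine mul_le_mul_of_nonneg_left ?_
    (mul_nonneg (plantedLaw_nonneg μ θ S σ) (plantedLaw_nonneg μ θ S' σ'))
  have hM := add_nonneg (sqMagnetization_nonneg S σ) (sqMagnetization_nonneg S' σ')
  set M := sqMagnetization S σ + sqMagnetization S' σ'
  have hexp : Real.exp (-(16 * r * M)) ≤ 1 := Real.exp_le_one_iff.2 (neg_nonpos.2 (by positivity))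
  calc Real.exp (-(16 * r * M)) * ∑ J ∈ (S ∩ S').powerset, (8 * M + 16 * (J.card / S.card)) ^ J.card
      ≤ Real.exp (-(16 * r * M)) * (Real.exp (16 * r * M) + 2) :=
        mul_le_mul_of_nonneg_left (sum_powerset_pow_le _ hr hM) (Real.exp_pos _).le
    _ = 1 + 2 * Real.exp (-(16 * r * M)) := by
        rw [mul_add, ← Real.exp_add, neg_add_cancel, Real.exp_zero, mul_comm (2 : ℝ)]
    _ ≤ 3 := by linarith

theorem overlapProduct_le_one (hsymm : μ.map (fun h : ℝ => -h) = μ) {θ : ℝ} (hθ : 0 ≤ θ)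
    (hS : S.Nonempty) : overlapProduct μ θ (θ * S.card / 2) S S' ≤ 1 := by
  have hk : (S.card : ℝ) ≠ 0 := by exact_mod_cast hS.card_pos.ne'
  have huniform (σ : Fin n → Bool) : tiltedLaw μ θ (θ * S.card / 2) S σ ≤ (1 / 2) ^ n := by
    refine (mul_le_mul_of_nonneg_right (plantedLaw_le hsymm hθ S σ) (Real.exp_pos _).le).trans_eq ?_
    have hcancel : θ / (2 * S.card) * blockSum S σ ^ 2 +
        -(θ * S.card / 2 * sqMagnetization S σ) = 0 := by
      rw [sqMagnetization]
      field_simp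
      ring
    rw [mul_assoc, ← Real.exp_add, hcancel, Real.exp_zero, mul_one]
  rw [overlapProduct, Finset.mul_sum, ← sum_plantedLaw μ θ S']
  refine Finset.sum_le_sum fun σ _ => ?_
  calc 2 ^ n * (tiltedLaw μ θ (θ * S.card / 2) S σ * tiltedLaw μ θ (θ * S.card / 2) S' σ)
      ≤ 2 ^ n * ((1 / 2) ^ n * plantedLaw μ θ S' σ) := by
        gcongr
        · exact tiltedLaw_nonneg _ _ _ _ _
        · exact huniform σ
        · exact tiltedLaw_le_plantedLaw μ θ (by positivity) S' σ
    _ = plantedLaw μ θ S' σ := by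
        rw [← mul_assoc, ← mul_pow]
        norm_num

/-- Spin flip symmetry kills the coefficients of degree one, so the excess of `overlapProduct` over
`1` is quadratic in the size of the overlap. -/
theorem overlapProduct_zero_le (hsymm : μ.map (fun h : ℝ => -h) = μ) (θ : ℝ)
    (hS : S.card = S'.card) (hr : 2 * (S ∩ S').card ≤ S.card)
    {b : (Fin n → Bool) → (Fin n → Bool) → ℝ}
    (hb : ∀ σ σ', b σ σ' = 8 * (sqMagnetization S σ + sqMagnetization S' σ') +
      16 * ((S ∩ S').card / S.card)) :
    overlapProduct μ θ 0 S S' ≤ 1 + ∑ σ, ∑ σ', plantedLaw μ θ S σ * plantedLaw μ θ S' σ' *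
      (((S ∩ S').card * b σ σ') ^ 2 * Real.exp ((S ∩ S').card * b σ σ')) := by
  have hb0 (σ σ' : Fin n → Bool) : 0 ≤ b σ σ' := by
    have hM := sqMagnetization_nonneg S σ
    have hM' := sqMagnetization_nonneg S' σ'
    rw [hb]
    positivity
  have hcoeff (J : Finset (Fin n)) (hJ : J ⊆ S ∩ S') :
      walshCoeff (tiltedLaw μ θ 0 S) J * walshCoeff (tiltedLaw μ θ 0 S') J ≤
        ∑ σ, ∑ σ', tiltedLaw μ θ 0 S σ * tiltedLaw μ θ 0 S' σ' *
          (if J.card = 1 then 0 else b σ σ' ^ J.card) := by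
    split_ifs with hone
    · rw [walshCoeff_tiltedLaw_of_odd_card hsymm θ 0 S (by simp [hone])]
      simp
    · simp only [hb]
      exact walshCoeff_mul_walshCoeff_le μ θ 0 hS hJ (by exact_mod_cast Finset.card_le_card hJ)
        (by exact_mod_cast hr)
  refine (overlapProduct_le_of_walshCoeff_le hsymm θ 0 hcoeff).trans ?_
  rw [← sum_sum_plantedLaw_mul_const μ θ S S' 1, ← Finset.sum_add_distrib]
  refine Finset.sum_le_sum fun σ _ => ?_
  rw [← Finset.sum_add_distrib]
  refine Finset.sum_le_sum fun σ' _ => ?_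
  rw [← mul_add, tiltedLaw_zero, tiltedLaw_zero]
  exact mul_le_mul_of_nonneg_left (sum_powerset_card_ne_one_le _ (hb0 σ σ'))
    (mul_nonneg (plantedLaw_nonneg μ θ S σ) (plantedLaw_nonneg μ θ S' σ'))

end OverlapProductBounds

section MomentBound

/-- Uniform exponential moment bound for the squared magnetization of the clique under the planted
law, on the scale `k ^ (-γ)` in the clique size `k`. -/
def MagnetizationMomentBound (μ : Measure ℝ) (θ γ c C : ℝ) : Prop :=
  ∀ (n : ℕ) (S : Finset (Fin n)), S.Nonempty →
    ∑ σ, plantedLaw μ θ S σ * Real.exp (c * ((S.card : ℝ) ^ γ * sqMagnetization S σ)) ≤ C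

theorem sq_mul_exp_le {c ρ u : ℝ} (hc : 0 < c) (hρ : 32 * ρ ≤ c) (hu : 0 ≤ u) :
    (8 * ρ * u) ^ 2 * Real.exp (8 * ρ * u) ≤ 2048 / c ^ 2 * ρ ^ 2 * Real.exp (c * u / 2) := by
  have hquad : (c * u / 4) ^ 2 / 2 ≤ Real.exp (c * u / 4) := by
    simpa using Real.pow_div_factorial_le_exp (c * u / 4) (by positivity) 2
  have hexp : Real.exp (8 * ρ * u) ≤ Real.exp (c * u / 4) := Real.exp_le_exp.2 (by nlinarith)
  have hsq : u ^ 2 ≤ 32 / c ^ 2 * Real.exp (c * u / 4) := by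
    rw [div_mul_eq_mul_div, le_div_iff₀ (by positivity)]
    linarith
  calc (8 * ρ * u) ^ 2 * Real.exp (8 * ρ * u)
      = 64 * ρ ^ 2 * (u ^ 2 * Real.exp (8 * ρ * u)) := by ring
    _ ≤ 64 * ρ ^ 2 * (32 / c ^ 2 * Real.exp (c * u / 4) * Real.exp (c * u / 4)) := by gcongr
    _ = 2048 / c ^ 2 * ρ ^ 2 * (Real.exp (c * u / 4) * Real.exp (c * u / 4)) := by ring
    _ = 2048 / c ^ 2 * ρ ^ 2 * Real.exp (c * u / 2) := by
        rw [← Real.exp_add]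
        ring_nf

section RescaledOverlap

variable {k γ r : ℝ}

theorem rpow_mul_rpow_le_self (hk : 1 ≤ k) (hγ : γ ≤ 1 / 2) : k ^ γ * k ^ γ ≤ k := by
  rw [← Real.rpow_add (by linarith)]
  exact (Real.rpow_le_rpow_of_exponent_le hk (by linarith)).trans_eq (Real.rpow_one k)

theorem mul_rpow_neg_mul_rpow (hk : 0 < k) (r γ : ℝ) : r * k ^ (-γ) * k ^ γ = r := by
  rw [mul_assoc, ← Real.rpow_add hk, neg_add_cancel, Real.rpow_zero, mul_one]

theorem mul_div_le_mul_rpow_neg (hk : 1 ≤ k) (hγ : γ ≤ 1 / 2) (hr : 0 ≤ r)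
    (hρ : r * k ^ (-γ) ≤ 1) : r * (r / k) ≤ r * k ^ (-γ) := by
  have hk0 : 0 < k := by linarith
  have : 0 ≤ r * k ^ (-γ) := by positivity
  calc r * (r / k) = r * k ^ (-γ) * (r * k ^ (-γ) * (k ^ γ * k ^ γ / k)) := by
        conv_lhs => rw [← mul_rpow_neg_mul_rpow hk0 r γ]
        ring
    _ ≤ r * k ^ (-γ) * (1 * 1) := by
        gcongr
        rw [div_le_one hk0]
        exact rpow_mul_rpow_le_self hk hγ
    _ = r * k ^ (-γ) := by ring

theorem sq_mul_exp_overlap_le {c a b : ℝ} (hk : 1 ≤ k) (hγ : γ ≤ 1 / 2) (hc : 0 < c) (hr : 0 ≤ r)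
    (hρ : r * k ^ (-γ) ≤ min (1 / 2) (c / 32)) (ha : 0 ≤ a) (hb : 0 ≤ b) :
    (r * (8 * (a + b) + 16 * (r / k))) ^ 2 * Real.exp (r * (8 * (a + b) + 16 * (r / k))) ≤
      2048 / c ^ 2 * Real.exp c * (r * k ^ (-γ)) ^ 2 *
        (Real.exp (c * (k ^ γ * a)) * Real.exp (c * (k ^ γ * b))) := by
  have hk0 : 0 < k := by linarith
  obtain ⟨hρ1, hρc⟩ := le_min_iff.1 hρ
  have hquad := mul_div_le_mul_rpow_neg hk hγ hr (by linarith)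
  have hscale := mul_rpow_neg_mul_rpow hk0 r γ
  set ρ := r * k ^ (-γ)
  set u := k ^ γ * a + k ^ γ * b + 2
  have hz : r * (8 * (a + b) + 16 * (r / k)) ≤ 8 * ρ * u := by
    have hlinear : ρ * (k ^ γ * a + k ^ γ * b) = r * (a + b) := by
      rw [← hscale]
      ring
    linarith
  calc (r * (8 * (a + b) + 16 * (r / k))) ^ 2 * Real.exp (r * (8 * (a + b) + 16 * (r / k)))
      ≤ (8 * ρ * u) ^ 2 * Real.exp (8 * ρ * u) := by gcongr
    _ ≤ 2048 / c ^ 2 * ρ ^ 2 * Real.exp (c * u / 2) :=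
        sq_mul_exp_le hc (by linarith) (by positivity)
    _ ≤ 2048 / c ^ 2 * ρ ^ 2 * Real.exp (c + c * (k ^ γ * a) + c * (k ^ γ * b)) := by
        gcongr
        have hexp : 0 ≤ c * (k ^ γ * a + k ^ γ * b) := by positivity
        linarith
    _ = 2048 / c ^ 2 * Real.exp c * ρ ^ 2 *
          (Real.exp (c * (k ^ γ * a)) * Real.exp (c * (k ^ γ * b))) := by
        rw [Real.exp_add, Real.exp_add]
        ring

end RescaledOverlap

theorem overlapProduct_zero_le_of_momentBound {μ : Measure ℝ} [IsProbabilityMeasure μ]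
    (hsymm : μ.map (fun h : ℝ => -h) = μ) {θ γ c C : ℝ} (hγ : γ ≤ 1 / 2) (hc : 0 < c)
    (hM : MagnetizationMomentBound μ θ γ c C) {n : ℕ} {S S' : Finset (Fin n)}
    (hne : S.Nonempty) (hS : S.card = S'.card)
    (hρ : (S ∩ S').card * (S.card : ℝ) ^ (-γ) ≤ min (1 / 2) (c / 32)) :
    overlapProduct μ θ 0 S S' ≤
      1 + 2048 / c ^ 2 * Real.exp c * C ^ 2 * ((S ∩ S').card * (S.card : ℝ) ^ (-γ)) ^ 2 := by
  have hk : (1 : ℝ) ≤ S.card := by exact_mod_cast hne.card_pos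
  have hmoment := hM n S hne
  have hmoment' := hM n S' (Finset.card_pos.1 (hS ▸ hne.card_pos))
  rw [← hS] at hmoment'
  have hpos (T : Finset (Fin n)) : 0 ≤ ∑ σ, plantedLaw μ θ T σ *
      Real.exp (c * ((S.card : ℝ) ^ γ * sqMagnetization T σ)) :=
    Finset.sum_nonneg fun σ _ => mul_nonneg (plantedLaw_nonneg μ θ T σ) (Real.exp_pos _).le
  have hr : 2 * (S ∩ S').card ≤ S.card := by
    have hle : (S.card : ℝ) ^ γ ≤ S.card :=
      (Real.rpow_le_rpow_of_exponent_le hk (by linarith)).trans_eq (Real.rpow_one _)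
    have hscale := mul_rpow_neg_mul_rpow (zero_lt_one.trans_le hk) ((S ∩ S').card : ℝ) γ
    have hmul := mul_le_mul (hρ.trans (min_le_left _ _)) hle (by positivity) (by norm_num)
    exact_mod_cast (by linarith : 2 * ((S ∩ S').card : ℝ) ≤ S.card)
  refine (overlapProduct_zero_le hsymm θ hS hr fun _ _ => rfl).trans (add_le_add le_rfl ?_)
  set ρ := (S ∩ S').card * (S.card : ℝ) ^ (-γ)
  calc _ ≤ ∑ σ, ∑ σ', 2048 / c ^ 2 * Real.exp c * ρ ^ 2 *
          (plantedLaw μ θ S σ * Real.exp (c * ((S.card : ℝ) ^ γ * sqMagnetization S σ)) *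
          (plantedLaw μ θ S' σ' * Real.exp (c * ((S.card : ℝ) ^ γ * sqMagnetization S' σ')))) := by
        refine Finset.sum_le_sum fun σ _ => Finset.sum_le_sum fun σ' _ => ?_
        refine (mul_le_mul_of_nonneg_left (sq_mul_exp_overlap_le hk hγ hc (Nat.cast_nonneg _) hρ
          (sqMagnetization_nonneg S σ) (sqMagnetization_nonneg S' σ'))
          (mul_nonneg (plantedLaw_nonneg μ θ S σ) (plantedLaw_nonneg μ θ S' σ'))).trans_eq ?_
        ring
    _ ≤ 2048 / c ^ 2 * Real.exp c * ρ ^ 2 * (C * C) := by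
        simp only [← Finset.mul_sum]
        rw [← Finset.sum_mul]
        exact mul_le_mul_of_nonneg_left
          (mul_le_mul hmoment hmoment' (hpos S') ((hpos S).trans hmoment)) (by positivity)
    _ = _ := by ring

end MomentBound

section TruncatedLaw

variable {n m : ℕ}

/-- The joint law of `m` observations, restricted to the event that the squared magnetizations of
the clique sum to at most `W`. Without the restriction the second moment of the likelihood ratio is
dominated by atypically magnetized samples. -/
noncomputable def truncatedLaw (μ : Measure ℝ) (θ W : ℝ) (S : Finset (Fin n))
    (x : Fin m → Fin n → Bool) : ℝ :=
  if ∑ j, sqMagnetization S (x j) ≤ W then ∏ j, plantedLaw μ θ S (x j) else 0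

section General

variable (μ : Measure ℝ) (θ W : ℝ) (S : Finset (Fin n))

theorem prod_plantedLaw_nonneg (x : Fin m → Fin n → Bool) : 0 ≤ ∏ j, plantedLaw μ θ S (x j) :=
  Finset.prod_nonneg fun j _ => plantedLaw_nonneg μ θ S (x j)

theorem sum_prod_plantedLaw [IsProbabilityMeasure μ] :
    ∑ x : Fin m → Fin n → Bool, ∏ j, plantedLaw μ θ S (x j) = 1 := by
  rw [← Fintype.sum_pow, sum_plantedLaw, one_pow]

theorem truncatedLaw_nonneg (x : Fin m → Fin n → Bool) : 0 ≤ truncatedLaw μ θ W S x := by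
  unfold truncatedLaw
  split_ifs
  · exact prod_plantedLaw_nonneg μ θ S x
  · exact le_rfl

theorem truncatedLaw_le (x : Fin m → Fin n → Bool) :
    truncatedLaw μ θ W S x ≤ ∏ j, plantedLaw μ θ S (x j) := by
  unfold truncatedLaw
  split_ifs
  · exact le_rfl
  · exact prod_plantedLaw_nonneg μ θ S x

theorem truncatedLaw_le_exp_mul_prod_tiltedLaw {lam : ℝ} (hlam : 0 ≤ lam)
    (x : Fin m → Fin n → Bool) :
    truncatedLaw μ θ W S x ≤ Real.exp (lam * W) * ∏ j, tiltedLaw μ θ lam S (x j) := by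
  unfold truncatedLaw
  split_ifs with hW
  · simp only [tiltedLaw]
    rw [Finset.prod_mul_distrib, ← Real.exp_sum, mul_left_comm, ← Real.exp_add,
      Finset.sum_neg_distrib, ← Finset.mul_sum]
    refine le_mul_of_one_le_right (prod_plantedLaw_nonneg μ θ S x) (Real.one_le_exp ?_)
    linarith [mul_le_mul_of_nonneg_left hW hlam]
  · exact mul_nonneg (Real.exp_pos _).le (Finset.prod_nonneg fun j _ => tiltedLaw_nonneg _ _ _ _ _)

theorem sum_truncatedLaw_mul_le {lam : ℝ} (hlam : 0 ≤ lam) (S' : Finset (Fin n)) :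
    (2 ^ n) ^ m * ∑ x : Fin m → Fin n → Bool, truncatedLaw μ θ W S x * truncatedLaw μ θ W S' x ≤
      Real.exp (2 * lam * W) * overlapProduct μ θ lam S S' ^ m := by
  have hpoint (x : Fin m → Fin n → Bool) : truncatedLaw μ θ W S x * truncatedLaw μ θ W S' x ≤
      Real.exp (2 * lam * W) * ∏ j, tiltedLaw μ θ lam S (x j) * tiltedLaw μ θ lam S' (x j) := by
    have hle := truncatedLaw_le_exp_mul_prod_tiltedLaw μ θ W S hlam x
    refine (mul_le_mul hle (truncatedLaw_le_exp_mul_prod_tiltedLaw μ θ W S' hlam x)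
      (truncatedLaw_nonneg μ θ W S' x) ((truncatedLaw_nonneg μ θ W S x).trans hle)).trans_eq ?_
    rw [mul_mul_mul_comm, ← Real.exp_add, Finset.prod_mul_distrib]
    ring_nf
  refine (mul_le_mul_of_nonneg_left (Finset.sum_le_sum fun x _ => hpoint x)
    (by positivity)).trans_eq ?_
  rw [← Finset.mul_sum,
    ← Fintype.sum_pow fun σ => tiltedLaw μ θ lam S σ * tiltedLaw μ θ lam S' σ,
    overlapProduct, mul_pow]
  ring

theorem prod_plantedLaw_sub_truncatedLaw_le {t : ℝ} (ht : 0 ≤ t) (x : Fin m → Fin n → Bool) :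
    ∏ j, plantedLaw μ θ S (x j) - truncatedLaw μ θ W S x ≤
      Real.exp (-(t * W)) *
        ∏ j, plantedLaw μ θ S (x j) * Real.exp (t * sqMagnetization S (x j)) := by
  have hp := prod_plantedLaw_nonneg μ θ S x
  unfold truncatedLaw
  rw [Finset.prod_mul_distrib, ← Real.exp_sum, mul_left_comm, ← Real.exp_add, ← Finset.mul_sum]
  split_ifs with hW
  · rw [sub_self]
    positivity
  · rw [sub_zero]
    refine le_mul_of_one_le_right hp (Real.one_le_exp ?_)
    linarith [mul_le_mul_of_nonneg_left (not_le.1 hW).le ht]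

end General

variable {μ : Measure ℝ} [IsProbabilityMeasure μ] {θ γ c C D : ℝ} {S S' : Finset (Fin n)}

theorem one_sub_le_sum_truncatedLaw (hc : 0 ≤ c) (hM : MagnetizationMomentBound μ θ γ c C)
    (hS : S.Nonempty) :
    1 - (C * Real.exp (-(c * D))) ^ m ≤
      ∑ x : Fin m → Fin n → Bool, truncatedLaw μ θ (D * m * (S.card : ℝ) ^ (-γ)) S x := by
  have hk : (0 : ℝ) < S.card := by exact_mod_cast hS.card_pos
  have hexponent : c * (S.card : ℝ) ^ γ * (D * m * (S.card : ℝ) ^ (-γ)) = m * (c * D) := by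
    linear_combination c * mul_rpow_neg_mul_rpow hk (D * m) γ
  have hchernoff := Finset.sum_le_sum fun (x : Fin m → Fin n → Bool) (_ : x ∈ Finset.univ) =>
    prod_plantedLaw_sub_truncatedLaw_le μ θ (D * m * (S.card : ℝ) ^ (-γ)) S
      (by positivity : 0 ≤ c * (S.card : ℝ) ^ γ) x
  rw [Finset.sum_sub_distrib, sum_prod_plantedLaw, ← Finset.mul_sum, ← Fintype.sum_pow fun σ =>
      plantedLaw μ θ S σ * Real.exp (c * (S.card : ℝ) ^ γ * sqMagnetization S σ),
    hexponent, ← mul_neg, Real.exp_nat_mul, ← mul_pow] at hchernoff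
  simp only [mul_assoc c] at hchernoff
  have hpos : 0 ≤ ∑ σ, plantedLaw μ θ S σ *
      Real.exp (c * ((S.card : ℝ) ^ γ * sqMagnetization S σ)) :=
    Finset.sum_nonneg fun σ _ => mul_nonneg (plantedLaw_nonneg μ θ S σ) (Real.exp_pos _).le
  have hbound := pow_le_pow_left₀ (by positivity)
    (mul_le_mul_of_nonneg_left (hM n S hS) (Real.exp_pos (-(c * D))).le) m
  rw [mul_comm C]
  linarith

theorem sum_truncatedLaw_mul_le_of_small_overlap (hsymm : μ.map (fun h : ℝ => -h) = μ)
    (hγ : γ ≤ 1 / 2) (hc : 0 < c) (hM : MagnetizationMomentBound μ θ γ c C) (W : ℝ)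
    (hne : S.Nonempty) (hS : S.card = S'.card)
    (hρ : (S ∩ S').card * (S.card : ℝ) ^ (-γ) ≤ min (1 / 2) (c / 32)) :
    (2 ^ n) ^ m * ∑ x : Fin m → Fin n → Bool, truncatedLaw μ θ W S x * truncatedLaw μ θ W S' x ≤
      Real.exp (2048 / c ^ 2 * Real.exp c * C ^ 2 * m *
        ((S ∩ S').card * (S.card : ℝ) ^ (-γ)) ^ 2) := by
  refine (sum_truncatedLaw_mul_le μ θ W S le_rfl S').trans ?_
  have hoverlap := overlapProduct_zero_le_of_momentBound hsymm hγ hc hM hne hS hρ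
  rw [add_comm] at hoverlap
  rw [mul_zero, zero_mul, Real.exp_zero, one_mul]
  refine (pow_le_pow_left₀ (overlapProduct_nonneg _ _ _ _ _)
    (hoverlap.trans (Real.add_one_le_exp _)) m).trans_eq ?_
  rw [← Real.exp_nat_mul]
  ring_nf

theorem sum_truncatedLaw_mul_le_of_moderate_overlap (hsymm : μ.map (fun h : ℝ => -h) = μ)
    (θ W : ℝ) (hS : S.card = S'.card) (hr : 192 * (S ∩ S').card ≤ S.card) :
    (2 ^ n) ^ m * ∑ x : Fin m → Fin n → Bool, truncatedLaw μ θ W S x * truncatedLaw μ θ W S' x ≤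
      Real.exp (32 * (S ∩ S').card * W + 2 * m) := by
  have hthree : overlapProduct μ θ (16 * (S ∩ S').card) S S' ≤ Real.exp 2 :=
    (overlapProduct_le_three hsymm θ hS hr).trans (by linarith [Real.add_one_le_exp (2 : ℝ)])
  refine (sum_truncatedLaw_mul_le μ θ W S (by positivity : (0 : ℝ) ≤ 16 * (S ∩ S').card)
    S').trans ?_
  refine (mul_le_mul_of_nonneg_left
    (pow_le_pow_left₀ (overlapProduct_nonneg _ _ _ _ _) hthree m) (Real.exp_pos _).le).trans_eq ?_
  rw [← Real.exp_nat_mul, ← Real.exp_add]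
  ring_nf

theorem sum_truncatedLaw_mul_le_exp (hsymm : μ.map (fun h : ℝ => -h) = μ) (hθ : 0 ≤ θ) (W : ℝ)
    (hS : S.Nonempty) (S' : Finset (Fin n)) :
    (2 ^ n) ^ m * ∑ x : Fin m → Fin n → Bool, truncatedLaw μ θ W S x * truncatedLaw μ θ W S' x ≤
      Real.exp (θ * S.card * W) := by
  refine (sum_truncatedLaw_mul_le μ θ W S (by positivity : 0 ≤ θ * S.card / 2) S').trans ?_
  refine (mul_le_of_le_one_right (Real.exp_pos _).le (pow_le_one₀ (overlapProduct_nonneg _ _ _ _ _)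
    (overlapProduct_le_one hsymm hθ hS))).trans_eq ?_
  ring_nf

theorem sum_truncatedLaw_mul_le_of_large_overlap (hsymm : μ.map (fun h : ℝ => -h) = μ)
    (hθ : 0 ≤ θ) {c₁ : ℝ} (hc₁ : 0 < c₁) (hD : 0 ≤ D) (hne : S.Nonempty)
    (hS : S.card = S'.card) (hρ : c₁ ≤ (S ∩ S').card * (S.card : ℝ) ^ (-γ)) :
    (2 ^ n) ^ m * ∑ x : Fin m → Fin n → Bool, truncatedLaw μ θ (D * m * (S.card : ℝ) ^ (-γ)) S x *
        truncatedLaw μ θ (D * m * (S.card : ℝ) ^ (-γ)) S' x ≤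
      Real.exp ((32 * D + 2 / c₁ + 192 * θ * D) *
        (m * ((S ∩ S').card * (S.card : ℝ) ^ (-γ)))) := by
  set r := (S ∩ S').card
  set g := (S.card : ℝ) ^ (-γ) with hg
  have hg0 : 0 ≤ g := by positivity
  rcases le_or_gt (192 * r) S.card with hr | hr
  · refine (sum_truncatedLaw_mul_le_of_moderate_overlap hsymm θ _ hS hr).trans
      (Real.exp_le_exp.2 ?_)
    have hm : 2 * (m : ℝ) ≤ 2 / c₁ * (m * (r * g)) := by
      rw [div_mul_eq_mul_div, le_div_iff₀ hc₁]
      linarith [mul_le_mul_of_nonneg_left hρ (by positivity : 0 ≤ 2 * (m : ℝ))]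
    have hrest : 0 ≤ 192 * θ * D * (m * (r * g)) := by positivity
    linarith
  · refine (sum_truncatedLaw_mul_le_exp hsymm hθ _ hne S').trans (Real.exp_le_exp.2 ?_)
    have hr' : (S.card : ℝ) ≤ 192 * r := by exact_mod_cast hr.le
    have hrest : 0 ≤ (32 * D + 2 / c₁) * (m * (r * g)) := by positivity
    linarith [mul_le_mul_of_nonneg_left hr' (by positivity : 0 ≤ θ * D * m * g)]

end TruncatedLaw

section TwoPointBound

variable {X : Type*} [Fintype X] {p : X → ℝ}

theorem one_sub_sum_abs_sub_le {q ψ : X → ℝ} (hq : ∑ x, q x = 1)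
    (hψ : ∀ x, ψ x ∈ Set.Icc (0 : ℝ) 1) :
    1 - ∑ x, |q x - p x| ≤ ∑ x, q x * ψ x + ∑ x, p x * (1 - ψ x) := by
  have hpointwise : ∀ x, q x - |q x - p x| ≤ q x * ψ x + p x * (1 - ψ x) := fun x => by
    nlinarith [(hψ x).1, (hψ x).2, le_abs_self (q x - p x), abs_nonneg (q x - p x)]
  have hsum := Finset.sum_le_sum fun x (_ : x ∈ Finset.univ) => hpointwise x
  rwa [Finset.sum_sub_distrib, Finset.sum_add_distrib, hq] at hsum

theorem sum_abs_uniform_sub_le [Nonempty X] {a χ : ℝ} (hmass : 1 - a ≤ ∑ x, p x)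
    (hsecond : Fintype.card X * ∑ x, p x ^ 2 ≤ 1 + χ) :
    ∑ x, |(Fintype.card X : ℝ)⁻¹ - p x| ≤ √(χ + 2 * a) := by
  have hX : (Fintype.card X : ℝ) ≠ 0 := by exact_mod_cast Fintype.card_ne_zero
  refine Real.le_sqrt_of_sq_le ((sq_sum_le_card_mul_sum_sq (s := Finset.univ)
    (f := fun x => |(Fintype.card X : ℝ)⁻¹ - p x|)).trans ?_)
  have hexpand : Fintype.card X * ∑ x, |(Fintype.card X : ℝ)⁻¹ - p x| ^ 2 =
      1 - 2 * ∑ x, p x + Fintype.card X * ∑ x, p x ^ 2 := by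
    simp only [sq_abs, sub_sq]
    rw [Finset.sum_add_distrib, Finset.sum_sub_distrib, ← Finset.mul_sum, Finset.sum_const,
      Finset.card_univ, nsmul_eq_mul]
    field_simp
  rw [Finset.card_univ, hexpand]
  linarith

end TwoPointBound

section Risk

variable {n m k : ℕ} {μ : Measure ℝ} {θ : ℝ}

theorem typeIError_nonneg (μ : Measure ℝ) (ψ : DetectionTest n m) : 0 ≤ typeIError μ ψ :=
  Finset.sum_nonneg fun x _ => mul_nonneg (prod_plantedLaw_nonneg μ 0 ∅ x) (ψ.2 x).1

theorem typeIIError_nonneg (μ : Measure ℝ) (θ : ℝ) (S : Finset (Fin n)) (ψ : DetectionTest n m) :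
    0 ≤ typeIIError μ θ S ψ :=
  Finset.sum_nonneg fun x _ =>
    mul_nonneg (prod_plantedLaw_nonneg μ θ S x) (sub_nonneg.2 (ψ.2 x).2)

theorem bddBelow_range_testRisk (μ : Measure ℝ) (θ : ℝ) (n k m : ℕ) :
    BddBelow (Set.range fun ψ : DetectionTest n m => testRisk μ θ k ψ) := by
  refine ⟨0, ?_⟩
  rintro _ ⟨ψ, rfl⟩
  exact add_nonneg (typeIError_nonneg μ ψ)
    (Real.iSup_nonneg fun S => typeIIError_nonneg μ θ S.1 ψ)

theorem minimaxRisk_le_one (μ : Measure ℝ) [IsProbabilityMeasure μ] (θ : ℝ) (n k m : ℕ) :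
    minimaxRisk μ θ n k m ≤ 1 := by
  refine (ciInf_le (bddBelow_range_testRisk μ θ n k m) ⟨fun _ => 0, fun _ => by simp⟩).trans ?_
  simp only [testRisk, typeIError, mul_zero, Finset.sum_const_zero, zero_add]
  refine Real.iSup_le (fun S => ?_) zero_le_one
  simp [typeIIError, sum_prod_plantedLaw]

/-- The average over cliques of size `k` of the truncated planted laws: a Bayesian alternative. -/
noncomputable def truncatedMixture (μ : Measure ℝ) (θ W : ℝ) (k : ℕ) (x : Fin m → Fin n → Bool) :
    ℝ :=
  (∑ S ∈ Finset.univ.powersetCard k, truncatedLaw μ θ W S x) / n.choose k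

theorem card_powersetCard_univ_fin (n k : ℕ) :
    ((Finset.univ : Finset (Fin n)).powersetCard k).card = n.choose k := by
  rw [Finset.card_powersetCard, Finset.card_fin]

theorem choose_cast_pos (hkn : k ≤ n) : (0 : ℝ) < n.choose k := by
  exact_mod_cast Nat.choose_pos hkn

theorem one_sub_le_sum_truncatedMixture (hkn : k ≤ n) {W a : ℝ}
    (hmass : ∀ S : Finset (Fin n), S.card = k →
      1 - a ≤ ∑ x : Fin m → Fin n → Bool, truncatedLaw μ θ W S x) :
    1 - a ≤ ∑ x : Fin m → Fin n → Bool, truncatedMixture μ θ W k x := by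
  simp only [truncatedMixture]
  rw [← Finset.sum_div, Finset.sum_comm, le_div_iff₀ (choose_cast_pos hkn), mul_comm,
    ← card_powersetCard_univ_fin, ← nsmul_eq_mul]
  exact Finset.card_nsmul_le_sum _ _ _ fun S hS => hmass S (Finset.mem_powersetCard.1 hS).2

theorem sum_truncatedMixture_sq_le (hkn : k ≤ n) {W χ : ℝ}
    (hsecond : ∀ S : Finset (Fin n), S.card = k → ∑ S' ∈ Finset.univ.powersetCard k,
      (2 ^ n) ^ m * ∑ x : Fin m → Fin n → Bool, truncatedLaw μ θ W S x * truncatedLaw μ θ W S' x ≤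
        (1 + χ) * n.choose k) :
    (2 ^ n) ^ m * ∑ x : Fin m → Fin n → Bool, truncatedMixture μ θ W k x ^ 2 ≤ 1 + χ := by
  have hN := choose_cast_pos hkn
  have hdouble : (2 ^ n) ^ m * ∑ x : Fin m → Fin n → Bool, truncatedMixture μ θ W k x ^ 2 =
      (∑ S ∈ Finset.univ.powersetCard k, ∑ S' ∈ Finset.univ.powersetCard k,
        (2 ^ n) ^ m * ∑ x : Fin m → Fin n → Bool,
          truncatedLaw μ θ W S x * truncatedLaw μ θ W S' x) / (n.choose k) ^ 2 := by
    simp only [← Finset.mul_sum]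
    rw [mul_div_assoc, Finset.sum_congr rfl fun S _ => Finset.sum_comm, Finset.sum_comm,
      Finset.sum_div]
    simp only [← Finset.sum_mul_sum, ← sq, truncatedMixture, div_pow]
  rw [hdouble, div_le_iff₀ (by positivity)]
  refine (Finset.sum_le_card_nsmul _ _ _ fun S hS =>
    hsecond S (Finset.mem_powersetCard.1 hS).2).trans_eq ?_
  rw [card_powersetCard_univ_fin, nsmul_eq_mul]
  ring

theorem sum_truncatedMixture_mul_one_sub_le (hkn : k ≤ n) (μ : Measure ℝ) (θ W : ℝ)
    (ψ : DetectionTest n m) :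
    ∑ x, truncatedMixture μ θ W k x * (1 - ψ.1 x) ≤
      ⨆ S : {S : Finset (Fin n) // S.card = k}, typeIIError μ θ S.1 ψ := by
  have hmixture : ∑ x, truncatedMixture μ θ W k x * (1 - ψ.1 x) =
      (∑ S ∈ Finset.univ.powersetCard k, ∑ x, truncatedLaw μ θ W S x * (1 - ψ.1 x)) /
        n.choose k := by
    simp only [truncatedMixture, div_mul_eq_mul_div, Finset.sum_mul]
    rw [← Finset.sum_div, Finset.sum_comm]
  rw [hmixture, div_le_iff₀ (choose_cast_pos hkn), mul_comm, ← card_powersetCard_univ_fin,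
    ← nsmul_eq_mul]
  refine Finset.sum_le_card_nsmul _ _ _ fun S hS => ?_
  refine le_trans ?_ (le_ciSup (f := fun S : {S : Finset (Fin n) // S.card = k} =>
    typeIIError μ θ S.1 ψ) (Set.finite_range _).bddAbove ⟨S, (Finset.mem_powersetCard.1 hS).2⟩)
  exact Finset.sum_le_sum fun x _ =>
    mul_le_mul_of_nonneg_right (truncatedLaw_le μ θ W S x) (sub_nonneg.2 (ψ.2 x).2)

/-- Second moment method: the truncation makes the bound on the second moment possible, and costs
only the mass `a` removed. -/
theorem one_sub_sqrt_le_minimaxRisk [IsProbabilityMeasure μ]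
    (hsymm : μ.map (fun h : ℝ => -h) = μ) (hkn : k ≤ n) {W a χ : ℝ}
    (hmass : ∀ S : Finset (Fin n), S.card = k →
      1 - a ≤ ∑ x : Fin m → Fin n → Bool, truncatedLaw μ θ W S x)
    (hsecond : ∀ S : Finset (Fin n), S.card = k → ∑ S' ∈ Finset.univ.powersetCard k,
      (2 ^ n) ^ m * ∑ x : Fin m → Fin n → Bool, truncatedLaw μ θ W S x * truncatedLaw μ θ W S' x ≤
        (1 + χ) * n.choose k) :
    1 - √(χ + 2 * a) ≤ minimaxRisk μ θ n k m := by
  have : Nonempty (DetectionTest n m) := ⟨⟨fun _ => 0, fun _ => by simp⟩⟩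
  refine le_ciInf fun ψ => ?_
  have hcard : (Fintype.card (Fin m → Fin n → Bool) : ℝ) = (2 ^ n) ^ m := by simp
  have huniform : ∑ _x : Fin m → Fin n → Bool,
      (Fintype.card (Fin m → Fin n → Bool) : ℝ)⁻¹ = 1 := by simp
  have htypeI : typeIError μ ψ =
      ∑ x, (Fintype.card (Fin m → Fin n → Bool) : ℝ)⁻¹ * ψ.1 x := by
    rw [hcard]
    simp [typeIError, nullLaw_eq hsymm]
  have htotal := sum_abs_uniform_sub_le (one_sub_le_sum_truncatedMixture hkn hmass)
    (by rw [hcard]; exact sum_truncatedMixture_sq_le hkn hsecond)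
  have htest := one_sub_sum_abs_sub_le (p := truncatedMixture μ θ W k) huniform ψ.2
  rw [testRisk, htypeI]
  linarith [sum_truncatedMixture_mul_one_sub_le hkn μ θ W ψ]

theorem minimaxRisk_zero_samples [IsProbabilityMeasure μ] (hsymm : μ.map (fun h : ℝ => -h) = μ)
    (θ : ℝ) (hkn : k ≤ n) : minimaxRisk μ θ n k 0 = 1 := by
  refine le_antisymm (minimaxRisk_le_one μ θ n k 0) ?_
  simpa using one_sub_sqrt_le_minimaxRisk hsymm (θ := θ) (m := 0) hkn (W := 0) (a := 0) (χ := 0)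
    (fun S _ => by simp [truncatedLaw]) (fun S _ => by simp [truncatedLaw])

end Risk

section Hypergeometric

variable {n k : ℕ} {S : Finset (Fin n)}

theorem card_filter_inter_card_le (hS : S.card = k) (r : ℕ) :
    (((Finset.univ : Finset (Fin n)).powersetCard k).filter
      fun S' => (S ∩ S').card = r).card ≤ k.choose r * (n - r).choose (k - r) := by
  have hsub : (Finset.univ.powersetCard k).filter (fun S' => (S ∩ S').card = r) ⊆
      (S.powersetCard r).biUnion fun T =>
        ((Finset.univ \ T).powersetCard (k - r)).image fun U => T ∪ U := by
    intro S' hS'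
    rw [Finset.mem_filter, Finset.mem_powersetCard] at hS'
    refine Finset.mem_biUnion.2 ⟨S ∩ S',
      Finset.mem_powersetCard.2 ⟨Finset.inter_subset_left, hS'.2⟩, ?_⟩
    refine Finset.mem_image.2 ⟨S' \ (S ∩ S'), Finset.mem_powersetCard.2 ⟨?_, ?_⟩, ?_⟩
    · exact Finset.sdiff_subset_sdiff (Finset.subset_univ _) le_rfl
    · rw [Finset.card_sdiff_of_subset Finset.inter_subset_right, hS'.1.2, hS'.2]
    · exact Finset.union_sdiff_of_subset Finset.inter_subset_right
  refine (Finset.card_le_card hsub).trans ?_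
  rw [← hS, ← Finset.card_powersetCard]
  refine Finset.card_biUnion_le_card_mul _ _ _ fun T hT => Finset.card_image_le.trans_eq ?_
  rw [Finset.card_powersetCard, Finset.card_sdiff_of_subset (Finset.subset_univ T),
    Finset.card_fin, (Finset.mem_powersetCard.1 hT).2]

theorem choose_sub_sub_mul_pow_le (hkn : k ≤ n) (r : ℕ) (hr : r ≤ k) :
    (n - r).choose (k - r) * n ^ r ≤ k ^ r * n.choose k := by
  induction r with
  | zero => simp
  | succ r ih =>
    have ih := ih (by lia)
    obtain ⟨a, ha⟩ : ∃ a, n = a + 1 + r := ⟨n - r - 1, by lia⟩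
    obtain ⟨b, hb⟩ : ∃ b, k = b + 1 + r := ⟨k - r - 1, by lia⟩
    have hba : b ≤ a := by lia
    rw [show n - r = a + 1 by lia, show k - r = b + 1 by lia] at ih
    rw [show n - (r + 1) = a by lia, show k - (r + 1) = b by lia]
    have hcross : n * (b + 1) ≤ k * (a + 1) := by
      rw [ha, hb]
      nlinarith
    refine le_of_mul_le_mul_left ?_ (Nat.succ_pos a)
    calc (a + 1) * (a.choose b * n ^ (r + 1))
        = (a + 1) * a.choose b * n * n ^ r := by ring
      _ = n * (b + 1) * ((a + 1).choose (b + 1) * n ^ r) := by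
        rw [Nat.add_one_mul_choose_eq a b]
        ring
      _ ≤ k * (a + 1) * (k ^ r * n.choose k) := Nat.mul_le_mul hcross ih
      _ = (a + 1) * (k ^ (r + 1) * n.choose k) := by ring

/-- The law of the size of the intersection of `S` with a uniformly random set of size `k`. -/
noncomputable def overlapLaw (k : ℕ) (S : Finset (Fin n)) (r : ℕ) : ℝ :=
  ((Finset.univ.powersetCard k).filter fun S' => (S ∩ S').card = r).card / (n.choose k : ℝ)

theorem overlapLaw_nonneg (k : ℕ) (S : Finset (Fin n)) (r : ℕ) : 0 ≤ overlapLaw k S r := by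
  unfold overlapLaw
  positivity

theorem sum_overlapLaw_mul (hkn : k ≤ n) (hS : S.card = k) (F : ℕ → ℝ) :
    ∑ S' ∈ (Finset.univ : Finset (Fin n)).powersetCard k, F (S ∩ S').card =
      (∑ r ∈ Finset.range (k + 1), overlapLaw k S r * F r) * n.choose k := by
  have hN := choose_cast_pos hkn
  rw [← Finset.sum_fiberwise_of_maps_to (t := Finset.range (k + 1))
    (g := fun S' => (S ∩ S').card), Finset.sum_mul]
  · refine Finset.sum_congr rfl fun r _ => ?_
    rw [Finset.sum_congr rfl fun S' hS' => by rw [(Finset.mem_filter.1 hS').2], Finset.sum_const,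
      nsmul_eq_mul, overlapLaw]
    field_simp
  · intro S' _
    rw [Finset.mem_range, Nat.lt_succ_iff, ← hS]
    exact Finset.card_le_card Finset.inter_subset_left

theorem sum_overlapLaw (hkn : k ≤ n) (hS : S.card = k) :
    ∑ r ∈ Finset.range (k + 1), overlapLaw k S r = 1 := by
  have htotal := sum_overlapLaw_mul hkn hS fun _ => 1
  simp only [Finset.sum_const, card_powersetCard_univ_fin, nsmul_eq_mul, mul_one] at htotal
  exact mul_right_cancel₀ (choose_cast_pos hkn).ne' (by rw [← htotal, one_mul])

theorem choose_le_exp_one_mul_div_pow (k r : ℕ) :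
    (k.choose r : ℝ) ≤ (Real.exp 1 * k / r) ^ r := by
  rcases r.eq_zero_or_pos with rfl | hr
  · simp
  have hr0 : (0 : ℝ) < r := by exact_mod_cast hr
  have hstirling : (r : ℝ) ^ r / r.factorial ≤ Real.exp 1 ^ r := by
    rw [Real.exp_one_pow]
    exact Real.pow_div_factorial_le_exp (r : ℝ) hr0.le r
  refine (Nat.choose_le_pow_div r k).trans ?_
  rw [div_pow, mul_pow, le_div_iff₀ (by positivity)]
  calc (k : ℝ) ^ r / r.factorial * (r : ℝ) ^ r = (r : ℝ) ^ r / r.factorial * k ^ r := by ring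
    _ ≤ Real.exp 1 ^ r * k ^ r := by gcongr

theorem overlapLaw_le (hkn : k ≤ n) (hk : 0 < k) (hS : S.card = k) (r : ℕ) :
    overlapLaw k S r ≤ (Real.exp 1 * ((k : ℝ) ^ 2 / n) / r) ^ r := by
  have hn : (0 : ℝ) < n := by exact_mod_cast hk.trans_le hkn
  rw [overlapLaw, div_le_iff₀ (choose_cast_pos hkn)]
  have hcount : (((Finset.univ.powersetCard k).filter fun S' => (S ∩ S').card = r).card : ℝ) ≤
      k.choose r * (n - r).choose (k - r) := by
    exact_mod_cast card_filter_inter_card_le hS r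
  refine hcount.trans ?_
  rcases le_or_gt r k with hrk | hrk
  · have hchoose : ((n - r).choose (k - r) : ℝ) ≤ (k / n) ^ r * n.choose k := by
      rw [div_pow, div_mul_eq_mul_div, le_div_iff₀ (by positivity)]
      exact_mod_cast choose_sub_sub_mul_pow_le hkn r hrk
    calc (k.choose r : ℝ) * (n - r).choose (k - r)
        ≤ (Real.exp 1 * k / r) ^ r * ((k / n) ^ r * n.choose k) :=
          mul_le_mul (choose_le_exp_one_mul_div_pow k r) hchoose (by positivity) (by positivity)
      _ = (Real.exp 1 * ((k : ℝ) ^ 2 / n) / r) ^ r * n.choose k := by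
        rw [← mul_assoc, ← mul_pow]
        congr 2
        ring
  · rw [Nat.choose_eq_zero_of_lt hrk, Nat.cast_zero, zero_mul]
    positivity

end Hypergeometric

section OverlapRate

open Real

variable {γ ε a k n : ℝ}

theorem rpow_div_sq_div_sq (hk : 0 < k) (γ n : ℝ) :
    (k ^ γ / (k ^ 2 / n)) ^ 2 = n ^ 2 * k ^ (2 * γ - 4) := by
  rw [rpow_sub hk, mul_comm 2 γ, rpow_mul hk.le, rpow_two,
    show (k : ℝ) ^ (4 : ℝ) = k ^ 4 by exact_mod_cast rpow_natCast k 4]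
  field_simp

theorem log_rpow_div_sq_div (hk : 0 < k) (hn : 0 < n) (γ : ℝ) :
    log (k ^ γ / (k ^ 2 / n)) = γ * log k - 2 * log k + log n := by
  rw [log_div (by positivity) (by positivity), log_div (by positivity) hn.ne', log_rpow hk,
    log_pow]
  push_cast
  ring

/-- If `k ^ γ` exceeds the mean overlap `k ^ 2 / n` by a power of `n`, then `log n` is at most a
multiple of the logarithm of their ratio; otherwise the ratio squared is at most `k ^ γ`. -/
theorem le_mul_rpow_mul_one_add_posLog (hγ0 : 0 < γ) (hγ1 : γ ≤ 1) (hε : 0 ≤ ε) (hk : 1 ≤ k)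
    (hn : 1 ≤ n) (hratio : a ≤ ε * (n ^ 2 * k ^ (2 * γ - 4)))
    (hlog : a ≤ ε * (k ^ γ * log n)) :
    a ≤ 8 * ε / γ * (k ^ γ * (1 + posLog (k ^ γ / (k ^ 2 / n)))) := by
  have hk0 : 0 < k := by linarith
  have hn0 : 0 < n := by linarith
  have hratioLog := log_rpow_div_sq_div hk0 hn0 γ
  rcases le_total (γ / 8 * log n) (log (k ^ γ / (k ^ 2 / n))) with hsparse | hdense
  · calc a ≤ ε * (k ^ γ * log n) := hlog
      _ = 8 * ε / γ * (k ^ γ * (γ / 8 * log n)) := by field_simp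
      _ ≤ 8 * ε / γ * (k ^ γ * (1 + posLog (k ^ γ / (k ^ 2 / n)))) := by
        gcongr
        rw [posLog_apply]
        linarith [le_max_right 0 (log (k ^ γ / (k ^ 2 / n)))]
  · have hpow : n ^ 2 * k ^ (2 * γ - 4) ≤ k ^ γ := by
      rw [← log_le_log_iff (by positivity) (by positivity), log_mul (by positivity) (by positivity),
        log_pow, log_rpow hk0, log_rpow hk0]
      push_cast
      refine le_of_mul_le_mul_left ?_ (by linarith : 0 < 1 - γ / 8)
      nlinarith [mul_nonneg hγ0.le (log_nonneg hk), mul_nonneg (sq_nonneg γ) (log_nonneg hk)]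
    calc a ≤ ε * (n ^ 2 * k ^ (2 * γ - 4)) := hratio
      _ ≤ ε * k ^ γ := by gcongr
      _ = ε * (k ^ γ * 1) := by ring
      _ ≤ 8 * ε / γ * (k ^ γ * (1 + posLog (k ^ γ / (k ^ 2 / n)))) := by
        gcongr
        · rw [le_div_iff₀ hγ0]
          nlinarith
        · exact le_add_of_nonneg_right posLog_nonneg

variable {s c v : ℝ}

theorem mul_posLog_inv_le_one (hs : 0 ≤ s) : s * posLog s⁻¹ ≤ 1 := by
  rcases hs.eq_or_lt with rfl | hs
  · simp
  rw [posLog_apply, mul_max_of_nonneg _ _ hs.le, mul_zero]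
  refine max_le zero_le_one ?_
  calc s * log s⁻¹ ≤ s * s⁻¹ := by
        gcongr
        exact log_le_self (by positivity)
    _ = 1 := mul_inv_cancel₀ hs.ne'

theorem posLog_div_le (hv : 0 ≤ log v) (s : ℝ) : posLog (v / s) ≤ log v + posLog s⁻¹ := by
  rw [div_eq_mul_inv]
  refine posLog_mul.trans_eq ?_
  rw [posLog_apply (x := v), max_eq_right hv]

theorem mul_one_add_posLog_div_le (hs : 0 ≤ s) (hsc : s ≤ c) (hv : 3 ≤ log v) :
    s * (1 + posLog (v / s)) ≤ (2 * c + 1) * (log v - 1) := by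
  calc s * (1 + posLog (v / s)) ≤ s * (1 + (log v + posLog s⁻¹)) := by
        gcongr
        exact posLog_div_le (by linarith) s
    _ = s * (1 + log v) + s * posLog s⁻¹ := by ring
    _ ≤ c * (1 + log v) + 1 :=
      add_le_add (mul_le_mul_of_nonneg_right hsc (by linarith)) (mul_posLog_inv_le_one hs)
    _ ≤ (2 * c + 1) * (log v - 1) := by nlinarith

theorem one_add_posLog_div_le (hc : 0 < c) (hcs : c ≤ s) (hv : 3 ≤ log v) :
    1 + posLog (v / s) ≤ (2 + posLog c⁻¹) * (log v - 1) := by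
  have hinv : posLog s⁻¹ ≤ posLog c⁻¹ :=
    posLog_le_posLog (inv_nonneg.2 (hc.le.trans hcs)) (inv_anti₀ hc hcs)
  nlinarith [posLog_div_le (v := v) (by linarith) s, posLog_nonneg (x := c⁻¹)]

end OverlapRate

section SecondMoment

open Real

theorem eventually_mul_le_of_pos (A : ℝ) {b : ℝ} (hb : 0 < b) :
    ∀ᶠ ε in 𝓝[>] (0 : ℝ), ε * A ≤ b := by
  have hlim : Tendsto (fun ε : ℝ => ε * A) (𝓝[>] 0) (𝓝 0) := by
    have hcont : ContinuousAt (fun ε : ℝ => ε * A) 0 := by fun_prop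
    simpa [ContinuousAt] using hcont.mono_left nhdsWithin_le_nhds
  exact (hlim.eventually_lt_const hb).mono fun ε hε => hε.le

theorem sum_range_pow_succ_le {x : ℝ} (hx0 : 0 ≤ x) (hx : x ≤ 1 / 2) (k : ℕ) :
    ∑ r ∈ Finset.range k, x ^ (r + 1) ≤ 2 * x := by
  have hgeom := Summable.sum_le_tsum (Finset.range k) (fun r _ => pow_nonneg hx0 r)
    (summable_geometric_of_lt_one hx0 (by linarith))
  rw [tsum_geometric_of_lt_one hx0 (by linarith)] at hgeom
  have hinv : (1 - x)⁻¹ ≤ 2 := by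
    rw [inv_le_comm₀ (by linarith) two_pos]
    linarith
  simp only [pow_succ]
  rw [← Finset.sum_mul]
  exact mul_le_mul_of_nonneg_right (hgeom.trans hinv) hx0

theorem sum_mul_le_of_forall_or {k : ℕ} {p F : ℕ → ℝ} {η x : ℝ} (hp : ∀ r, 0 ≤ p r)
    (hsum : ∑ r ∈ Finset.range (k + 1), p r = 1) (hη : 0 ≤ η) (hx0 : 0 ≤ x) (hx : x ≤ 1 / 2)
    (hF : ∀ r ≤ k, F r ≤ 1 + η ∨ 0 < r ∧ p r * F r ≤ x ^ r) :
    ∑ r ∈ Finset.range (k + 1), p r * F r ≤ 1 + η + 2 * x := by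
  have hterm : ∀ r ∈ Finset.range (k + 1),
      p r * F r ≤ p r * (1 + η) + if r = 0 then 0 else x ^ r := by
    intro r hr
    have hpη : 0 ≤ p r * (1 + η) := mul_nonneg (hp r) (by linarith)
    rcases hF r (Nat.lt_succ_iff.1 (Finset.mem_range.1 hr)) with hbulk | ⟨hr0, htail⟩
    · refine le_add_of_le_of_nonneg (mul_le_mul_of_nonneg_left hbulk (hp r)) ?_
      split_ifs <;> positivity
    · rw [if_neg hr0.ne']
      exact le_add_of_nonneg_of_le hpη htail
  refine (Finset.sum_le_sum hterm).trans ?_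
  rw [Finset.sum_add_distrib, ← Finset.sum_mul, hsum, one_mul, Finset.sum_range_succ']
  simp only [Nat.add_eq_zero_iff, one_ne_zero, and_false, if_false, if_true, add_zero]
  gcongr
  exact sum_range_pow_succ_le hx0 hx k

section Pointwise

variable {p F K₁ K₂ c ε ε' g M a y : ℝ} {r : ℕ}

theorem le_exp_half_mul_log_of_rate (hK₁ : 0 ≤ K₁) (hK₂ : 0 ≤ K₂) (hc : 0 < c) (hg : 0 < g)
    (hM : M ≠ 0) (ha : a ≤ ε' * (g * (1 + posLog (g / M)))) (hr : 0 < r)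
    (hlog : 3 ≤ log (r / M)) (hε₁ : ε' * (K₁ * (2 * c + 1)) ≤ 1 / 2)
    (hε₂ : ε' * (K₂ * (2 + posLog c⁻¹)) ≤ 1 / 2) (hε' : 0 ≤ ε')
    (hsmall : r / g ≤ c → F ≤ exp (K₁ * a * (r / g) ^ 2))
    (hlarge : c < r / g → F ≤ exp (K₂ * (a * (r / g)))) :
    F ≤ exp (r * ((log (r / M) - 1) / 2)) := by
  have hr0 : (0 : ℝ) < r := by exact_mod_cast hr
  have hratio : g / M = r / M / (r / g) := by field_simp
  rw [hratio] at ha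
  have hℓ : 0 ≤ r * (log (r / M) - 1) := mul_nonneg hr0.le (by linarith)
  rcases le_or_gt (r / g) c with hs | hs
  · refine (hsmall hs).trans (exp_le_exp.2 ?_)
    calc K₁ * a * (r / g) ^ 2
        ≤ K₁ * (ε' * (g * (1 + posLog (r / M / (r / g))))) * (r / g) ^ 2 := by gcongr
      _ = ε' * K₁ * r * (r / g * (1 + posLog (r / M / (r / g)))) := by field_simp
      _ ≤ ε' * K₁ * r * ((2 * c + 1) * (log (r / M) - 1)) :=
        mul_le_mul_of_nonneg_left (mul_one_add_posLog_div_le (by positivity) hs hlog)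
          (by positivity)
      _ = ε' * (K₁ * (2 * c + 1)) * (r * (log (r / M) - 1)) := by ring
      _ ≤ 1 / 2 * (r * (log (r / M) - 1)) := by gcongr
      _ = r * ((log (r / M) - 1) / 2) := by ring
  · refine (hlarge hs).trans (exp_le_exp.2 ?_)
    calc K₂ * (a * (r / g))
        ≤ K₂ * (ε' * (g * (1 + posLog (r / M / (r / g)))) * (r / g)) := by gcongr
      _ = ε' * K₂ * r * (1 + posLog (r / M / (r / g))) := by field_simp
      _ ≤ ε' * K₂ * r * ((2 + posLog c⁻¹) * (log (r / M) - 1)) := by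
        gcongr
        exact one_add_posLog_div_le hc hs.le hlog
      _ = ε' * (K₂ * (2 + posLog c⁻¹)) * (r * (log (r / M) - 1)) := by ring
      _ ≤ 1 / 2 * (r * (log (r / M) - 1)) := by gcongr
      _ = r * ((log (r / M) - 1) / 2) := by ring

theorem mul_le_exp_neg_pow_of_poisson_tail (hp : 0 ≤ p) (hM : 0 < M) (hr : 0 < r)
    (htail : p ≤ (exp 1 * M / r) ^ r) (hF : F ≤ exp (r * ((log (r / M) - 1) / 2)))
    (hy : 1 + 2 * y ≤ log (r / M)) : p * F ≤ exp (-y) ^ r := by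
  have hr0 : (0 : ℝ) < r := by exact_mod_cast hr
  have hbase : exp 1 * M / r = exp (1 - log (r / M)) := by
    rw [exp_sub, exp_log (by positivity)]
    field_simp
  rw [hbase, ← exp_nat_mul] at htail
  calc p * F ≤ exp (r * (1 - log (r / M))) * exp (r * ((log (r / M) - 1) / 2)) :=
        (mul_le_mul_of_nonneg_left hF hp).trans (mul_le_mul_of_nonneg_right htail (exp_pos _).le)
    _ = exp (r * ((1 - log (r / M)) / 2)) := by
      rw [← exp_add]
      congr 1
      ring
    _ ≤ exp (r * -y) := by
      gcongr
      linarith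
    _ = exp (-y) ^ r := exp_nat_mul _ _

theorem le_exp_of_lt_mul_mean {K : ℝ} (hK₁ : 0 ≤ K₁) (hc : 0 ≤ c) (hg : 0 < g)
    (ha : 1 ≤ a) (hratio : a * (M / g) ^ 2 ≤ ε) (hεc : ε * K ^ 2 ≤ c ^ 2) (hr : r < K * M)
    (hsmall : r / g ≤ c → F ≤ exp (K₁ * a * (r / g) ^ 2)) : F ≤ exp (ε * (K₁ * K ^ 2)) := by
  have hrg : r / g ≤ K * (M / g) := by
    rw [← mul_div_assoc]
    gcongr
  have hone : (M / g) ^ 2 ≤ ε := (le_mul_of_one_le_left (sq_nonneg _) ha).trans hratio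
  have hs : r / g ≤ c := by
    refine hrg.trans (abs_le_of_sq_le_sq' ?_ hc).2
    rw [mul_pow, mul_comm]
    exact (mul_le_mul_of_nonneg_right hone (sq_nonneg K)).trans hεc
  refine (hsmall hs).trans (exp_le_exp.2 ?_)
  calc K₁ * a * (r / g) ^ 2 ≤ K₁ * a * (K * (M / g)) ^ 2 := by gcongr
    _ = a * (M / g) ^ 2 * (K₁ * K ^ 2) := by ring
    _ ≤ ε * (K₁ * K ^ 2) := by gcongr

theorem bulk_or_tail_of_rate {η : ℝ} (hp : 0 ≤ p) (hη : 0 < η) (hy : 1 ≤ y) (hK₁ : 0 ≤ K₁)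
    (hK₂ : 0 ≤ K₂) (hc : 0 < c) (hg : 0 < g) (hM : 0 < M) (hε' : 0 ≤ ε') (ha : 1 ≤ a)
    (hratio : a * (M / g) ^ 2 ≤ ε) (hrate : a ≤ ε' * (g * (1 + posLog (g / M))))
    (hεc : ε * exp (1 + 2 * y) ^ 2 ≤ c ^ 2)
    (hεη : ε * (K₁ * exp (1 + 2 * y) ^ 2) ≤ log (1 + η))
    (hε₁ : ε' * (K₁ * (2 * c + 1)) ≤ 1 / 2) (hε₂ : ε' * (K₂ * (2 + posLog c⁻¹)) ≤ 1 / 2)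
    (htail : p ≤ (exp 1 * M / r) ^ r)
    (hsmall : r / g ≤ c → F ≤ exp (K₁ * a * (r / g) ^ 2))
    (hlarge : c < r / g → F ≤ exp (K₂ * (a * (r / g)))) :
    F ≤ 1 + η ∨ 0 < r ∧ p * F ≤ exp (-y) ^ r := by
  rcases lt_or_ge (r : ℝ) (exp (1 + 2 * y) * M) with hr | hr
  · left
    refine (le_exp_of_lt_mul_mean hK₁ hc.le hg ha hratio hεc hr hsmall).trans ?_
    rwa [← le_log_iff_exp_le (by linarith)]
  · right
    have hr0 : (0 : ℝ) < r := lt_of_lt_of_le (by positivity) hr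
    have hrpos : 0 < r := by exact_mod_cast hr0
    have hlog : 1 + 2 * y ≤ log (r / M) := by
      rwa [le_log_iff_exp_le (by positivity), le_div_iff₀ hM]
    exact ⟨hrpos, mul_le_exp_neg_pow_of_poisson_tail hp hM hrpos htail
      (le_exp_half_mul_log_of_rate hK₁ hK₂ hc hg hM.ne' hrate hrpos (by linarith) hε₁ hε₂ hε'
        hsmall hlarge) hlog⟩

end Pointwise

/-- The contribution of overlaps `r` below a large multiple of the mean `k ^ 2 / n` is controlled
by the first bound on `m`; beyond, the Poisson tail of `p` wins against `F`. -/
theorem exists_sum_overlap_le {γ c K₁ K₂ η : ℝ} (hγ0 : 0 < γ) (hγ1 : γ ≤ 1) (hc : 0 < c)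
    (hK₁ : 0 ≤ K₁) (hK₂ : 0 ≤ K₂) (hη : 0 < η) :
    ∃ ε > 0, ∀ n k m : ℕ, 0 < n → 0 < k → 0 < m →
      (m : ℝ) ≤ ε * ((n : ℝ) ^ 2 * (k : ℝ) ^ (2 * γ - 4)) →
      (m : ℝ) ≤ ε * ((k : ℝ) ^ γ * log n) →
      ∀ F p : ℕ → ℝ, (∀ r, 0 ≤ p r) → ∑ r ∈ Finset.range (k + 1), p r = 1 →
      (∀ r, p r ≤ (exp 1 * ((k : ℝ) ^ 2 / n) / r) ^ r) →
      (∀ r ≤ k, (r : ℝ) * (k : ℝ) ^ (-γ) ≤ c →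
        F r ≤ exp (K₁ * m * (r * (k : ℝ) ^ (-γ)) ^ 2)) →
      (∀ r ≤ k, c < (r : ℝ) * (k : ℝ) ^ (-γ) →
        F r ≤ exp (K₂ * (m * (r * (k : ℝ) ^ (-γ))))) →
      ∑ r ∈ Finset.range (k + 1), p r * F r ≤ 1 + η := by
  set y := max 1 (log (4 / η))
  have hy : exp (-y) ≤ 1 / 2 ∧ exp (-y) ≤ η / 4 := by
    constructor
    · rw [exp_neg, one_div]
      exact inv_anti₀ two_pos
        (by linarith [add_one_le_exp (1 : ℝ), exp_le_exp.2 (le_max_left 1 (log (4 / η)))])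
    · rw [exp_neg, ← inv_div]
      refine inv_anti₀ (by positivity) ?_
      rw [← log_le_iff_le_exp (by positivity)]
      exact le_max_right 1 _
  obtain ⟨ε, ⟨⟨⟨hεc, hεη⟩, hε₁⟩, hε₂⟩, hε0⟩ := ((((eventually_mul_le_of_pos (exp (1 + 2 * y) ^ 2)
    (pow_pos hc 2)).and (eventually_mul_le_of_pos (K₁ * exp (1 + 2 * y) ^ 2)
    (log_pos (by linarith : 1 < 1 + η / 2)))).and (eventually_mul_le_of_pos
    (8 / γ * (K₁ * (2 * c + 1))) one_half_pos)).and (eventually_mul_le_of_pos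
    (8 / γ * (K₂ * (2 + posLog c⁻¹))) one_half_pos)).and self_mem_nhdsWithin |>.exists
  refine ⟨ε, hε0, fun n k m hn hk hm hratio hlog F p hp hsum htail hsmall hlarge => ?_⟩
  have hn1 : (1 : ℝ) ≤ n := by exact_mod_cast hn
  have hk1 : (1 : ℝ) ≤ k := by exact_mod_cast hk
  have hrate := le_mul_rpow_mul_one_add_posLog hγ0 hγ1 hε0.le hk1 hn1 hratio hlog
  have hratio' : (m : ℝ) * ((k : ℝ) ^ 2 / n / (k : ℝ) ^ γ) ^ 2 ≤ ε := by
    rw [← rpow_div_sq_div_sq (by positivity), ← div_le_iff₀ (by positivity)] at hratio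
    rwa [← inv_div, inv_pow, ← div_eq_mul_inv]
  simp only [rpow_neg (Nat.cast_nonneg k), ← div_eq_mul_inv] at hsmall hlarge
  have hsplit := sum_mul_le_of_forall_or hp hsum (half_pos hη).le (exp_pos (-y)).le hy.1
    fun r hr => bulk_or_tail_of_rate (hp r) (half_pos hη) (le_max_left 1 _) hK₁ hK₂ hc
      (by positivity) (by positivity) (by positivity) (by exact_mod_cast hm) hratio' hrate hεc hεη
      (by rwa [mul_div_right_comm, mul_comm (8 / γ), mul_assoc])
      (by rwa [mul_div_right_comm, mul_comm (8 / γ), mul_assoc]) (htail r) (hsmall r hr)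
      (hlarge r hr)
  linarith [hy.2]

end SecondMoment

section LaplaceIntegral

theorem integral_exp_neg_mul_abs {s : ℝ} (hs : 0 < s) :
    ∫ x : ℝ, Real.exp (-(s * |x|)) = 2 / s := by
  have h := integral_exp_mul_Ioi (a := -s) (by linarith) 0
  simp only [neg_mul, mul_zero, Real.exp_zero, neg_div_neg_eq] at h
  rw [integral_comp_abs (f := fun x => Real.exp (-(s * x))), h]
  ring

theorem integrable_exp_neg_mul_abs {s : ℝ} (hs : 0 < s) :
    Integrable fun x : ℝ => Real.exp (-(s * |x|)) :=
  .of_integral_ne_zero (by rw [integral_exp_neg_mul_abs hs]; positivity)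

theorem sqrt_mul_integral_exp_neg_mul_abs_le {k q : ℝ} (hk : 0 < k) (hq : 0 < q) :
    √(k / 2 / Real.pi) * ∫ x : ℝ, Real.exp (-(q * √k * |x|)) ≤ 1 / q := by
  have hsqrt : √(k / 2 / Real.pi) ≤ √k / 2 := by
    rw [Real.sqrt_le_left (by positivity), div_pow, Real.sq_sqrt hk.le, div_div]
    gcongr
    linarith [Real.pi_gt_three]
  rw [integral_exp_neg_mul_abs (by positivity)]
  calc √(k / 2 / Real.pi) * (2 / (q * √k)) ≤ √k / 2 * (2 / (q * √k)) := by gcongr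
    _ = 1 / q := by field_simp

end LaplaceIntegral

section GaussianIntegral

variable {B : ℝ}

theorem exp_neg_mul_sq_add_eq (hB : 0 < B) (ω x : ℝ) :
    Real.exp (-B * x ^ 2 + ω * x) =
      Real.exp (ω ^ 2 / (4 * B)) * Real.exp (-B * (x - ω / (2 * B)) ^ 2) := by
  rw [← Real.exp_add]
  congr 1
  field_simp
  ring

theorem integrable_exp_neg_mul_sq_add (hB : 0 < B) (ω : ℝ) :
    Integrable fun x : ℝ => Real.exp (-B * x ^ 2 + ω * x) := by
  simp only [exp_neg_mul_sq_add_eq hB ω]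
  exact ((integrable_exp_neg_mul_sq hB).comp_sub_right (ω / (2 * B))).const_mul _

theorem integral_exp_neg_mul_sq_add (hB : 0 < B) (ω : ℝ) :
    ∫ x : ℝ, Real.exp (-B * x ^ 2 + ω * x) = √(Real.pi / B) * Real.exp (ω ^ 2 / (4 * B)) := by
  simp only [exp_neg_mul_sq_add_eq hB ω]
  rw [integral_const_mul, integral_sub_right_eq_self (fun x : ℝ => Real.exp (-B * x ^ 2)),
    integral_gaussian, mul_comm]

end GaussianIntegral

section FieldLogPartition

variable {ι : Type*}

/-- The log-partition function of the spins of `S` in the fields `a x + h i`, relative to that in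
the fields `h i`. -/
noncomputable def fieldLogPartition (a : ℝ) (S : Finset ι) (h : ι → ℝ) (x : ℝ) : ℝ :=
  ∑ i ∈ S, (logCosh (a * x + h i) - logCosh (h i))

theorem fieldLogPartition_le {a : ℝ} (ha : 0 ≤ a) (S : Finset ι) (h : ι → ℝ) (x : ℝ) :
    fieldLogPartition a S h x ≤ S.card * (a * |x|) := by
  refine (Finset.sum_le_card_nsmul S _ (a * |x|) fun i _ => ?_).trans_eq (nsmul_eq_mul _ _)
  refine (le_abs_self _).trans ((abs_logCosh_sub_le _ _).trans_eq ?_)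
  rw [add_sub_cancel_right, abs_mul, abs_of_nonneg ha]

theorem integrable_exp_add_fieldLogPartition {a B : ℝ} (ha : 0 ≤ a) (hB : 0 < B) (S : Finset ι)
    (h : ι → ℝ) : Integrable fun x : ℝ => Real.exp (-B * x ^ 2 + fieldLogPartition a S h x) := by
  have hcont : Continuous (fieldLogPartition a S h) :=
    continuous_finsetSum _ fun i _ =>
      (((contDiff_logCosh 0).continuous.comp (by fun_prop)).sub continuous_const)
  refine ((integrable_exp_neg_mul_sq_add hB (S.card * a)).add
    (integrable_exp_neg_mul_sq_add hB (-(S.card * a)))).mono' (by fun_prop)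
    (Eventually.of_forall fun x => ?_)
  have hle := fieldLogPartition_le ha S h x
  rw [Real.norm_of_nonneg (Real.exp_pos _).le, Pi.add_apply]
  rcases abs_cases x with ⟨habs, -⟩ | ⟨habs, -⟩ <;> rw [habs] at hle
  · refine le_add_of_le_of_nonneg (Real.exp_le_exp.2 ?_) (Real.exp_pos _).le
    linarith
  · refine le_add_of_nonneg_of_le (Real.exp_pos _).le (Real.exp_le_exp.2 ?_)
    linarith

variable [Fintype ι] [DecidableEq ι]

theorem prod_cosh_mul_exp_fieldLogPartition (a : ℝ) (S : Finset ι) (h : ι → ℝ) (x : ℝ) :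
    (∏ i, (2 * Real.cosh (h i))) * Real.exp (fieldLogPartition a S h x) =
      ∏ i, (2 * Real.cosh (h i + if i ∈ S then a * x else 0)) := by
  have hexp : Real.exp (fieldLogPartition a S h x) =
      ∏ i, if i ∈ S then Real.cosh (a * x + h i) / Real.cosh (h i) else 1 := by
    rw [fieldLogPartition, Real.exp_sum, Finset.prod_ite_mem, Finset.univ_inter]
    refine Finset.prod_congr rfl fun i _ => ?_
    rw [logCosh, logCosh, Real.exp_sub, Real.exp_log (Real.cosh_pos _),
      Real.exp_log (Real.cosh_pos _)]
  rw [hexp, ← Finset.prod_mul_distrib]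
  refine Finset.prod_congr rfl fun i _ => ?_
  split_ifs
  · rw [add_comm (h i), mul_assoc, mul_div_cancel₀ _ (Real.cosh_pos _).ne']
  · simp

theorem sum_exp_blockSum (a : ℝ) (S : Finset ι) (h : ι → ℝ) (x : ℝ) :
    ∑ σ : ι → Bool, Real.exp (a * x * blockSum S σ) * ∏ i, Real.exp (h i * spin (σ i)) =
      (∏ i, (2 * Real.cosh (h i))) * Real.exp (fieldLogPartition a S h x) := by
  rw [prod_cosh_mul_exp_fieldLogPartition, ← sum_prod_exp_spin]
  refine Finset.sum_congr rfl fun σ _ => ?_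
  rw [← Real.exp_sum, ← Real.exp_sum, ← Real.exp_add]
  simp only [add_mul, Finset.sum_add_distrib, ite_mul, zero_mul]
  rw [Finset.sum_ite_mem, Finset.univ_inter, blockSum, Finset.mul_sum, add_comm]

theorem sum_exp_linear_blockSum (a B : ℝ) (S : Finset ι) (h : ι → ℝ) (x : ℝ) :
    ∑ σ : ι → Bool, Real.exp (-B * x ^ 2 + a * blockSum S σ * x) *
        ∏ i, Real.exp (h i * spin (σ i)) =
      (∏ i, (2 * Real.cosh (h i))) * Real.exp (-B * x ^ 2 + fieldLogPartition a S h x) := by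
  rw [Real.exp_add (-B * x ^ 2) (fieldLogPartition _ _ _ _), mul_left_comm, ← sum_exp_blockSum,
    Finset.mul_sum]
  refine Finset.sum_congr rfl fun σ _ => ?_
  rw [Real.exp_add, mul_assoc, mul_right_comm a]

/-- Hubbard–Stratonovich: a Gaussian mean field linearizes the quadratic interaction. -/
theorem sum_exp_sq_blockSum {θ B : ℝ} (hθ : 0 ≤ θ) (hB : 0 < B) (S : Finset ι) (h : ι → ℝ) :
    ∑ σ : ι → Bool, Real.exp (θ / (4 * B) * blockSum S σ ^ 2) *
        ∏ i, Real.exp (h i * spin (σ i)) =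
      (∏ i, (2 * Real.cosh (h i))) * (√(B / Real.pi) *
        ∫ x : ℝ, Real.exp (-B * x ^ 2 + fieldLogPartition √θ S h x)) := by
  rw [mul_left_comm, ← integral_const_mul]
  simp only [← sum_exp_linear_blockSum]
  rw [integral_finsetSum _ fun σ _ => (integrable_exp_neg_mul_sq_add hB _).mul_const _,
    Finset.mul_sum]
  refine Finset.sum_congr rfl fun σ _ => ?_
  have hunit : B / Real.pi * (Real.pi / B) = 1 := by field_simp
  rw [integral_mul_const, integral_exp_neg_mul_sq_add hB, ← mul_assoc, ← mul_assoc,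
    ← Real.sqrt_mul (by positivity), hunit, Real.sqrt_one, one_mul, mul_pow, Real.sq_sqrt hθ,
    div_mul_eq_mul_div]

end FieldLogPartition

section QuenchedMoment

variable {n : ℕ} {θ : ℝ} {S : Finset (Fin n)} (h : Fin n → ℝ)

theorem sum_gibbsWeight_eq (hθ : 0 ≤ θ) (hS : S.Nonempty) :
    ∑ σ : Fin n → Bool, gibbsWeight θ S h σ = (∏ i, (2 * Real.cosh (h i))) *
      (√((S.card : ℝ) / 2 / Real.pi) *
        ∫ x : ℝ, Real.exp (-((S.card : ℝ) / 2) * x ^ 2 + fieldLogPartition √θ S h x)) := by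
  have hk : (0 : ℝ) < S.card := by exact_mod_cast Finset.card_pos.2 hS
  rw [← sum_exp_sq_blockSum hθ (half_pos hk)]
  refine Finset.sum_congr rfl fun σ _ => ?_
  rw [gibbsWeight_eq]
  ring_nf

/-- The parameter `k / 2 / (1 + 2 ε / k)` of the Gaussian mean field dominates `k / 2 - ε`, so
tilting by the magnetization costs at most a factor `exp (ε x ^ 2)` in the mean field. -/
theorem sum_gibbsWeight_mul_exp_le (hθ : 0 ≤ θ) (hS : S.Nonempty) {ε : ℝ} (hε : 0 ≤ ε)
    {f : ℝ → ℝ} (hf : Integrable f)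
    (hle : ∀ x, Real.exp (ε * x ^ 2 + (-((S.card : ℝ) / 2) * x ^ 2 +
      fieldLogPartition √θ S h x)) ≤ f x) :
    ∑ σ, gibbsWeight θ S h σ * Real.exp (θ * ε * sqMagnetization S σ) ≤
      (∏ i, (2 * Real.cosh (h i))) * (√((S.card : ℝ) / 2 / Real.pi) * ∫ x, f x) := by
  have hk : (0 : ℝ) < S.card := by exact_mod_cast Finset.card_pos.2 hS
  set k := (S.card : ℝ)
  set B := k / 2 / (1 + 2 * ε / k) with hB
  have hB0 : 0 < B := by positivity
  have hBle : B ≤ k / 2 := div_le_self (by positivity) (le_add_of_nonneg_right (by positivity))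
  have hleB : k / 2 - ε ≤ B := by
    have hdiff : B - (k / 2 - ε) = 2 * ε ^ 2 / (k + 2 * ε) := by
      rw [hB]
      field_simp
      ring
    have : 0 ≤ 2 * ε ^ 2 / (k + 2 * ε) := by positivity
    linarith
  have htilt : ∀ σ : Fin n → Bool, gibbsWeight θ S h σ * Real.exp (θ * ε * sqMagnetization S σ) =
      Real.exp (θ / (4 * B) * blockSum S σ ^ 2) * ∏ i, Real.exp (h i * spin (σ i)) := fun σ => by
    rw [gibbsWeight_eq, mul_right_comm, ← Real.exp_add, sqMagnetization, hB]
    congr 2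
    field_simp
    ring
  have hint : ∫ x : ℝ, Real.exp (-B * x ^ 2 + fieldLogPartition √θ S h x) ≤ ∫ x, f x := by
    refine integral_mono (integrable_exp_add_fieldLogPartition θ.sqrt_nonneg hB0 S h) hf fun x =>
      (Real.exp_le_exp.2 ?_).trans (hle x)
    linarith [mul_le_mul_of_nonneg_right hleB (sq_nonneg x)]
  simp only [htilt]
  rw [sum_exp_sq_blockSum hθ hB0]
  have : 0 ≤ ∫ x : ℝ, Real.exp (-B * x ^ 2 + fieldLogPartition √θ S h x) :=
    integral_nonneg fun x => (Real.exp_pos _).le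
  have : 0 ≤ ∏ i, (2 * Real.cosh (h i)) :=
    Finset.prod_nonneg fun i _ => (mul_pos two_pos (Real.cosh_pos _)).le
  gcongr

theorem sum_quenchedLaw_mul_exp_le (hθ : 0 ≤ θ) (hS : S.Nonempty) {ε q A : ℝ} (hε : 0 ≤ ε)
    (hq : 0 < q)
    (hle : ∀ x, Real.exp (ε * x ^ 2 + (-((S.card : ℝ) / 2) * x ^ 2 +
        fieldLogPartition √θ S h x)) ≤
      Real.exp A * Real.exp (-((S.card : ℝ) / 2) * x ^ 2 + fieldLogPartition √θ S h x) +
        Real.exp (-(q * √(S.card : ℝ) * |x|))) :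
    ∑ σ, quenchedLaw θ S h σ * Real.exp (θ * ε * sqMagnetization S σ) ≤
      Real.exp A + 1 / q := by
  have hk : (0 : ℝ) < S.card := by exact_mod_cast Finset.card_pos.2 hS
  have hmain := (integrable_exp_add_fieldLogPartition θ.sqrt_nonneg (half_pos hk) S h).const_mul
    (Real.exp A)
  have htail := integrable_exp_neg_mul_abs (s := q * √(S.card : ℝ)) (by positivity)
  have hquot : ∑ σ, quenchedLaw θ S h σ * Real.exp (θ * ε * sqMagnetization S σ) =
      (∑ σ, gibbsWeight θ S h σ * Real.exp (θ * ε * sqMagnetization S σ)) /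
        ∑ σ, gibbsWeight θ S h σ := by
    simp only [quenchedLaw, div_mul_eq_mul_div, Finset.sum_div]
  rw [hquot, div_le_iff₀ (partition_pos θ S h)]
  refine (sum_gibbsWeight_mul_exp_le h hθ hS hε (hmain.add htail) hle).trans ?_
  have hpartition := sum_gibbsWeight_eq h hθ hS
  have hdom := prod_cosh_le_partition S h hθ
  have htail_le := sqrt_mul_integral_exp_neg_mul_abs_le hk hq
  simp only [Pi.add_apply]
  rw [integral_add hmain htail, integral_const_mul]
  set Q := ∏ i, (2 * Real.cosh (h i))
  set Z := ∑ σ : Fin n → Bool, gibbsWeight θ S h σ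
  have : 0 ≤ Z := (partition_pos θ S h).le
  have : 0 ≤ Q := Finset.prod_nonneg fun i _ => (mul_pos two_pos (Real.cosh_pos _)).le
  calc _ = Real.exp A * Z + Q * (√((S.card : ℝ) / 2 / Real.pi) *
        ∫ x : ℝ, Real.exp (-(q * √(S.card : ℝ) * |x|))) := by rw [hpartition]; ring
    _ ≤ Real.exp A * Z + Z * (1 / q) := by gcongr
    _ = (Real.exp A + 1 / q) * Z := by ring

end QuenchedMoment

section MeanFieldWeight

theorem sq_rpow_half_mul_abs {k : ℝ} (hk : 0 ≤ k) (γ x : ℝ) :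
    (k ^ (γ / 2) * |x|) ^ 2 = k ^ γ * x ^ 2 := by
  rw [mul_pow, sq_abs, ← Real.rpow_natCast, ← Real.rpow_mul hk]
  congr 2
  push_cast
  ring

/-- The exponent `1 / (2 τ - 1)` is the one for which the critical weight `k x ^ (2 τ)` is of the
order of the fluctuation `√k |x|` on the scale `z = 1`. -/
theorem mul_pow_two_mul_eq {τ : ℕ} (hτ : 1 ≤ τ) {k : ℝ} (hk : 0 ≤ k) (x : ℝ) :
    k * x ^ (2 * τ) =
      (k ^ (1 / (2 * (τ : ℝ) - 1) / 2) * |x|) ^ (2 * τ - 1) * (√k * |x|) := by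
  have hτ' : 2 * (τ : ℝ) - 1 ≠ 0 := by
    have : (1 : ℝ) ≤ τ := by exact_mod_cast hτ
    linarith
  have hscale : (k ^ (1 / (2 * (τ : ℝ) - 1) / 2)) ^ (2 * τ - 1) = √k := by
    rw [Real.sqrt_eq_rpow, ← Real.rpow_natCast, ← Real.rpow_mul hk,
      Nat.cast_sub (by omega : 1 ≤ 2 * τ)]
    congr 1
    push_cast
    field_simp
  calc k * x ^ (2 * τ) = √k * √k * |x| ^ (2 * τ - 1 + 1) := by
        rw [Real.mul_self_sqrt hk, Nat.sub_add_cancel (by omega), (even_two_mul τ).pow_abs]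
    _ = _ := by
        rw [mul_pow, hscale, pow_succ]
        ring

theorem sq_add_fluctuation_le {g c Ξ z s : ℝ} {N : ℕ} (hg : 0 < g) (hcg : c ≤ g / 4) (hN : 2 ≤ N)
    (hz : 1 ≤ z) (hzs : z ≤ s) (hΞ : 2 * Ξ / g ≤ z ^ 2) :
    c * z ^ 2 + (-(g * (z ^ N * s)) + Ξ * s) ≤ -(g / 4 * s) := by
  have hs : 0 ≤ s := by linarith
  have hsq : z ^ 2 ≤ z ^ N := pow_le_pow_right₀ hz hN
  have hone : 1 ≤ z ^ N := one_le_pow₀ hz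
  have hfluct : Ξ * s ≤ g / 2 * (z ^ N * s) := by
    rw [div_le_iff₀ hg] at hΞ
    linarith [mul_le_mul_of_nonneg_right (hΞ.trans (mul_le_mul_of_nonneg_right hsq hg.le)) hs]
  have htilt : c * z ^ 2 ≤ g / 4 * (z ^ N * s) :=
    mul_le_mul hcg (hsq.trans (le_mul_of_one_le_right (by positivity) (hz.trans hzs)))
      (by positivity) (by positivity)
  have hrest : g / 4 * s ≤ g / 4 * (z ^ N * s) := by
    gcongr
    exact le_mul_of_one_le_left hs hone
  linarith

theorem sq_add_linear_le {k a c z x φ : ℝ} (hk : 1 ≤ k) (ha : 0 < a) (hc8 : c ≤ 1 / 8)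
    (hz : z ^ 2 ≤ k * x ^ 2) (hx : 4 * a < |x|) (hφ : φ ≤ k * (a * |x|)) :
    c * z ^ 2 + (-(k / 2) * x ^ 2 + φ) ≤ -(a / 2 * √k * |x|) := by
  have htilt : c * z ^ 2 ≤ 1 / 8 * (k * x ^ 2) := by
    nlinarith [mul_le_mul_of_nonneg_right hc8 (sq_nonneg z)]
  have hsq : k * (4 * a * |x|) ≤ k * x ^ 2 := by
    rw [← sq_abs x, sq]
    gcongr
  have hsqrt : a / 2 * √k * |x| ≤ a / 2 * k * |x| := by
    gcongr
    exact Real.sqrt_le_iff.2 ⟨by linarith, le_self_pow₀ hk two_ne_zero⟩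
  linarith

/-- Below the critical scale the tilt is bounded, and above it the mean-field weight is negligible
compared to `exp (-√k |x|)`. -/
theorem exp_meanField_le {τ : ℕ} (hτ : 2 ≤ τ) {k a g c Ξ x φ : ℝ} (hk : 1 ≤ k) (ha : 0 < a)
    (hg : 0 < g) (hc : 0 ≤ c) (hcg : c ≤ g / 4) (hc8 : c ≤ 1 / 8) (hΞ : 0 ≤ Ξ)
    (hφ : φ ≤ k * (a * |x|))
    (hφ' : |x| ≤ 4 * a → -(k / 2) * x ^ 2 + φ ≤ -(k * (g * x ^ (2 * τ))) + Ξ * (√k * |x|)) :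
    Real.exp (c * k ^ (1 / (2 * (τ : ℝ) - 1)) * x ^ 2 + (-(k / 2) * x ^ 2 + φ)) ≤
      Real.exp (1 + Ξ) * Real.exp (-(k / 2) * x ^ 2 + φ) +
        Real.exp (-(min (g / 4) (a / 2) * √k * |x|)) := by
  have hk0 : 0 ≤ k := by linarith
  have hτ' : (2 : ℝ) ≤ τ := by exact_mod_cast hτ
  have hγ : 1 / (2 * (τ : ℝ) - 1) ≤ 1 := by rw [div_le_one (by linarith)]; linarith
  rw [mul_assoc c, ← sq_rpow_half_mul_abs hk0]
  have hcrit := mul_pow_two_mul_eq (show 1 ≤ τ by omega) hk0 x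
  have hzs : k ^ (1 / (2 * (τ : ℝ) - 1) / 2) * |x| ≤ √k * |x| := by
    rw [Real.sqrt_eq_rpow]
    gcongr
  set z := k ^ (1 / (2 * (τ : ℝ) - 1) / 2) * |x|
  have hz0 : 0 ≤ z := by positivity
  rcases le_or_gt (z ^ 2) (1 + 2 * Ξ / g) with hnear | hfar
  · refine le_trans ?_ (le_add_of_nonneg_right (Real.exp_pos _).le)
    rw [← Real.exp_add, Real.exp_le_exp]
    have hΞg : c * (2 * Ξ / g) ≤ Ξ := by
      rw [← mul_div_assoc, div_le_iff₀ hg]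
      nlinarith
    linarith [mul_le_mul_of_nonneg_left hnear hc]
  refine le_trans (Real.exp_le_exp.2 ?_) (le_add_of_nonneg_left (by positivity))
  have hΞg : 0 ≤ 2 * Ξ / g := by positivity
  rcases le_or_gt |x| (4 * a) with hx | hx
  · have hz : 1 ≤ z := (one_le_sq_iff₀ hz0).1 (by linarith)
    have := sq_add_fluctuation_le hg hcg (show 2 ≤ 2 * τ - 1 by omega) hz hzs
      ((le_add_of_nonneg_left zero_le_one).trans hfar.le)
    rw [← hcrit] at this
    have := mul_le_mul_of_nonneg_right (min_le_left (g / 4) (a / 2)) (hz0.trans hzs)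
    linarith [hφ' hx]
  · have hzx : z ^ 2 ≤ k * x ^ 2 := by
      rw [← Real.sq_sqrt hk0, ← sq_abs x, ← mul_pow]
      gcongr
    have := mul_le_mul_of_nonneg_right (min_le_right (g / 4) (a / 2)) (hz0.trans hzs)
    linarith [sq_add_linear_le hk ha hc8 hzx hx hφ]

end MeanFieldWeight

section SecondDerivative

theorem abs_deriv_le_add_setIntegral {f f' : ℝ → ℝ} (hf : ∀ x, HasDerivAt f (f' x) x)
    (hcont : Continuous f') {X x : ℝ} (hx : |x| ≤ X) :
    |f x| ≤ |f 0| + ∫ t in Set.Icc (-X) X, |f' t| := by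
  have hX : 0 ≤ X := (abs_nonneg x).trans hx
  have hftc : ∫ t in (0 : ℝ)..x, f' t = f x - f 0 :=
    intervalIntegral.integral_eq_sub_of_hasDerivAt (fun t _ => hf t) (hcont.intervalIntegrable _ _)
  have hsub : Set.uIoc 0 x ⊆ Set.Icc (-X) X :=
    Set.uIoc_subset_uIcc.trans (Set.uIcc_subset_Icc ⟨by linarith, hX⟩ (abs_le.1 hx))
  have hvar : |∫ t in (0 : ℝ)..x, f' t| ≤ ∫ t in Set.Icc (-X) X, |f' t| :=
    (intervalIntegral.norm_integral_le_integral_norm_uIoc (f := f') (a := 0) (b := x)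
      (μ := volume)).trans (setIntegral_mono_set
        (hcont.abs.continuousOn.integrableOn_compact isCompact_Icc)
        (Eventually.of_forall fun t => abs_nonneg _) (LE.le.eventuallyLE hsub))
  rw [hftc] at hvar
  linarith [abs_sub_abs_le_abs_sub (f x) (f 0)]

theorem abs_sub_le_mul_of_second_deriv {f f' f'' : ℝ → ℝ} (hf : ∀ x, HasDerivAt f (f' x) x)
    (hf' : ∀ x, HasDerivAt f' (f'' x) x) (hcont : Continuous f'') {X x : ℝ} (hx : |x| ≤ X) :
    |f x - f 0| ≤ (|f' 0| + ∫ t in Set.Icc (-X) X, |f'' t|) * |x| := by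
  have hX : 0 ≤ X := (abs_nonneg x).trans hx
  have hlip := Convex.norm_image_sub_le_of_norm_hasDerivWithin_le (s := Set.Icc (-X) X)
    (fun y _ => (hf y).hasDerivWithinAt)
    (fun y hy => abs_deriv_le_add_setIntegral hf' hcont (abs_le.2 hy)) (convex_Icc _ _)
    (x := 0) (y := x) ⟨by linarith, hX⟩ (abs_le.1 hx)
  rwa [sub_zero] at hlip

end SecondDerivative

section SubGaussian

open ProbabilityTheory NNReal

theorem integral_exp_mul_abs_le_of_hasSubgaussianMGF {Ω : Type*} {mΩ : MeasurableSpace Ω}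
    {P : Measure Ω} {X : Ω → ℝ} {c : ℝ≥0} (hX : HasSubgaussianMGF X c P) (t : ℝ) :
    ∫ ω, Real.exp (t * |X ω|) ∂P ≤ 2 * Real.exp (c * t ^ 2 / 2) := by
  have hle : ∀ ω, Real.exp (t * |X ω|) ≤ Real.exp (t * X ω) + Real.exp (-t * X ω) := fun ω => by
    rcases abs_cases (X ω) with ⟨habs, -⟩ | ⟨habs, -⟩ <;> rw [habs]
    · exact le_add_of_nonneg_right (Real.exp_pos _).le
    · rw [mul_neg, ← neg_mul]
      exact le_add_of_nonneg_left (Real.exp_pos _).le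
  have hpos := hX.mgf_le t
  have hneg := hX.mgf_le (-t)
  rw [neg_sq] at hneg
  calc ∫ ω, Real.exp (t * |X ω|) ∂P
      ≤ ∫ ω, (Real.exp (t * X ω) + Real.exp (-t * X ω)) ∂P :=
        integral_mono (integrable_exp_mul_abs (hX.integrable_exp_mul t)
          (hX.integrable_exp_mul (-t)))
          ((hX.integrable_exp_mul t).add (hX.integrable_exp_mul (-t))) hle
    _ = mgf X P t + mgf X P (-t) :=
        integral_add (hX.integrable_exp_mul t) (hX.integrable_exp_mul (-t))
    _ ≤ 2 * Real.exp (c * t ^ 2 / 2) := by linarith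

theorem hasSubgaussianMGF_centered_sum {ι : Type*} [Fintype ι] {μ : Measure ℝ}
    [IsProbabilityMeasure μ] {f : ℝ → ℝ} (hf : Measurable f) {b : ℝ≥0} (hb : ∀ x, |f x| ≤ b)
    (S : Finset ι) :
    HasSubgaussianMGF (fun h : ι → ℝ => ∑ i ∈ S, (f (h i) - ∫ y, f y ∂μ)) (S.card * b ^ 2)
      (Measure.pi fun _ : ι => μ) := by
  have hsite : HasSubgaussianMGF (fun x => f x - ∫ y, f y ∂μ) (b ^ 2) μ := by
    have hoeffding := hasSubgaussianMGF_of_mem_Icc (μ := μ) hf.aemeasurable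
      (Eventually.of_forall fun x => abs_le.1 (hb x))
    have hwidth : ‖(b : ℝ) - -b‖₊ / 2 = b := by
      rw [sub_neg_eq_add, ← two_mul, nnnorm_mul, Real.nnnorm_ofNat, NNReal.nnnorm_eq]
      exact mul_div_cancel_left₀ b two_ne_zero
    rwa [hwidth] at hoeffding
  have hindep : iIndepFun (fun (i : ι) (h : ι → ℝ) => f (h i) - ∫ y, f y ∂μ)
      (Measure.pi fun _ : ι => μ) :=
    iIndepFun_pi (X := fun _ x => f x - ∫ y, f y ∂μ) fun _ => hsite.aemeasurable
  have hsum := HasSubgaussianMGF.sum_of_iIndepFun hindep (s := S) (c := fun _ => b ^ 2)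
    fun i _ => HasSubgaussianMGF.of_map (X := fun x => f x - ∫ y, f y ∂μ)
      (Y := fun h : ι → ℝ => h i) (measurable_pi_apply i).aemeasurable
      (by rwa [(measurePreserving_eval (fun _ : ι => μ) i).map_eq])
  rwa [Finset.sum_const, nsmul_eq_mul] at hsum

end SubGaussian

section Jensen

theorem exp_setIntegral_le_of_continuous {X : ℝ} (hX : 0 < X) {f : ℝ → ℝ} (hf : Continuous f) :
    Real.exp (∫ t in Set.Icc (-X) X, f t) ≤
      (2 * X)⁻¹ * ∫ t in Set.Icc (-X) X, Real.exp (2 * X * f t) := by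
  have hvol : volume.real (Set.Icc (-X) X) = 2 * X := by
    rw [Real.volume_real_Icc_of_le (by linarith)]
    ring
  have hjensen := convexOn_exp.map_set_average_le (μ := volume) (t := Set.Icc (-X) X)
    (f := fun t => 2 * X * f t) Real.continuous_exp.continuousOn isClosed_univ
    (by simpa using hX) (by simp) (Eventually.of_forall fun _ => Set.mem_univ _)
    ((continuous_const.mul hf).continuousOn.integrableOn_compact isCompact_Icc)
    ((Real.continuous_exp.comp (continuous_const.mul hf)).continuousOn.integrableOn_compact
      isCompact_Icc)
  rwa [setAverage_eq, setAverage_eq, hvol, integral_const_mul, smul_eq_mul, smul_eq_mul,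
    inv_mul_cancel_left₀ (by positivity)] at hjensen

end Jensen

section Fubini

variable {α β : Type*} {mα : MeasurableSpace α} {mβ : MeasurableSpace β} {P : Measure α}
  {ν : Measure β} [IsFiniteMeasure ν] {f : α × β → ℝ} {C : ℝ}

theorem integrable_prod_of_integral_le [SFinite P] (hf : AEStronglyMeasurable f (P.prod ν))
    (hnonneg : ∀ p, 0 ≤ f p) (hint : ∀ y, Integrable (fun x => f (x, y)) P)
    (hC : ∀ y, ∫ x, f (x, y) ∂P ≤ C) : Integrable f (P.prod ν) := by
  refine (integrable_prod_iff' hf).2 ⟨Eventually.of_forall hint, ?_⟩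
  refine (integrable_const C).mono' hf.norm.prod_swap.integral_prod_right'
    (Eventually.of_forall fun y => ?_)
  rw [Real.norm_of_nonneg (integral_nonneg fun x => norm_nonneg _)]
  simpa only [Real.norm_of_nonneg (hnonneg _)] using hC y

theorem integral_integral_le_of_integral_le [SFinite P] (hf : Integrable f (P.prod ν))
    (hC : ∀ y, ∫ x, f (x, y) ∂P ≤ C) : ∫ x, ∫ y, f (x, y) ∂ν ∂P ≤ ν.real Set.univ * C := by
  rw [integral_integral_swap (f := fun x y => f (x, y)) hf]
  exact (integral_mono hf.integral_prod_right (integrable_const C) hC).trans_eq (by simp)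

end Fubini

section FieldFluctuation

variable {ι : Type*} {μ : Measure ℝ}

/-- The normalized fluctuation `k ^ (-1/2) ∑_{i ∈ S} (g⁽ʲ⁾(h i) - 𝔼 g⁽ʲ⁾(h i))`, `k = |S|`, where
`g⁽ʲ⁾(h)` is the derivative of order `j` of `x ↦ log cosh (a x + h)`. -/
noncomputable def fieldFluctuation (μ : Measure ℝ) (a : ℝ) (j : ℕ) (S : Finset ι) (h : ι → ℝ)
    (x : ℝ) : ℝ :=
  (∑ i ∈ S, (a ^ j * iteratedDeriv j logCosh (a * x + h i) - logCoshMean μ a j x)) /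
    √(S.card : ℝ)

theorem hasDerivAt_fieldFluctuation [IsFiniteMeasure μ] (hint : Integrable (fun h : ℝ => h) μ)
    (a : ℝ) (j : ℕ) (S : Finset ι) (h : ι → ℝ) (x : ℝ) :
    HasDerivAt (fieldFluctuation μ a j S h) (fieldFluctuation μ a (j + 1) S h x) x := by
  refine (HasDerivAt.fun_sum fun i _ => ?_).div_const _
  have hlin : HasDerivAt (fun y => a * y + h i) a x := by
    simpa using ((hasDerivAt_id x).const_mul a).add_const (h i)
  refine ((((hasDerivAt_iteratedDeriv_logCosh j (a * x + h i)).comp x hlin).const_mul (a ^ j)).sub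
    (hasDerivAt_logCoshMean hint a j x)).congr_deriv ?_
  ring

theorem continuous_fieldFluctuation [IsFiniteMeasure μ] (hint : Integrable (fun h : ℝ => h) μ)
    (a : ℝ) (j : ℕ) (S : Finset ι) : Continuous (fieldFluctuation μ a j S).uncurry := by
  refine (continuous_finsetSum _ fun i _ => Continuous.sub ?_ ?_).div_const _
  · exact continuous_const.mul ((continuous_iteratedDeriv_logCosh j).comp (by fun_prop))
  · exact (continuous_logCoshMean hint a j).comp continuous_snd

theorem sqrt_card_mul_fieldFluctuation_sub (μ : Measure ℝ) (a : ℝ) {S : Finset ι}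
    (hS : S.Nonempty) (h : ι → ℝ) (x : ℝ) :
    √(S.card : ℝ) * (fieldFluctuation μ a 0 S h x - fieldFluctuation μ a 0 S h 0) =
      fieldLogPartition a S h x - S.card * (logCoshMean μ a 0 x - logCoshMean μ a 0 0) := by
  have hk : √(S.card : ℝ) ≠ 0 := by simp [hS.ne_empty]
  rw [fieldFluctuation, fieldFluctuation, ← sub_div, mul_div_cancel₀ _ hk, fieldLogPartition]
  simp only [Finset.sum_sub_distrib, iteratedDeriv_zero, pow_zero, one_mul, mul_zero, zero_add,
    Finset.sum_const, nsmul_eq_mul]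
  ring

theorem exists_hasSubgaussianMGF_fieldFluctuation (μ : Measure ℝ) [IsProbabilityMeasure μ] (a : ℝ)
    (j : ℕ) : ∃ c, ∀ (n : ℕ) (S : Finset (Fin n)) (x : ℝ), S.Nonempty →
      ProbabilityTheory.HasSubgaussianMGF (fun h => fieldFluctuation μ a (j + 1) S h x) c
        (Measure.pi fun _ : Fin n => μ) := by
  obtain ⟨C, hC⟩ := exists_abs_iteratedDeriv_logCosh_le j
  refine ⟨(|a ^ (j + 1)| * C).toNNReal ^ 2, fun n S x hS => ?_⟩
  have hC0 : 0 ≤ C := (abs_nonneg _).trans (hC 0)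
  have hmeas : Measurable fun y => a ^ (j + 1) * iteratedDeriv (j + 1) logCosh (a * x + y) :=
    (continuous_const.mul
      ((continuous_iteratedDeriv_logCosh (j + 1)).comp (by fun_prop))).measurable
  have hsum := hasSubgaussianMGF_centered_sum (μ := μ) hmeas (b := (|a ^ (j + 1)| * C).toNNReal)
    (fun y => by
      rw [Real.coe_toNNReal _ (by positivity), abs_mul]
      gcongr
      exact hC _) S
  convert hsum.const_mul (√(S.card : ℝ))⁻¹ using 1
  · ext h
    rw [fieldFluctuation, integral_const_mul, logCoshMean, div_eq_inv_mul]
  · have hk : (S.card : ℝ) ≠ 0 := by simp [hS.ne_empty]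
    refine NNReal.eq ?_
    change _ = (√(S.card : ℝ))⁻¹ ^ 2 * (S.card * ((|a ^ (j + 1)| * C).toNNReal ^ 2 : ℝ))
    rw [inv_pow, Real.sq_sqrt (Nat.cast_nonneg _), inv_mul_cancel_left₀ hk, NNReal.coe_pow]

end FieldFluctuation

section FieldSlope

variable {ι : Type*} {μ : Measure ℝ}

/-- The random slope controlling the fluctuations of the log-partition function on `[-X, X]`. -/
noncomputable def fieldSlope (μ : Measure ℝ) (a X : ℝ) (S : Finset ι) (h : ι → ℝ) : ℝ :=
  |fieldFluctuation μ a 1 S h 0| + ∫ t in Set.Icc (-X) X, |fieldFluctuation μ a 2 S h t|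

theorem fieldSlope_nonneg (μ : Measure ℝ) (a X : ℝ) (S : Finset ι) (h : ι → ℝ) :
    0 ≤ fieldSlope μ a X S h :=
  add_nonneg (abs_nonneg _) (integral_nonneg fun _ => abs_nonneg _)

theorem fieldLogPartition_le_add_fieldSlope [IsFiniteMeasure μ]
    (hint : Integrable (fun h : ℝ => h) μ) (a : ℝ) {S : Finset ι} (hS : S.Nonempty) (h : ι → ℝ)
    {X x : ℝ} (hx : |x| ≤ X) :
    fieldLogPartition a S h x ≤ S.card * (logCoshMean μ a 0 x - logCoshMean μ a 0 0) +
      fieldSlope μ a X S h * (√(S.card : ℝ) * |x|) := by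
  have hslope : |fieldFluctuation μ a 0 S h x - fieldFluctuation μ a 0 S h 0| ≤
      fieldSlope μ a X S h * |x| :=
    abs_sub_le_mul_of_second_deriv (hasDerivAt_fieldFluctuation hint a 0 S h)
      (hasDerivAt_fieldFluctuation hint a 1 S h)
      ((continuous_fieldFluctuation hint a 2 S).uncurry_left h) hx
  have := mul_le_mul_of_nonneg_left ((le_abs_self _).trans hslope) (Real.sqrt_nonneg (S.card : ℝ))
  rw [sqrt_card_mul_fieldFluctuation_sub μ a hS] at this
  linarith

theorem continuous_fieldSlope [IsFiniteMeasure μ] [Finite ι]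
    (hint : Integrable (fun h : ℝ => h) μ) (a X : ℝ) (S : Finset ι) :
    Continuous (fieldSlope μ a X S) := by
  refine ((continuous_fieldFluctuation hint a 1 S).uncurry_right 0).abs.add ?_
  exact continuous_parametric_integral_of_continuous
    (f := fun h t => |fieldFluctuation μ a 2 S h t|) (continuous_fieldFluctuation hint a 2 S).abs
    isCompact_Icc

theorem exp_fieldSlope_le [IsFiniteMeasure μ] (hint : Integrable (fun h : ℝ => h) μ) (a : ℝ)
    {X : ℝ} (hX : 0 < X) (S : Finset ι) (h : ι → ℝ) :
    Real.exp (fieldSlope μ a X S h) ≤ Real.exp (2 * |fieldFluctuation μ a 1 S h 0|) +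
      (2 * X)⁻¹ * ∫ t in Set.Icc (-X) X, Real.exp (4 * X * |fieldFluctuation μ a 2 S h t|) := by
  have hjensen := exp_setIntegral_le_of_continuous hX
    (f := fun t => 2 * |fieldFluctuation μ a 2 S h t|)
    (continuous_const.mul ((continuous_fieldFluctuation hint a 2 S).uncurry_left h).abs)
  have hscale : ∀ y, 2 * X * (2 * y) = 4 * X * y := fun y => by ring
  simp only [hscale, integral_const_mul] at hjensen
  refine le_trans ?_ (add_le_add_right hjensen _)
  rw [fieldSlope]
  set u := |fieldFluctuation μ a 1 S h 0|
  set v := ∫ t in Set.Icc (-X) X, |fieldFluctuation μ a 2 S h t|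
  rcases le_total u v with huv | huv
  · exact le_add_of_nonneg_of_le (Real.exp_pos _).le (Real.exp_le_exp.2 (by linarith))
  · exact le_add_of_le_of_nonneg (Real.exp_le_exp.2 (by linarith)) (Real.exp_pos _).le

theorem exists_integral_exp_abs_fieldFluctuation_le (μ : Measure ℝ) [IsProbabilityMeasure μ]
    (a : ℝ) (j : ℕ) (T : ℝ) : ∃ C, ∀ (n : ℕ) (S : Finset (Fin n)) (x : ℝ), S.Nonempty →
      Integrable (fun h => Real.exp (T * |fieldFluctuation μ a (j + 1) S h x|))
        (Measure.pi fun _ : Fin n => μ) ∧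
      ∫ h, Real.exp (T * |fieldFluctuation μ a (j + 1) S h x|)
        ∂(Measure.pi fun _ : Fin n => μ) ≤ C := by
  obtain ⟨c, hc⟩ := exists_hasSubgaussianMGF_fieldFluctuation μ a j
  exact ⟨2 * Real.exp (c * T ^ 2 / 2), fun n S x hS =>
    ⟨ProbabilityTheory.integrable_exp_mul_abs ((hc n S x hS).integrable_exp_mul T)
      ((hc n S x hS).integrable_exp_mul (-T)),
    integral_exp_mul_abs_le_of_hasSubgaussianMGF (hc n S x hS) T⟩⟩

theorem exists_integral_exp_fieldSlope_le [IsProbabilityMeasure μ]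
    (hint : Integrable (fun h : ℝ => h) μ) (a : ℝ) {X : ℝ} (hX : 0 < X) :
    ∃ C, ∀ (n : ℕ) (S : Finset (Fin n)), S.Nonempty →
      Integrable (fun h => Real.exp (fieldSlope μ a X S h)) (Measure.pi fun _ : Fin n => μ) ∧
      ∫ h, Real.exp (fieldSlope μ a X S h) ∂(Measure.pi fun _ : Fin n => μ) ≤ C := by
  obtain ⟨C₁, hC₁⟩ := exists_integral_exp_abs_fieldFluctuation_le μ a 0 2
  obtain ⟨C₂, hC₂⟩ := exists_integral_exp_abs_fieldFluctuation_le μ a 1 (4 * X)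
  refine ⟨C₁ + C₂, fun n S hS => ?_⟩
  have hjoint : Integrable (fun p : (Fin n → ℝ) × ℝ =>
      Real.exp (4 * X * |fieldFluctuation μ a 2 S p.1 p.2|))
      ((Measure.pi fun _ : Fin n => μ).prod (volume.restrict (Set.Icc (-X) X))) :=
    integrable_prod_of_integral_le
      (Real.continuous_exp.comp (continuous_const.mul
        (continuous_fieldFluctuation hint a 2 S).abs)).aestronglyMeasurable
      (fun p => (Real.exp_pos _).le) (fun t => (hC₂ n S t hS).1) (fun t => (hC₂ n S t hS).2)
  have hmajorant := (hC₁ n S 0 hS).1.add (hjoint.integral_prod_left.const_mul (2 * X)⁻¹)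
  have hslope : Integrable (fun h => Real.exp (fieldSlope μ a X S h))
      (Measure.pi fun _ : Fin n => μ) :=
    hmajorant.mono' (Real.continuous_exp.comp
      (continuous_fieldSlope hint a X S)).aestronglyMeasurable
      (Eventually.of_forall fun h => (Real.norm_of_nonneg (Real.exp_pos _).le).trans_le
        (exp_fieldSlope_le hint a hX S h))
  refine ⟨hslope, (integral_mono hslope hmajorant (exp_fieldSlope_le hint a hX S)).trans ?_⟩
  simp only [Pi.add_apply]
  rw [integral_add (hC₁ n S 0 hS).1 (hjoint.integral_prod_left.const_mul _), integral_const_mul]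
  refine add_le_add (hC₁ n S 0 hS).2 ?_
  have hswap := integral_integral_le_of_integral_le hjoint fun t => (hC₂ n S t hS).2
  rw [measureReal_restrict_apply_univ, Real.volume_real_Icc_of_le (by linarith), sub_neg_eq_add,
    ← two_mul] at hswap
  rwa [inv_mul_le_iff₀ (by positivity)]

end FieldSlope

section MomentBound

variable {μ : Measure ℝ} [IsProbabilityMeasure μ] {θ : ℝ} {n : ℕ} {S : Finset (Fin n)}

theorem sum_plantedLaw_mul_le {f : (Fin n → Bool) → ℝ} {Y : (Fin n → ℝ) → ℝ}
    (hY : Integrable Y (Measure.pi fun _ : Fin n => μ))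
    (hle : ∀ h, ∑ σ, quenchedLaw θ S h σ * f σ ≤ Y h) :
    ∑ σ, plantedLaw μ θ S σ * f σ ≤ ∫ h, Y h ∂(Measure.pi fun _ : Fin n => μ) := by
  have hintegrable : ∀ σ ∈ Finset.univ, Integrable (fun h => quenchedLaw θ S h σ * f σ)
      (Measure.pi fun _ : Fin n => μ) := fun σ _ => (integrable_quenchedLaw μ θ S σ).mul_const _
  simp only [plantedLaw, ← integral_mul_const]
  rw [← integral_finsetSum _ hintegrable]
  exact integral_mono (integrable_finsetSum _ hintegrable) hY hle

theorem sum_quenchedLaw_mul_le_exp_fieldSlope (hint : Integrable (fun h : ℝ => h) μ) (hθ : 0 < θ)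
    {τ : ℕ} (hτ : 2 ≤ τ) {g c : ℝ} (hg : 0 < g)
    (hflat : ∀ x, |x| ≤ 4 * √θ →
      g * x ^ (2 * τ) ≤ meanFieldFunctional μ θ x - meanFieldFunctional μ θ 0)
    (hc : 0 ≤ c) (hcg : c ≤ g / 4) (hc8 : c ≤ 1 / 8) (hS : S.Nonempty) (h : Fin n → ℝ) :
    ∑ σ, quenchedLaw θ S h σ * Real.exp (θ * c *
        ((S.card : ℝ) ^ (1 / (2 * (τ : ℝ) - 1)) * sqMagnetization S σ)) ≤
      Real.exp (1 + fieldSlope μ √θ (4 * √θ) S h) + 1 / min (g / 4) (√θ / 2) := by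
  have hk : (1 : ℝ) ≤ S.card := by exact_mod_cast hS.card_pos
  have hθ' : 0 < √θ := Real.sqrt_pos.2 hθ
  have hassoc : ∀ σ, θ * c * ((S.card : ℝ) ^ (1 / (2 * (τ : ℝ) - 1)) * sqMagnetization S σ) =
      θ * (c * (S.card : ℝ) ^ (1 / (2 * (τ : ℝ) - 1))) * sqMagnetization S σ := fun σ => by ring
  simp only [hassoc]
  refine sum_quenchedLaw_mul_exp_le h hθ.le hS (by positivity) (by positivity) fun x =>
    exp_meanField_le hτ hk hθ' hg hc hcg hc8 (fieldSlope_nonneg μ _ _ S h)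
      (fieldLogPartition_le hθ'.le S h x) fun hx => ?_
  have hmean := hflat x hx
  simp only [meanFieldFunctional_eq] at hmean
  have hscaled := mul_le_mul_of_nonneg_left hmean (zero_le_one.trans hk)
  linarith [fieldLogPartition_le_add_fieldSlope hint √θ hS h hx]

theorem exists_magnetizationMomentBound (hint : Integrable (fun h : ℝ => h) μ) (hθ : 0 < θ)
    {τ : ℕ} (hτ : 2 ≤ τ) (hflat : IsGlobalMinWithFlatness (meanFieldFunctional μ θ) τ) :
    ∃ c > 0, ∃ C, MagnetizationMomentBound μ θ (1 / (2 * (τ : ℝ) - 1)) c C := by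
  have : 0 < √θ := Real.sqrt_pos.2 hθ
  obtain ⟨g, hg, hgrowth⟩ := hflat.exists_le_sub
    (contDiff_meanFieldFunctional hint θ (2 * τ)) (4 * √θ)
  obtain ⟨C, hC⟩ := exists_integral_exp_fieldSlope_le hint √θ (X := 4 * √θ) (by positivity)
  refine ⟨θ * min (g / 4) (1 / 8), by positivity,
    Real.exp 1 * C + 1 / min (g / 4) (√θ / 2), fun n S hS => ?_⟩
  obtain ⟨hslope, hslope_le⟩ := hC n S hS
  have hquenched := sum_quenchedLaw_mul_le_exp_fieldSlope (S := S) hint hθ hτ hg hgrowth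
    (c := min (g / 4) (1 / 8)) (by positivity) (min_le_left _ _) (min_le_right _ _) hS
  simp only [Real.exp_add] at hquenched
  refine (sum_plantedLaw_mul_le ((hslope.const_mul _).add (integrable_const _))
    hquenched).trans ?_
  simp only [Pi.add_apply]
  rw [integral_add (hslope.const_mul _) (integrable_const _), integral_const_mul, integral_const,
    probReal_univ, one_smul]
  gcongr

end MomentBound

section Impossibility

variable {μ : Measure ℝ} {θ γ c C : ℝ}

theorem MagnetizationMomentBound.nonneg (hM : MagnetizationMomentBound μ θ γ c C) : 0 ≤ C :=
  (Finset.sum_nonneg fun σ _ => mul_nonneg (plantedLaw_nonneg μ θ _ σ) (Real.exp_pos _).le).trans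
    (hM 1 Finset.univ Finset.univ_nonempty)

theorem exists_mul_exp_neg_mul_le (C : ℝ) (hc : 0 < c) {a : ℝ} (ha : 0 < a) :
    ∃ D, 0 ≤ D ∧ C * Real.exp (-(c * D)) ≤ a := by
  have hlim : Tendsto (fun D => C * Real.exp (-(c * D))) atTop (𝓝 0) := by
    simpa using (Real.tendsto_exp_neg_atTop_nhds_zero.comp
      (tendsto_id.const_mul_atTop hc)).const_mul C
  exact ((eventually_ge_atTop 0).and (hlim.eventually_le_const ha)).exists

variable [IsProbabilityMeasure μ]

theorem exists_one_sub_le_minimaxRisk (hsymm : μ.map (fun h : ℝ => -h) = μ) (hθ : 0 ≤ θ)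
    (hγ₀ : 0 < γ) (hγ : γ ≤ 1 / 2) (hc : 0 < c) (hM : MagnetizationMomentBound μ θ γ c C) {η : ℝ}
    (hη : 0 < η) :
    ∃ ε > 0, ∀ n k m : ℕ, k ≤ n → 0 < k → 0 < m →
      (m : ℝ) ≤ ε * ((n : ℝ) ^ 2 * (k : ℝ) ^ (2 * γ - 4)) →
      (m : ℝ) ≤ ε * ((k : ℝ) ^ γ * Real.log n) → 1 - η ≤ minimaxRisk μ θ n k m := by
  obtain ⟨D, hD, htail⟩ := exists_mul_exp_neg_mul_le C hc
    (lt_min one_pos (by positivity : 0 < η ^ 2 / 4))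
  set c₁ := min (1 / 2) (c / 32)
  set K₁ := 2048 / c ^ 2 * Real.exp c * C ^ 2
  set K₂ := 32 * D + 2 / c₁ + 192 * θ * D
  have hc₁ : 0 < c₁ := by positivity
  obtain ⟨ε, hε, hoverlap⟩ := exists_sum_overlap_le (K₁ := K₁) (K₂ := K₂) hγ₀ (by linarith) hc₁
    (by positivity) (by positivity) (by positivity : 0 < η ^ 2 / 2)
  refine ⟨ε, hε, fun n k m hkn hk hm hglobal hlocal => ?_⟩
  have hsqrt : √(η ^ 2 / 2 + 2 * (η ^ 2 / 4)) = η := by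
    rw [← Real.sqrt_sq hη.le]
    congr 1
    rw [Real.sqrt_sq hη.le]
    ring
  rw [← hsqrt]
  refine one_sub_sqrt_le_minimaxRisk hsymm hkn (W := D * m * (k : ℝ) ^ (-γ)) ?_ ?_
  · rintro S rfl
    refine le_trans (sub_le_sub_left ?_ 1)
      (one_sub_le_sum_truncatedLaw hc.le hM (Finset.card_pos.1 hk))
    exact (pow_le_of_le_one (mul_nonneg hM.nonneg (Real.exp_pos _).le)
      (htail.trans (min_le_left _ _)) hm.ne').trans (htail.trans (min_le_right _ _))
  · rintro S rfl
    have hne := Finset.card_pos.1 hk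
    refine (Finset.sum_le_sum fun S' hS' => ?_).trans ((sum_overlapLaw_mul hkn rfl fun r =>
      Real.exp (if (r : ℝ) * (S.card : ℝ) ^ (-γ) ≤ c₁ then
        K₁ * m * (r * (S.card : ℝ) ^ (-γ)) ^ 2 else
        K₂ * (m * (r * (S.card : ℝ) ^ (-γ))))).trans_le ?_)
    · have hcard := (Finset.mem_powersetCard.1 hS').2.symm
      split_ifs with hρ
      · exact sum_truncatedLaw_mul_le_of_small_overlap hsymm hγ hc hM _ hne hcard hρ
      · exact sum_truncatedLaw_mul_le_of_large_overlap hsymm hθ hc₁ hD hne hcard (not_le.1 hρ).le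
    · gcongr
      exact hoverlap n _ m (hk.trans_le hkn) hk hm hglobal hlocal _ (overlapLaw S.card S)
        (overlapLaw_nonneg _ S) (sum_overlapLaw hkn rfl) (overlapLaw_le hkn hk rfl)
        (fun r _ hr => by rw [if_pos hr]) fun r _ hr => by rw [if_neg hr.not_ge]

theorem tendsto_minimaxRisk_of_momentBound (hsymm : μ.map (fun h : ℝ => -h) = μ) (hθ : 0 ≤ θ)
    (hγ₀ : 0 < γ) (hγ : γ ≤ 1 / 2) (hc : 0 < c) (hM : MagnetizationMomentBound μ θ γ c C)
    {k m : ℕ → ℕ} (hk : ∀ᶠ n in atTop, k n ≤ n)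
    (hglobal : (fun n => (m n : ℝ)) =o[atTop]
      fun n : ℕ => (n : ℝ) ^ 2 * (k n : ℝ) ^ (2 * γ - 4))
    (hlocal : (fun n => (m n : ℝ)) =o[atTop] fun n : ℕ => (k n : ℝ) ^ γ * Real.log n) :
    Tendsto (fun n => minimaxRisk μ θ n (k n) (m n)) atTop (𝓝 1) := by
  refine tendsto_order.2 ⟨fun b hb => ?_, fun b hb => Eventually.of_forall fun n =>
    (minimaxRisk_le_one μ θ n (k n) (m n)).trans_lt hb⟩
  obtain ⟨ε, hε, hrisk⟩ := exists_one_sub_le_minimaxRisk hsymm hθ hγ₀ hγ hc hM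
    (half_pos (sub_pos.2 hb))
  filter_upwards [hk, hglobal.bound hε, hlocal.bound hε] with n hkn hglobal_n hlocal_n
  rw [Real.norm_natCast, Real.norm_of_nonneg (by positivity)] at hglobal_n hlocal_n
  rcases (m n).eq_zero_or_pos with hm | hm
  · rwa [hm, minimaxRisk_zero_samples hsymm θ hkn]
  · refine lt_of_lt_of_le (by linarith)
      (hrisk n (k n) (m n) hkn (Nat.pos_of_ne_zero fun hk₀ => ?_) hm hglobal_n hlocal_n)
    rw [hk₀, Nat.cast_zero, Real.zero_rpow hγ₀.ne', zero_mul, mul_zero] at hlocal_n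
    exact hlocal_n.not_gt (by exact_mod_cast hm)

end Impossibility

section Rates

variable {k : ℕ → ℕ} {p γ : ℝ}

theorem eventually_one_le_log_natCast : ∀ᶠ n : ℕ in atTop, 1 ≤ Real.log n :=
  (Real.tendsto_log_atTop.comp tendsto_natCast_atTop_atTop).eventually_ge_atTop 1

theorem one_isBigO_log_natCast : (fun _ => (1 : ℝ)) =O[atTop] fun n : ℕ => Real.log n :=
  (Real.isLittleO_const_log_atTop.comp_tendsto tendsto_natCast_atTop_atTop).isBigO

theorem mul_log_isBigO_of_isBigO_div_log {f g : ℕ → ℝ}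
    (hfg : f =O[atTop] fun n => g n / Real.log n) :
    (fun n => f n * Real.log n) =O[atTop] g := by
  refine (hfg.mul (isBigO_refl (fun n : ℕ => Real.log n) atTop)).congr' EventuallyEq.rfl ?_
  filter_upwards [eventually_one_le_log_natCast] with n hn
  exact div_mul_cancel₀ _ (zero_lt_one.trans_le hn).ne'

theorem isBigO_of_isBigO_div_log {f g : ℕ → ℝ} (hfg : f =O[atTop] fun n => g n / Real.log n) :
    f =O[atTop] g := by
  simpa only [mul_one] using ((isBigO_refl f atTop).mul one_isBigO_log_natCast).trans
    (mul_log_isBigO_of_isBigO_div_log hfg)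

theorem rpow_four_sub_mul_rpow_two_mul_sub_four (hγ : γ ≠ 0) {x : ℝ} (hx : 0 ≤ x) :
    x ^ (4 - γ) * x ^ (2 * γ - 4) = x ^ γ := by
  have hexponent : 4 - γ + (2 * γ - 4) = γ := by ring
  rw [← Real.rpow_add' hx (hexponent.trans_ne hγ), hexponent]

theorem natCast_rpow_rpow_eq_sq (hp : p * (4 - γ) = 2) (n : ℕ) :
    ((n : ℝ) ^ p) ^ (4 - γ) = (n : ℝ) ^ 2 := by
  rw [← Real.rpow_mul (Nat.cast_nonneg n), hp, Real.rpow_two]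

theorem sq_mul_rpow_isBigO_rpow_mul_log (hγ₀ : γ ≠ 0) (hγ : γ ≤ 4) (hp : p * (4 - γ) = 2)
    (hk : (fun n : ℕ => (n : ℝ) ^ p) =O[atTop] fun n => (k n : ℝ)) :
    (fun n : ℕ => (n : ℝ) ^ 2 * (k n : ℝ) ^ (2 * γ - 4)) =O[atTop]
      fun n : ℕ => (k n : ℝ) ^ γ * Real.log n := by
  have hpow := (hk.rpow (sub_nonneg.2 hγ) (Eventually.of_forall fun n => Nat.cast_nonneg _)).mul
    (isBigO_refl (fun n => (k n : ℝ) ^ (2 * γ - 4)) atTop)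
  simp only [natCast_rpow_rpow_eq_sq hp,
    rpow_four_sub_mul_rpow_two_mul_sub_four hγ₀ (Nat.cast_nonneg _)] at hpow
  simpa only [mul_one] using hpow.mul one_isBigO_log_natCast

theorem rpow_mul_log_isBigO_sq_mul_rpow (hγ₀ : γ ≠ 0) (hγ : γ ≤ 3) (hp : p * (4 - γ) = 2)
    (hk : (fun n => (k n : ℝ)) =O[atTop] fun n : ℕ => (n : ℝ) ^ p / Real.log n) :
    (fun n : ℕ => (k n : ℝ) ^ γ * Real.log n) =O[atTop]
      fun n : ℕ => (n : ℝ) ^ 2 * (k n : ℝ) ^ (2 * γ - 4) := by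
  have hpow := (mul_log_isBigO_of_isBigO_div_log hk).rpow (by linarith : 0 ≤ 4 - γ)
    (Eventually.of_forall fun n => by positivity)
  simp only [natCast_rpow_rpow_eq_sq hp] at hpow
  have hlog : (fun n : ℕ => (k n : ℝ) ^ (4 - γ) * Real.log n) =O[atTop]
      fun n : ℕ => ((k n : ℝ) * Real.log n) ^ (4 - γ) := by
    refine IsBigO.of_bound' ?_
    filter_upwards [eventually_one_le_log_natCast] with n hn
    rw [Real.norm_of_nonneg (by positivity), Real.norm_of_nonneg (by positivity),
      Real.mul_rpow (by positivity) (by positivity)]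
    gcongr
    exact Real.self_le_rpow_of_one_le hn (by linarith)
  refine ((hlog.trans hpow).mul (isBigO_refl (fun n => (k n : ℝ) ^ (2 * γ - 4)) atTop)).congr_left
    fun n => ?_
  rw [mul_right_comm, rpow_four_sub_mul_rpow_two_mul_sub_four hγ₀ (Nat.cast_nonneg _)]

theorem eventually_le_of_isBigO_rpow {q : ℝ} (hq : q < 1)
    (hk : (fun n => (k n : ℝ)) =O[atTop] fun n : ℕ => (n : ℝ) ^ q) :
    ∀ᶠ n in atTop, k n ≤ n := by
  have hsublinear : (fun n : ℕ => (n : ℝ) ^ q) =o[atTop] fun n : ℕ => (n : ℝ) := by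
    have hlim := (tendsto_rpow_neg_atTop (sub_pos.2 hq)).comp tendsto_natCast_atTop_atTop
    refine (((isLittleO_one_iff ℝ).2 hlim).mul_isBigO
      (isBigO_refl (fun n : ℕ => (n : ℝ)) atTop)).congr' ?_ (by simp)
    filter_upwards [eventually_gt_atTop 0] with n hn
    rw [Function.comp_apply, neg_sub, Real.rpow_sub_one (by positivity),
      div_mul_cancel₀ _ (by positivity)]
  filter_upwards [(hk.trans_isLittleO hsublinear).bound one_pos] with n hn
  simpa using hn

theorem min_isBigO_left {f g : ℕ → ℝ} (hf : ∀ n, 0 ≤ f n) (hg : ∀ n, 0 ≤ g n) :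
    (fun n => min (f n) (g n)) =O[atTop] f :=
  isBigO_of_le _ fun n => by
    rw [Real.norm_of_nonneg (hf n), Real.norm_of_nonneg (le_min (hf n) (hg n))]
    exact min_le_left _ _

theorem min_isBigO_right {f g : ℕ → ℝ} (hf : ∀ n, 0 ≤ f n) (hg : ∀ n, 0 ≤ g n) :
    (fun n => min (f n) (g n)) =O[atTop] g := by
  simpa only [min_comm] using min_isBigO_left hg hf

variable {τ : ℕ}

theorem localRate_nonneg (τ n k : ℕ) : 0 ≤ localRate τ n k :=
  mul_nonneg (Real.rpow_nonneg (div_nonneg (Nat.cast_nonneg _) (Real.log_natCast_nonneg _)) _)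
    (Real.log_natCast_nonneg _)

theorem globalRate_nonneg (τ n k : ℕ) : 0 ≤ globalRate τ n k := by
  unfold globalRate
  positivity

theorem div_log_le_inv_log_two_mul (k : ℕ) :
    (k : ℝ) / Real.log k ≤ (Real.log 2)⁻¹ * k := by
  rcases lt_or_ge k 2 with hk | hk
  · interval_cases k <;> simp [(Real.log_pos one_lt_two).le]
  · rw [div_eq_mul_inv, mul_comm]
    gcongr
    exact_mod_cast hk

theorem one_div_two_mul_sub_one_pos (hτ : 1 ≤ τ) : 0 < 1 / (2 * (τ : ℝ) - 1) := by
  have : (1 : ℝ) ≤ τ := by exact_mod_cast hτ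
  exact one_div_pos.2 (by linarith)

theorem one_div_two_mul_sub_one_le_half (hτ : 2 ≤ τ) : 1 / (2 * (τ : ℝ) - 1) ≤ 1 / 2 := by
  have : (2 : ℝ) ≤ τ := by exact_mod_cast hτ
  exact one_div_le_one_div_of_le two_pos (by linarith)

theorem localRate_isBigO (hτ : 1 ≤ τ) (k : ℕ → ℕ) :
    (fun n => localRate τ n (k n)) =O[atTop]
      fun n : ℕ => (k n : ℝ) ^ (1 / (2 * (τ : ℝ) - 1)) * Real.log n := by
  refine IsBigO.of_bound ((Real.log 2)⁻¹ ^ (1 / (2 * (τ : ℝ) - 1)))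
    (Eventually.of_forall fun n => ?_)
  rw [Real.norm_of_nonneg (localRate_nonneg τ n _), Real.norm_of_nonneg (by positivity),
    ← mul_assoc, ← Real.mul_rpow (by positivity) (by positivity), localRate]
  gcongr
  · exact (one_div_two_mul_sub_one_pos hτ).le
  · exact div_log_le_inv_log_two_mul _

theorem globalRate_eq (hτ : 1 ≤ τ) (n k : ℕ) :
    globalRate τ n k = (n : ℝ) ^ 2 * (k : ℝ) ^ (2 * (1 / (2 * (τ : ℝ) - 1)) - 4) := by
  have := one_div_pos.1 (one_div_two_mul_sub_one_pos hτ)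
  rw [globalRate]
  congr 2
  field

/-- With `γ = 1 / (2τ - 1)`, the two rates `n ^ 2 k ^ (2γ - 4)` and `k ^ γ` cross at `k = n ^ p`
when `p (4 - γ) = 2`. -/
theorem crossover_exponent_mul (hτ : 1 ≤ τ) :
    (4 * (τ : ℝ) - 2) / (8 * (τ : ℝ) - 5) * (4 - 1 / (2 * (τ : ℝ) - 1)) = 2 := by
  have : (1 : ℝ) ≤ τ := by exact_mod_cast hτ
  have : (τ : ℝ) * 8 - 5 ≠ 0 := by linarith
  have : (τ : ℝ) * 2 - 1 ≠ 0 := by linarith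
  field

theorem globalRate_isBigO (hτ : 2 ≤ τ)
    (hk : (fun n : ℕ => (n : ℝ) ^ ((4 * (τ : ℝ) - 2) / (8 * (τ : ℝ) - 5))) =O[atTop]
      fun n => (k n : ℝ)) :
    (fun n => globalRate τ n (k n)) =O[atTop]
      fun n : ℕ => (k n : ℝ) ^ (1 / (2 * (τ : ℝ) - 1)) * Real.log n := by
  simp only [globalRate_eq (one_le_two.trans hτ)]
  exact sq_mul_rpow_isBigO_rpow_mul_log (one_div_two_mul_sub_one_pos (one_le_two.trans hτ)).ne'
    (by linarith [one_div_two_mul_sub_one_le_half hτ])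
    (crossover_exponent_mul (one_le_two.trans hτ)) hk

theorem isBigO_globalRate (hτ : 2 ≤ τ)
    (hk : (fun n => (k n : ℝ)) =O[atTop]
      fun n : ℕ => (n : ℝ) ^ ((4 * (τ : ℝ) - 2) / (8 * (τ : ℝ) - 5)) / Real.log n) :
    (fun n : ℕ => (k n : ℝ) ^ (1 / (2 * (τ : ℝ) - 1)) * Real.log n) =O[atTop]
      fun n => globalRate τ n (k n) := by
  simp only [globalRate_eq (one_le_two.trans hτ)]
  exact rpow_mul_log_isBigO_sq_mul_rpow
    (one_div_two_mul_sub_one_pos (one_le_two.trans hτ)).ne'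
    (by linarith [one_div_two_mul_sub_one_le_half hτ])
    (crossover_exponent_mul (one_le_two.trans hτ)) hk

theorem crossover_exponent_lt_one (hτ : 2 ≤ τ) :
    (4 * (τ : ℝ) - 2) / (8 * (τ : ℝ) - 5) < 1 := by
  have : (2 : ℝ) ≤ τ := by exact_mod_cast hτ
  rw [div_lt_one] <;> linarith

theorem information_exponent_lt_one (hτ : 2 ≤ τ) :
    (2 * (τ : ℝ) - 1) / (4 * (τ : ℝ) - 3) < 1 := by
  have : (2 : ℝ) ≤ τ := by exact_mod_cast hτ
  rw [div_lt_one] <;> linarith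

end Rates

theorem mainTheorem4_general (μ : Measure ℝ) [IsProbabilityMeasure μ]
    (hint : Integrable (fun h : ℝ => h) μ)
    (hsymm : μ.map (fun h : ℝ => -h) = μ)
    (θ : ℝ) (hcrit : θ = 1 / ∫ h, 1 / Real.cosh h ^ 2 ∂μ)
    (τ : ℕ) (hflat : IsGlobalMinWithFlatness (meanFieldFunctional μ θ) τ)
    (k m : ℕ → ℕ) (hk : ∀ᶠ n in atTop, k n ≤ n)
    (hglobal : (fun n => (m n : ℝ)) =o[atTop] fun n => globalRate τ n (k n))
    (hlocal : (fun n => (m n : ℝ)) =o[atTop]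
      fun n : ℕ => (k n : ℝ) ^ (1 / (2 * (τ : ℝ) - 1)) * Real.log n) :
    Tendsto (fun n => minimaxRisk μ θ n (k n) (m n)) atTop (𝓝 1) := by
  have hθ := critical_temperature_pos hcrit
  have hτ := two_le_flatness hint hcrit hflat
  obtain ⟨c, hc, C, hM⟩ := exists_magnetizationMomentBound hint hθ hτ hflat
  simp only [globalRate_eq hflat.pos] at hglobal
  exact tendsto_minimaxRisk_of_momentBound hsymm hθ.le (one_div_two_mul_sub_one_pos hflat.pos)
    (one_div_two_mul_sub_one_le_half hτ) hc hM hk hglobal hlocal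

theorem mainTheorem4 (μ : Measure ℝ) [IsProbabilityMeasure μ]
    (hint : Integrable (fun h : ℝ => h) μ)
    (hsymm : μ.map (fun h : ℝ => -h) = μ)
    (θ : ℝ) (hcrit : θ = 1 / ∫ h, 1 / Real.cosh h ^ 2 ∂μ)
    (τ : ℕ) (hflat : IsGlobalMinWithFlatness (meanFieldFunctional μ θ) τ)
    (k m : ℕ → ℕ) :
    (((fun n : ℕ => (n : ℝ) ^ ((4 * (τ : ℝ) - 2) / (8 * (τ : ℝ) - 5))) =O[atTop]
          fun n => (k n : ℝ)) →
      ((fun n => (k n : ℝ)) =O[atTop]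
          fun n : ℕ => (n : ℝ) ^ ((2 * (τ : ℝ) - 1) / (4 * (τ : ℝ) - 3))) →
      ((fun n => (m n : ℝ)) =o[atTop] fun n => globalRate τ n (k n)) →
      Tendsto (fun n => minimaxRisk μ θ n (k n) (m n)) atTop (𝓝 1)) ∧
    (((fun n => (k n : ℝ)) =O[atTop]
          fun n : ℕ => (n : ℝ) ^ ((4 * (τ : ℝ) - 2) / (8 * (τ : ℝ) - 5)) / Real.log (n : ℝ)) →
      ((fun n => (m n : ℝ)) =o[atTop] fun n => localRate τ n (k n)) →
      Tendsto (fun n => minimaxRisk μ θ n (k n) (m n)) atTop (𝓝 1)) ∧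
    (((fun n => (k n : ℝ)) =o[atTop]
          fun n : ℕ => (n : ℝ) ^ ((4 * (τ : ℝ) - 2) / (8 * (τ : ℝ) - 5))) →
      ((fun n => (m n : ℝ)) =o[atTop]
          fun n => min (localRate τ n (k n)) (globalRate τ n (k n))) →
      Tendsto (fun n => minimaxRisk μ θ n (k n) (m n)) atTop (𝓝 1)) := by
  have hτ := two_le_flatness hint hcrit hflat
  have hundetectable := mainTheorem4_general μ hint hsymm θ hcrit τ hflat k m
  have hlocal := localRate_isBigO hflat.pos k
  refine ⟨fun hk_lower hk_upper hm => ?_, fun hk hm => ?_, fun hk hm => ?_⟩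
  · exact hundetectable (eventually_le_of_isBigO_rpow (information_exponent_lt_one hτ) hk_upper) hm
      (hm.trans_isBigO (globalRate_isBigO hτ hk_lower))
  · have hm' := hm.trans_isBigO hlocal
    exact hundetectable (eventually_le_of_isBigO_rpow (crossover_exponent_lt_one hτ)
      (isBigO_of_isBigO_div_log hk)) (hm'.trans_isBigO (isBigO_globalRate hτ hk)) hm'
  · have hlocal_nonneg := fun n => localRate_nonneg τ n (k n)
    have hglobal_nonneg := fun n => globalRate_nonneg τ n (k n)
    exact hundetectable (eventually_le_of_isBigO_rpow (crossover_exponent_lt_one hτ) hk.isBigO)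
      (hm.trans_isBigO (min_isBigO_right hlocal_nonneg hglobal_nonneg))
      (hm.trans_isBigO ((min_isBigO_left hlocal_nonneg hglobal_nonneg).trans hlocal))
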